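/- **Setting.** An election has $n$ voters and $m$ candidates; each voter ranks all candidates, and $\mathrm{pos}_v(c)\in\{1,\dots,m\}$ is the position of candidate $c$ in the ranking of voter $v$. The rank of $c$ is $\mathrm{rank}(c)=\min_v \mathrm{pos}_v(c)$. For a committee size $k$, STV uses the quota $q=\lfloor n/(k+1)\rfloor+1$ and works in rounds until $k$ candidates are elected or no candidate is left: if some remaining candidate is ranked first (among the remaining candidates) by at least $q$ remaining voters, then one such candidate is elected and deleted from the rankings, together with exactly $q$ of the voters who rank it first; otherwise a candidate that is ranked first by the fewest remaining voters is eliminated. A committee of size $k$ wins if some way of breaking all ties (which candidate to elect or eliminate, which $q$ voters to delete) elects it. The committee size $k$ is called normal (for $n$ voters) if $kq\le n$, i.e. the rule never has to delete more voters than there are. In the problem STV Robustness Radius we are given an election, a committee size $k$ and an integer $B\ge 0$, and ask whether the set of winning committees of size $k$ can be changed by at most $B$ swaps of adjacent candidates in the voters' rankings; the smallest such $B$ is the robustness radius of the election. **Theorem.** STV Robustness Radius, restricted to instances with a normal committee size, is fixed-parameter tractable with respect to the number $n$ of voters: there are an algorithm (a random access machine with unit-cost addition and truncated subtraction), a computable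 function $f$ and a constant $c$ such that the algorithm decides every such instance $I$ in at most $f(n)\,|I|^{c}$ steps, where $|I|$ is the length of the binary encoding of $I$. Moreover, for every election with $n$ voters and $m$ candidates and every normal committee size $k$: 1. no candidate of rank greater than $n$ belongs to a winning committee; 2. if $1\le k<m$, then the robustness radius is at most $n^2$; 3. if the set of winning committees can be changed by at most $B$ swaps of adjacent candidates, then it can also be changed by at most $\min(B,n^2)$ swaps of adjacent candidates each of which moves at least one candidate whose rank in the original election is at most $n^2+n+1$. -/

import Mathlib

namespace STVRobust

/-! ### Elections, STV and adjacent swaps -/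

/-- An election with `n` voters and `m` candidates: `P v i` is the candidate that voter `v` puts in
the `i`-th place, counted from `0` (the most preferred candidate). -/
abbrev Profile (n m : ℕ) : Type := Fin n → Equiv.Perm (Fin m)

/-- The position of candidate `c` in the ranking of voter `v`; the top position is `1`. -/
def pos {n m : ℕ} (P : Profile n m) (v : Fin n) (c : Fin m) : ℕ := ((P v).symm c : ℕ) + 1

/-- The rank of a candidate: its best position over all voters. -/
noncomputable def rank {n m : ℕ} (P : Profile n m) (c : Fin m) : ℕ := ⨅ v, pos P v c

/-- The STV quota `⌊n / (k + 1)⌋ + 1`. -/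
def quota (n k : ℕ) : ℕ := n / (k + 1) + 1

/-- The committee size `k` is normal for `n` voters: the `k` deletions of `quota n k` voters that
fill the committee never require more voters than there are. -/
def Normal (n k : ℕ) : Prop := k * quota n k ≤ n

/-- The state of an STV count: remaining candidates, remaining voters, elected candidates. -/
structure State (n m : ℕ) where
  cands : Finset (Fin m)
  voters : Finset (Fin n)
  elected : Finset (Fin m)

/-- The remaining voters who rank `c` first among the remaining candidates. -/
def supporters {n m : ℕ} (P : Profile n m) (s : State n m) (c : Fin m) : Finset (Fin n) :=
  s.voters.filter fun v => c ∈ s.cands ∧ ∀ d ∈ s.cands, pos P v c ≤ pos P v d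

/-- One round of STV for committee size `k`, with every way of breaking ties. Rounds are executed
only while fewer than `k` candidates are elected. -/
inductive Round {n m : ℕ} (P : Profile n m) (k : ℕ) : State n m → State n m → Prop
  | elect (s : State n m) (c : Fin m) (D : Finset (Fin n))
      (hk : s.elected.card < k)
      (hc : c ∈ s.cands) (hq : quota n k ≤ (supporters P s c).card)
      (hD : D ⊆ supporters P s c) (hDq : D.card = quota n k) :
      Round P k s ⟨s.cands.erase c, s.voters \ D, insert c s.elected⟩
  | eliminate (s : State n m) (d : Fin m)
      (hk : s.elected.card < k)
      (hq : ∀ c ∈ s.cands, (supporters P s c).card < quota n k)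
      (hd : d ∈ s.cands)
      (hmin : ∀ c ∈ s.cands, (supporters P s d).card ≤ (supporters P s c).card) :
      Round P k s ⟨s.cands.erase d, s.voters, s.elected⟩

/-- The STV rule: all size-`k` committees that some way of breaking ties elects. -/
def STV {n m : ℕ} (P : Profile n m) (k : ℕ) : Set (Finset (Fin m)) :=
  {W | W.card = k ∧ ∃ s : State n m,
    Relation.ReflTransGen (Round P k) ⟨Finset.univ, Finset.univ, ∅⟩ s ∧ s.elected = W}

/-- Swap the candidates in the adjacent places `i` and `i + 1` of the ranking of voter `v`. -/
def swapAt {n m : ℕ} (P : Profile n m) (v : Fin n) (i : ℕ) (hi : i + 1 < m) : Profile n m :=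
  Function.update P v (P v * Equiv.swap ⟨i, Nat.lt_of_succ_lt hi⟩ ⟨i + 1, hi⟩)

/-- `SwapsTo S t P P'`: the profile `P'` arises from `P` by exactly `t` swaps of adjacent
candidates, each of which moves at least one candidate of `S`. -/
inductive SwapsTo {n m : ℕ} (S : Set (Fin m)) : ℕ → Profile n m → Profile n m → Prop
  | refl (P : Profile n m) : SwapsTo S 0 P P
  | step {t : ℕ} {P P' : Profile n m} (v : Fin n) (i : ℕ) (hi : i + 1 < m)
      (hS : P' v ⟨i, Nat.lt_of_succ_lt hi⟩ ∈ S ∨ P' v ⟨i + 1, hi⟩ ∈ S)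
      (h : SwapsTo S t P P') : SwapsTo S (t + 1) P (swapAt P' v i hi)

/-- At most `B` swaps of adjacent candidates, each moving at least one candidate of `S`, can change
the set of STV winning committees of size `k`. -/
def CanChangeWith {n m : ℕ} (S : Set (Fin m)) (P : Profile n m) (k B : ℕ) : Prop :=
  ∃ t ≤ B, ∃ P' : Profile n m, SwapsTo S t P P' ∧ STV P' k ≠ STV P k

/-- The question of STV Robustness Radius: can at most `B` swaps of adjacent candidates change
the set of winning committees? -/
def CanChange {n m : ℕ} (P : Profile n m) (k B : ℕ) : Prop := CanChangeWith Set.univ P k B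

/-- An input of STV Robustness Radius: an election, a committee size `k` and a budget `B`. -/
structure Instance where
  n : ℕ
  m : ℕ
  k : ℕ
  B : ℕ
  P : Profile n m

/-- An input as a list of numbers: `n`, `m`, `k`, `B`, and then the rankings of the voters one after
the other, each of them listed from its top candidate down. -/
def Instance.encode (I : Instance) : List ℕ :=
  [I.n, I.m, I.k, I.B] ++
    (List.finRange I.n).flatMap fun v => List.ofFn fun i => (I.P v i : ℕ)

/-! ### Random access machines with a step count -/

/-- Expressions over a memory that has number variables `var x` and arrays of numbers `a`, where
`get a e` is the entry of `a` at index `e`. -/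
inductive Expr : Type
  | num (c : ℕ)
  | var (x : ℕ)
  | get (a : ℕ) (e : Expr)
  | add (e₁ e₂ : Expr)
  | sub (e₁ e₂ : Expr)

/-- Structured programs of a random access machine: assignment to a variable, assignment to
an array entry, composition, branching and while loop (a condition holds if it is not `0`). -/
inductive Prog : Type
  | assign (x : ℕ) (e : Expr)
  | put (a : ℕ) (i e : Expr)
  | seq (p q : Prog)
  | ite (e : Expr) (p q : Prog)
  | loop (e : Expr) (p : Prog)

/-- Memory contents. A program mentions finitely many variables and arrays. -/
structure Memory where
  var : ℕ → ℕ
  arr : ℕ → ℕ → ℕ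

/-- Write the number `a` into variable `x`. -/
def Memory.setVar (s : Memory) (x a : ℕ) : Memory := ⟨Function.update s.var x a, s.arr⟩

/-- Write the number `b` into entry `i` of array `a`. -/
def Memory.setArr (s : Memory) (a i b : ℕ) : Memory :=
  ⟨s.var, Function.update s.arr a (Function.update (s.arr a) i b)⟩

/-- The value of an expression; `sub` is truncated subtraction. -/
def Expr.eval (s : Memory) : Expr → ℕ
  | num c => c
  | var x => s.var x
  | get a e => s.arr a (e.eval s)
  | add e₁ e₂ => e₁.eval s + e₂.eval s
  | sub e₁ e₂ => e₁.eval s - e₂.eval s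

/-- The number of steps that the evaluation of an expression takes: one per constant, variable,
array access, addition and subtraction. -/
def Expr.cost : Expr → ℕ
  | num _ => 1
  | var _ => 1
  | get _ e => e.cost + 1
  | add e₁ e₂ => e₁.cost + e₂.cost + 1
  | sub e₁ e₂ => e₁.cost + e₂.cost + 1

/-- `Exec p s t s'`: the program `p`, started with memory `s`, halts after exactly `t` steps with
memory `s'`. -/
inductive Exec : Prog → Memory → ℕ → Memory → Prop
  | assign (x : ℕ) (e : Expr) (s : Memory) :
      Exec (.assign x e) s (e.cost + 1) (s.setVar x (e.eval s))
  | put (a : ℕ) (i e : Expr) (s : Memory) :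
      Exec (.put a i e) s (i.cost + e.cost + 1)
        (s.setArr a (i.eval s) (e.eval s))
  | seq {p q : Prog} {s s' s'' : Memory} {t t' : ℕ}
      (hp : Exec p s t s') (hq : Exec q s' t' s'') : Exec (.seq p q) s (t + t') s''
  | ite_true {e : Expr} {p q : Prog} {s s' : Memory} {t : ℕ}
      (he : e.eval s ≠ 0) (hp : Exec p s t s') : Exec (.ite e p q) s (e.cost + 1 + t) s'
  | ite_false {e : Expr} {p q : Prog} {s s' : Memory} {t : ℕ}
      (he : e.eval s = 0) (hq : Exec q s t s') : Exec (.ite e p q) s (e.cost + 1 + t) s'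
  | loop_done {e : Expr} {p : Prog} {s : Memory}
      (he : e.eval s = 0) : Exec (.loop e p) s (e.cost + 1) s
  | loop_step {e : Expr} {p : Prog} {s s' s'' : Memory} {t t' : ℕ}
      (he : e.eval s ≠ 0) (hp : Exec p s t s') (hl : Exec (.loop e p) s' t' s'') :
      Exec (.loop e p) s (e.cost + 1 + t + t') s''

/-- Execution is deterministic: the running time and the final memory are unique. -/
theorem Exec.unique {p : Prog} {s s₁ s₂ : Memory} {t₁ t₂ : ℕ}
    (h₁ : Exec p s t₁ s₁) (h₂ : Exec p s t₂ s₂) : t₁ = t₂ ∧ s₁ = s₂ := by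
  induction h₁ generalizing t₂ s₂ with
  | assign x e s => cases h₂; exact ⟨rfl, rfl⟩
  | put a i e s => cases h₂; exact ⟨rfl, rfl⟩
  | seq _ _ ihp ihq =>
    cases h₂ with
    | seq hp hq =>
      obtain ⟨rfl, rfl⟩ := ihp hp
      obtain ⟨rfl, rfl⟩ := ihq hq
      exact ⟨rfl, rfl⟩
  | ite_true he _ ih =>
    cases h₂ with
    | ite_true _ hp => obtain ⟨rfl, rfl⟩ := ih hp; exact ⟨rfl, rfl⟩
    | ite_false he' _ => exact absurd he' he
  | ite_false he _ ih =>
    cases h₂ with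
    | ite_true he' _ => exact absurd he he'
    | ite_false _ hp => obtain ⟨rfl, rfl⟩ := ih hp; exact ⟨rfl, rfl⟩
  | loop_done he =>
    cases h₂ with
    | loop_done _ => exact ⟨rfl, rfl⟩
    | loop_step he' _ _ => exact absurd he he'
  | loop_step he _ _ ihp ihl =>
    cases h₂ with
    | loop_done he' => exact absurd he' he
    | loop_step _ hp hl =>
      obtain ⟨rfl, rfl⟩ := ihp hp
      obtain ⟨rfl, rfl⟩ := ihl hl
      exact ⟨rfl, rfl⟩

/-- The initial memory for the input `x`: array `0` holds `x`, everything else is `0`. -/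
def initMemory (x : List ℕ) : Memory where
  var _ := 0
  arr a i := if a = 0 then x.getD i 0 else 0

/-- The length of the encoding of an input: binary digits, with one separator per number. -/
def bitLength (x : List ℕ) : ℕ := (x.map fun a => Nat.size a + 1).sum

/-- The problem `L` on inputs of type `ι`, with encoding `enc` and parameter `κ`, is
fixed-parameter tractable: one program decides it (it accepts by leaving a nonzero number in
variable `0`) within `f (κ x) * |x| ^ c` steps, for a computable `f` and a constant `c`. -/
def IsFPT {ι : Type} (enc : ι → List ℕ) (κ : ι → ℕ) (L : ι → Prop) : Prop :=
  ∃ (p : Prog) (f : ℕ → ℕ) (c : ℕ), Computable f ∧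
    ∀ x : ι, ∃ (t : ℕ) (s : Memory), Exec p (initMemory (enc x)) t s ∧
      t ≤ f (κ x) * bitLength (enc x) ^ c ∧ (s.var 0 ≠ 0 ↔ L x)

end STVRobust

/-!
The quota `q` satisfies `(k + 1) q > n`. As long as nobody has been eliminated, every voter who is
left supports a candidate in one of its first `n` places, because fewer than `n` candidates have
been elected. The candidates outside the top `n` places therefore have no supporters: they are
never elected, they are eliminated before all others, and they leave the supporters of the others
unchanged. Hence the winning committees depend only on the order in which the voters rank the
candidates of these places.

If `1 ≤ k < m` and `k` is normal, then some committee `W` wins, and at most `k` swaps in each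
ranking move a candidate outside `W` to the top. Then nobody in `W` is supported in the first round:
either the first round elects a candidate outside `W`, or no candidate reaches the quota until the
candidates of `W` have been eliminated. So at most `n k` swaps suffice. During `B` swaps, on the
other hand, a candidate of rank greater than `B + n` stays below the first `n` places of every
ranking, so that the swaps of two such candidates can be omitted.

The algorithm keeps the candidates that some voter has in one of the first `n² + n` places; their
number is bounded in terms of `n`. Of each ranking only the places of the kept candidates remain,
and the gaps between them are cut down to a length that `n²` swaps cannot close. Whether the winning
committees can be changed is a primitive recursive property of these shortened rankings, and a
primitive recursive function is computed by a program whose running time is primitive recursive.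
-/

namespace STVRobust

open Relation

section Count

variable {n m k : ℕ} {P P' : Profile n m} {s s' : State n m} {S T W : Finset (Fin m)} {c d : Fin m}
  {v : Fin n}

theorem quota_pos (n k : ℕ) : 0 < quota n k :=
  Nat.succ_pos _

theorem Normal.le (h : Normal n k) : k ≤ n :=
  (Nat.le_mul_of_pos_right k (quota_pos n k)).trans h

theorem pos_le (P : Profile n m) (v : Fin n) (c : Fin m) : pos P v c ≤ m :=
  ((P v).symm c).isLt

theorem rank_le (P : Profile n m) (v : Fin n) (c : Fin m) : rank P c ≤ pos P v c :=
  ciInf_le ⟨0, fun _ _ => Nat.zero_le _⟩ v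

theorem mem_supporters :
    v ∈ supporters P s c ↔ v ∈ s.voters ∧ c ∈ s.cands ∧ ∀ d ∈ s.cands, pos P v c ≤ pos P v d := by
  simp only [supporters, Finset.mem_filter]

theorem supporters_subset_voters : supporters P s c ⊆ s.voters :=
  Finset.filter_subset _ _

theorem exists_mem_supporters (P : Profile n m) (h : s.cands.Nonempty) (hv : v ∈ s.voters) :
    ∃ c ∈ s.cands, v ∈ supporters P s c := by
  obtain ⟨c, hc, hmin⟩ := s.cands.exists_min_image (pos P v) h
  exact ⟨c, hc, mem_supporters.2 ⟨hv, hc, hmin⟩⟩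

theorem card_voters_le_sum_card_supporters (P : Profile n m) (h : s.cands.Nonempty) :
    s.voters.card ≤ ∑ c ∈ s.cands, (supporters P s c).card := by
  refine (Finset.card_le_card fun v hv => ?_).trans (Finset.card_biUnion_le (t := supporters P s))
  obtain ⟨c, hc, hvc⟩ := exists_mem_supporters P h hv
  exact Finset.mem_biUnion.2 ⟨c, hc, hvc⟩

/-- The state before the first round of a count in which only the candidates of `S` take part. -/
def State.start (S : Finset (Fin m)) : State n m := ⟨S, Finset.univ, ∅⟩

/-- The state after the election of `c`, for which the voters of `D` are deleted. -/
abbrev State.elect (s : State n m) (c : Fin m) (D : Finset (Fin n)) : State n m :=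
  ⟨s.cands.erase c, s.voters \ D, insert c s.elected⟩

/-- The state after the elimination of `d`. -/
abbrev State.eliminate (s : State n m) (d : Fin m) : State n m :=
  ⟨s.cands.erase d, s.voters, s.elected⟩

/-- Some way of breaking ties leads from the first state to the second one. -/
abbrev Reaches (P : Profile n m) (k : ℕ) : State n m → State n m → Prop :=
  ReflTransGen (Round P k)

/-- No remaining candidate reaches the quota, so that the next round eliminates a candidate. -/
def NoQuota (P : Profile n m) (k : ℕ) (s : State n m) : Prop :=
  ∀ c ∈ s.cands, (supporters P s c).card < quota n k

/-! ### Filling the committee -/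

/-- A state from which a committee of size `k` can still be filled if `k` is normal: there are
enough candidates left, and each election so far has cost exactly `quota n k` of the `n` voters. -/
structure Completable (k : ℕ) (s : State n m) : Prop where
  disjoint : Disjoint s.cands s.elected
  card_elected_le : s.elected.card ≤ k
  le_card : k ≤ s.elected.card + s.cands.card
  card_voters : s.voters.card + s.elected.card * quota n k = n

theorem Completable.start (hk : k ≤ m) :
    Completable k (State.start Finset.univ : State n m) where
  disjoint := Finset.disjoint_empty_right _
  card_elected_le := Nat.zero_le k
  le_card := by simpa [State.start] using hk
  card_voters := by simp [State.start]

theorem Completable.elect (hs : Completable k s) (hk : s.elected.card < k) (hc : c ∈ s.cands)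
    {D : Finset (Fin n)} (hD : D ⊆ s.voters) (hDq : D.card = quota n k) :
    Completable k (s.elect c D) := by
  have hce : c ∉ s.elected := Finset.disjoint_left.1 hs.disjoint hc
  have helected := Finset.card_insert_of_notMem hce
  have hvoters := Finset.card_sdiff_of_subset hD
  have hle := Finset.card_le_card hD
  have hcands := Finset.card_erase_add_one hc
  obtain ⟨hdisj, -, hm, hn⟩ := hs
  refine ⟨?_, by simp only; omega, by simp only; omega, ?_⟩
  · rw [Finset.disjoint_insert_right]
    exact ⟨Finset.notMem_erase c _, hdisj.mono_left (Finset.erase_subset _ _)⟩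
  · rw [helected, hvoters, add_mul]
    omega

/-- If exactly as many candidates are left as are still to be elected, then one of them reaches the
quota, since more voters are left than the candidates could share without reaching it. -/
theorem Completable.eliminate (hs : Completable k s) (hN : Normal n k)
    (hq : NoQuota P k s) (hd : d ∈ s.cands) :
    Completable k (s.eliminate d) := by
  refine ⟨hs.disjoint.mono_left (Finset.erase_subset _ _), hs.card_elected_le, ?_, hs.card_voters⟩
  suffices hlt : k < s.elected.card + s.cands.card by
    have := Finset.card_erase_add_one hd
    simp only
    omega
  refine hs.le_card.lt_of_ne fun heq => ?_
  have hfew : ∑ c ∈ s.cands, (supporters P s c).card < s.cands.card * quota n k := by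
    simpa using Finset.sum_lt_sum_of_nonempty ⟨d, hd⟩ hq
  have hvoters := card_voters_le_sum_card_supporters P (s := s) ⟨d, hd⟩
  have hn := hs.card_voters
  have hnormal : (s.elected.card + s.cands.card) * quota n k ≤ n := by rw [← heq]; exact hN
  rw [add_mul] at hnormal
  omega

theorem Completable.exists_reaches_card_eq (P : Profile n m) (hN : Normal n k)
    (hs : Completable k s) : ∃ s', Reaches P k s s' ∧ s'.elected.card = k := by
  induction hr : s.cands.card generalizing s with
  | zero =>
    have := hs.card_elected_le
    have := hs.le_card
    exact ⟨s, .refl, by omega⟩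
  | succ r ih =>
    obtain hfull | hk := hs.card_elected_le.eq_or_lt
    · exact ⟨s, .refl, hfull⟩
    by_cases hq : NoQuota P k s
    · have hne : s.cands.Nonempty := Finset.card_pos.1 (by omega)
      obtain ⟨d, hd, hmin⟩ := s.cands.exists_min_image (fun c => (supporters P s c).card) hne
      obtain ⟨s', hreach, hcard⟩ := ih (hs.eliminate hN hq hd)
        (by rw [Finset.card_erase_of_mem hd, hr, Nat.add_sub_cancel])
      exact ⟨s', .head (.eliminate s d hk hq hd hmin) hreach, hcard⟩
    · obtain ⟨c, hc, hcq⟩ : ∃ c ∈ s.cands, quota n k ≤ (supporters P s c).card := by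
        simpa [NoQuota] using hq
      obtain ⟨D, hD, hDq⟩ := Finset.exists_subset_card_eq hcq
      obtain ⟨s', hreach, hcard⟩ := ih (hs.elect hk hc (hD.trans supporters_subset_voters) hDq)
        (by rw [Finset.card_erase_of_mem hc, hr, Nat.add_sub_cancel])
      exact ⟨s', .head (.elect s c D hk hc hcq hD hDq) hreach, hcard⟩

theorem STV_nonempty (P : Profile n m) (hN : Normal n k) (hk : k ≤ m) : (STV P k).Nonempty := by
  obtain ⟨s, hreach, hcard⟩ := (Completable.start hk).exists_reaches_card_eq P hN
  exact ⟨s.elected, hcard, s, hreach, rfl⟩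

theorem Reaches.card_elected_mul_add_card_voters_le (h : Reaches P k (.start S) s) :
    s.elected.card * quota n k + s.voters.card ≤ n := by
  induction h with
  | refl => simp [State.start]
  | @tail s₁ s₂ _ hround ih =>
    cases hround with
    | elect c D hk hc hq hD hDq =>
      have hDv : D ⊆ s₁.voters := hD.trans supporters_subset_voters
      have hle := Finset.card_le_card hDv
      have := Nat.mul_le_mul_right (quota n k) (Finset.card_insert_le c s₁.elected)
      rw [add_mul] at this
      simp only [Finset.card_sdiff_of_subset hDv]
      omega
    | eliminate => exact ih

theorem normal_of_mem_STV (hW : W ∈ STV P k) : Normal n k := by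
  obtain ⟨hcard, s, hs, rfl⟩ := hW
  have := Reaches.card_elected_mul_add_card_voters_le hs
  rw [hcard] at this
  exact (Nat.le_add_right _ _).trans this

theorem STV_eq_empty_of_not_normal (P : Profile n m) (hN : ¬ Normal n k) : STV P k = ∅ :=
  Set.eq_empty_of_forall_notMem fun _ hW => hN (normal_of_mem_STV hW)

theorem STV_zero (P : Profile n m) : STV P 0 = {∅} := by
  ext W
  constructor
  · rintro ⟨hW, -⟩
    exact Finset.card_eq_zero.1 hW
  · rintro rfl
    exact ⟨rfl, _, .refl, rfl⟩

theorem STV_eq_of_le (P P' : Profile n m) (hN : Normal n k) (hk : m ≤ k) : STV P k = STV P' k := by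
  have hall : ∀ Q : Profile n m, ∀ W ∈ STV Q k, m = k ∧ W = Finset.univ := fun Q W hW => by
    have hle : W.card ≤ m := by simpa using W.card_le_univ
    have hmk : m = k := by have := hW.1; omega
    exact ⟨hmk, by rw [← Finset.card_eq_iff_eq_univ, hW.1, Fintype.card_fin, hmk]⟩
  have hsub : ∀ Q Q' : Profile n m, STV Q k ⊆ STV Q' k := fun Q Q' W hW => by
    obtain ⟨hmk, rfl⟩ := hall Q W hW
    obtain ⟨W', hW'⟩ := STV_nonempty Q' hN hmk.ge
    rwa [← (hall Q' W' hW').2]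
  exact (hsub _ _).antisymm (hsub _ _)

/-! ### Eliminating candidates without supporters -/

theorem supporters_eliminate (hd : supporters P s d = ∅) (hc : c ≠ d) :
    supporters P (s.eliminate d) c = supporters P s c := by
  ext v
  simp only [mem_supporters, Finset.mem_erase]
  constructor
  · rintro ⟨hv, ⟨-, hcs⟩, hmin⟩
    obtain ⟨e, he, hve⟩ := exists_mem_supporters P ⟨c, hcs⟩ hv
    have hed : e ≠ d := by rintro rfl; simp [hd] at hve
    exact ⟨hv, hcs, fun x hx => (hmin e ⟨hed, he⟩).trans ((mem_supporters.1 hve).2.2 x hx)⟩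
  · rintro ⟨hv, hcs, hmin⟩
    exact ⟨hv, ⟨hc, hcs⟩, fun x hx => hmin x hx.2⟩

theorem NoQuota.eliminate (h : NoQuota P k s) (hd : supporters P s d = ∅) :
    NoQuota P k (s.eliminate d) := by
  intro c hc
  rw [supporters_eliminate hd (Finset.ne_of_mem_erase hc)]
  exact h c (Finset.mem_of_mem_erase hc)

theorem supporters_eq_empty_of_forall_card_le
    (hmin : ∀ c ∈ s.cands, (supporters P s d).card ≤ (supporters P s c).card)
    (hc : c ∈ s.cands) (hc0 : supporters P s c = ∅) : supporters P s d = ∅ := by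
  have := hmin c hc
  rwa [hc0, Finset.card_empty, Nat.le_zero, Finset.card_eq_zero] at this

theorem Reaches.elected_subset (h : Reaches P k s s') : s.elected ⊆ s'.elected := by
  induction h with
  | refl => exact subset_rfl
  | tail _ hround ih =>
    cases hround with
    | elect => exact ih.trans (Finset.subset_insert _ _)
    | eliminate => exact ih

theorem Reaches.notMem_elected_of_notMem_cands (h : Reaches P k s s') (hc : c ∉ s.cands)
    (hce : c ∉ s.elected) : c ∉ s'.elected := by
  induction h using ReflTransGen.head_induction_on with
  | refl => exact hce
  | head hround _ ih =>
    cases hround with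
    | elect e D _ he =>
      have hne : c ≠ e := by rintro rfl; exact hc he
      exact ih (fun h => hc (Finset.mem_of_mem_erase h)) (by simp [hne, hce])
    | eliminate => exact ih (fun h => hc (Finset.mem_of_mem_erase h)) hce

/-- As long as `c` remains, only candidates without supporters are eliminated, so that nobody ever
reaches the quota before `c` is eliminated itself. -/
theorem Reaches.notMem_elected_of_noQuota (h : Reaches P k s s') (hq : NoQuota P k s)
    (hc : supporters P s c = ∅) (hce : c ∉ s.elected) : c ∉ s'.elected := by
  induction h using ReflTransGen.head_induction_on with
  | refl => exact hce
  | @head s₁ s₂ hround hreach ih =>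
    by_cases hcs : c ∈ s₁.cands
    · cases hround with
      | elect e D _ he heq => exact absurd (hq e he) heq.not_gt
      | eliminate d _ _ hd hmin =>
        have hd0 := supporters_eq_empty_of_forall_card_le hmin hcs hc
        by_cases hcd : c = d
        · exact Reaches.notMem_elected_of_notMem_cands hreach (by simp [hcd]) hce
        · exact ih (hq.eliminate hd0) (by rw [supporters_eliminate hd0 hcd, hc]) hce
    · exact Reaches.notMem_elected_of_notMem_cands (.head hround hreach) hcs hce

theorem supporters_start_univ_eq_empty (hm : 0 < m) (hc : ∀ v, P v ⟨0, hm⟩ ≠ c) :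
    supporters P (.start Finset.univ) c = ∅ := by
  refine Finset.eq_empty_of_forall_notMem fun v hv => hc v ?_
  have htop := (mem_supporters.1 hv).2.2 (P v ⟨0, hm⟩) (Finset.mem_univ _)
  simp only [pos, Equiv.symm_apply_apply] at htop
  rw [← Equiv.eq_symm_apply]
  exact Fin.ext (by simp only; omega)

/-- If the first round elects someone, it is a candidate outside `W`; otherwise the candidates of
`W`, who have no supporters, are never elected. -/
theorem notMem_STV_of_forall_top_notMem (hm : 0 < m) (hne : W.Nonempty)
    (hW : ∀ v, P v ⟨0, hm⟩ ∉ W) : W ∉ STV P k := by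
  have h0 : ∀ c ∈ W, supporters P (.start Finset.univ) c = ∅ := fun c hc =>
    supporters_start_univ_eq_empty hm fun v hv => hW v (hv ▸ hc)
  obtain ⟨w, hw⟩ := hne
  rintro ⟨-, s, hs, rfl⟩
  rcases hs.cases_head with rfl | ⟨s₁, hround, hs₁⟩
  · exact Finset.notMem_empty w hw
  · cases hround with
    | elect c D _ _ hq =>
      have hc : c ∈ s.elected := Reaches.elected_subset hs₁ (Finset.mem_insert_self c _)
      have hcard := congrArg Finset.card (h0 c hc)
      exact (quota_pos n k).not_ge (hq.trans hcard.le)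
    | eliminate d _ hq =>
      exact Reaches.notMem_elected_of_noQuota hs hq (h0 w hw) (Finset.notMem_empty w) hw

/-! ### Restricting the race to the candidates in the top places -/

/-- The set `T` contains every candidate that some voter has in one of the first `n` places. -/
def CoversTop (P : Profile n m) (T : Finset (Fin m)) : Prop :=
  ∀ c ∉ T, ∀ v, n < pos P v c

/-- The three phases of a count with respect to a set `T` that covers the top places: until the
first elimination all candidates are still there or elected; then candidates without supporters are
eliminated and the supporters of the others do not change; finally only candidates of `T` are left.
-/
structure TopInvariant (P : Profile n m) (k : ℕ) (T : Finset (Fin m)) (s : State n m) : Prop where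
  elected_subset : s.elected ⊆ T
  phase : s.cands ⊆ T ∨
    s.cands ∪ s.elected = Finset.univ ∧ s.elected.card + s.voters.card ≤ n ∨
    NoQuota P k s ∧ ∀ v ∈ s.voters, ∃ d ∈ s.cands, pos P v d ≤ n

theorem exists_mem_cands_pos_le (hc : n < pos P v c) (hall : s.cands ∪ s.elected = Finset.univ)
    (hlt : s.elected.card < n) : ∃ d ∈ s.cands, pos P v d ≤ n := by
  by_contra! hlow
  have hnm : n ≤ m := (hc.trans_le (pos_le P v c)).le
  have htop : ∀ i : Fin n, P v (i.castLE hnm) ∈ s.elected := fun i => by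
    have hmem : P v (i.castLE hnm) ∈ s.cands ∪ s.elected := hall ▸ Finset.mem_univ _
    refine (Finset.mem_union.1 hmem).resolve_left fun hi => (hlow _ hi).not_ge ?_
    rw [pos, Equiv.symm_apply_apply]
    exact i.isLt
  have hle : (Finset.univ : Finset (Fin n)).card ≤ s.elected.card :=
    Finset.card_le_card_of_injOn _ (fun i _ => htop i)
      (((P v).injective.comp (Fin.castLE_injective hnm)).injOn)
  rw [Finset.card_fin] at hle
  exact hlt.not_ge hle

theorem TopInvariant.exists_mem_cands_pos_le (hT : CoversTop P T) (h : TopInvariant P k T s)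
    (hsub : ¬ s.cands ⊆ T) (hv : v ∈ s.voters) : ∃ d ∈ s.cands, pos P v d ≤ n := by
  obtain ⟨z, -, hzT⟩ := Finset.not_subset.1 hsub
  rcases h.phase with h | ⟨hall, hcard⟩ | ⟨-, htop⟩
  · exact absurd h hsub
  · have : 0 < s.voters.card := Finset.card_pos.2 ⟨v, hv⟩
    exact STVRobust.exists_mem_cands_pos_le (hT z hzT v) hall (by omega)
  · exact htop v hv

theorem TopInvariant.supporters_eq_empty (hT : CoversTop P T) (h : TopInvariant P k T s)
    (hc : c ∉ T) : supporters P s c = ∅ := by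
  refine Finset.eq_empty_of_forall_notMem fun v hv => ?_
  obtain ⟨hvs, hcs, hmin⟩ := mem_supporters.1 hv
  obtain ⟨d, hd, hdn⟩ := h.exists_mem_cands_pos_le hT (fun hsub => hc (hsub hcs)) hvs
  exact ((hmin d hd).trans hdn).not_gt (hT c hc v)

theorem TopInvariant.mem_of_quota_le (hT : CoversTop P T) (h : TopInvariant P k T s)
    (hq : quota n k ≤ (supporters P s c).card) : c ∈ T := by
  by_contra hc
  rw [h.supporters_eq_empty hT hc, Finset.card_empty] at hq
  exact (quota_pos n k).not_ge hq

theorem TopInvariant.start (P : Profile n m) (k : ℕ) (T : Finset (Fin m)) :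
    TopInvariant P k T (.start Finset.univ) :=
  ⟨Finset.empty_subset _, .inr (.inl ⟨by simp [State.start], by simp [State.start]⟩)⟩

theorem TopInvariant.round (hT : CoversTop P T) (h : TopInvariant P k T s)
    (hround : Round P k s s') : TopInvariant P k T s' := by
  cases hround with
  | elect c D _ hc hq hD hDq =>
    refine ⟨Finset.insert_subset (h.mem_of_quota_le hT hq) h.elected_subset, ?_⟩
    rcases h.phase with hsub | ⟨hall, hcard⟩ | ⟨hno, -⟩
    · exact .inl ((Finset.erase_subset _ _).trans hsub)
    · refine .inr (.inl ⟨?_, ?_⟩)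
      · rw [Finset.union_insert, ← Finset.insert_union, Finset.insert_erase hc, hall]
      · have hDv : D ⊆ s.voters := hD.trans supporters_subset_voters
        have := Finset.card_insert_le c s.elected
        have := Finset.card_le_card hDv
        have := quota_pos n k
        simp only [Finset.card_sdiff_of_subset hDv]
        omega
    · exact absurd (hno c hc) hq.not_gt
  | eliminate d _ hq hd hmin =>
    refine ⟨h.elected_subset, ?_⟩
    by_cases hsub : s.cands ⊆ T
    · exact .inl ((Finset.erase_subset _ _).trans hsub)
    obtain ⟨z, hz, hzT⟩ := Finset.not_subset.1 hsub
    have hd0 := supporters_eq_empty_of_forall_card_le hmin hz (h.supporters_eq_empty hT hzT)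
    refine .inr (.inr ⟨NoQuota.eliminate hq hd0, fun v hv => ?_⟩)
    obtain ⟨e, he, hen⟩ := h.exists_mem_cands_pos_le hT hsub hv
    obtain ⟨c, hc, hvc⟩ := exists_mem_supporters P ⟨z, hz⟩ hv
    have hcd : c ≠ d := by rintro rfl; simp [hd0] at hvc
    exact ⟨c, Finset.mem_erase.2 ⟨hcd, hc⟩, ((mem_supporters.1 hvc).2.2 e he).trans hen⟩

theorem Reaches.topInvariant (hT : CoversTop P T) (h : Reaches P k (.start Finset.univ) s) :
    TopInvariant P k T s := by
  induction h with
  | refl => exact .start P k T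
  | tail _ hround ih => exact ih.round hT hround

theorem subset_of_mem_STV (hT : CoversTop P T) (hW : W ∈ STV P k) : W ⊆ T := by
  obtain ⟨-, s, hs, rfl⟩ := hW
  exact (Reaches.topInvariant hT hs).elected_subset

theorem notMem_of_mem_STV_of_lt_rank (hc : n < rank P c) (hW : W ∈ STV P k) : c ∉ W := by
  have hT : CoversTop P (Finset.univ.erase c) := fun d hd v => by
    obtain rfl : d = c := by simpa using hd
    exact hc.trans_le (rank_le P v d)
  exact fun hcW => Finset.notMem_erase c _ (subset_of_mem_STV hT hW hcW)

/-- Only the candidates of `T` stay in the race. -/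
abbrev State.restrict (s : State n m) (T : Finset (Fin m)) : State n m :=
  ⟨s.cands ∩ T, s.voters, s.elected⟩

theorem State.restrict_eliminate_of_notMem (hd : d ∉ T) :
    (s.eliminate d).restrict T = s.restrict T := by
  simp only [State.restrict, Finset.erase_inter,
    Finset.erase_eq_of_notMem (fun h => hd (Finset.mem_inter.1 h).2)]

theorem TopInvariant.supporters_restrict (hT : CoversTop P T) (h : TopInvariant P k T s)
    (hc : c ∈ T) : supporters P (s.restrict T) c = supporters P s c := by
  ext v
  simp only [mem_supporters, Finset.mem_inter]
  constructor
  · rintro ⟨hv, ⟨hcs, -⟩, hmin⟩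
    refine ⟨hv, hcs, fun d hd => ?_⟩
    by_cases hdT : d ∈ T
    · exact hmin d ⟨hd, hdT⟩
    obtain ⟨e, he, hen⟩ := h.exists_mem_cands_pos_le hT (fun hsub => hdT (hsub hd)) hv
    have heT : e ∈ T := by
      by_contra heT
      exact (hT e heT v).not_ge hen
    exact ((hmin e ⟨he, heT⟩).trans hen).trans (hT d hdT v).le
  · rintro ⟨hv, hcs, hmin⟩
    exact ⟨hv, ⟨hcs, hc⟩, fun d hd => hmin d hd.1⟩

theorem TopInvariant.noQuota_restrict_iff (hT : CoversTop P T) (h : TopInvariant P k T s) :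
    NoQuota P k (s.restrict T) ↔ NoQuota P k s := by
  constructor <;> intro hq c hc
  · by_cases hcT : c ∈ T
    · rw [← h.supporters_restrict hT hcT]
      exact hq c (Finset.mem_inter.2 ⟨hc, hcT⟩)
    · rw [h.supporters_eq_empty hT hcT, Finset.card_empty]
      exact quota_pos n k
  · obtain ⟨hcs, hcT⟩ := Finset.mem_inter.1 hc
    rw [h.supporters_restrict hT hcT]
    exact hq c hcs

theorem TopInvariant.reaches_restrict_of_round (hT : CoversTop P T) (h : TopInvariant P k T s)
    (hround : Round P k s s') : Reaches P k (s.restrict T) (s'.restrict T) := by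
  cases hround with
  | elect c D hk hc hq hD hDq =>
    have hcT := h.mem_of_quota_le hT hq
    rw [← h.supporters_restrict hT hcT] at hq hD
    have := Round.elect (s.restrict T) c D hk (Finset.mem_inter.2 ⟨hc, hcT⟩) hq hD hDq
    rw [← Finset.erase_inter] at this
    exact .single this
  | eliminate d hk hq hd hmin =>
    by_cases hdT : d ∈ T
    · have := Round.eliminate (s.restrict T) d hk ((h.noQuota_restrict_iff hT).2 hq)
        (Finset.mem_inter.2 ⟨hd, hdT⟩) fun c hc => by
          obtain ⟨hcs, hcT⟩ := Finset.mem_inter.1 hc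
          rw [h.supporters_restrict hT hcT, h.supporters_restrict hT hdT]
          exact hmin c hcs
      rw [← Finset.erase_inter] at this
      exact .single this
    · rw [State.restrict_eliminate_of_notMem hdT]

theorem Reaches.restrict (hT : CoversTop P T) (h : Reaches P k (.start Finset.univ) s) :
    Reaches P k (.start T) (s.restrict T) := by
  induction h with
  | refl => simp [State.start, State.restrict, ReflTransGen.refl]
  | tail hreach hround ih =>
    exact ih.trans ((Reaches.topInvariant hT hreach).reaches_restrict_of_round hT hround)

theorem TopInvariant.reaches_restrict_of_noQuota (hT : CoversTop P T) (h : TopInvariant P k T s)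
    (hk : s.elected.card < k) (hq : NoQuota P k s) : Reaches P k s (s.restrict T) := by
  induction hr : (s.cands \ T).card generalizing s with
  | zero =>
    rw [Finset.card_eq_zero, Finset.sdiff_eq_empty_iff_subset] at hr
    rw [State.restrict, Finset.inter_eq_left.2 hr]
  | succ r ih =>
    obtain ⟨z, hz⟩ := Finset.card_pos.1 (by omega : 0 < (s.cands \ T).card)
    obtain ⟨hzs, hzT⟩ := Finset.mem_sdiff.1 hz
    have hz0 := h.supporters_eq_empty hT hzT
    have hround : Round P k s (s.eliminate z) := .eliminate s z hk hq hzs (by simp [hz0])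
    rw [← State.restrict_eliminate_of_notMem hzT]
    refine .head hround (ih (h.round hT hround) hk (hq.eliminate hz0) ?_)
    rw [Finset.erase_sdiff_comm, Finset.card_erase_of_mem hz, hr, Nat.add_sub_cancel]

theorem Reaches.exists_restrict_eq (hT : CoversTop P T) (h : Reaches P k (.start T) s) :
    ∃ s', Reaches P k (.start Finset.univ) s' ∧ s'.restrict T = s := by
  induction h with
  | refl => exact ⟨_, .refl, by simp [State.start, State.restrict]⟩
  | tail _ hround ih =>
    obtain ⟨s', hs', rfl⟩ := ih
    have hinv := Reaches.topInvariant hT hs'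
    cases hround with
    | elect c D hk hc hq hD hDq =>
      obtain ⟨hcs, hcT⟩ := Finset.mem_inter.1 hc
      rw [hinv.supporters_restrict hT hcT] at hq hD
      exact ⟨_, hs'.tail (.elect s' c D hk hcs hq hD hDq),
        by simp only [State.restrict, Finset.erase_inter]⟩
    | eliminate d hk hq hd hmin =>
      have hrestrict :=
        hinv.reaches_restrict_of_noQuota hT hk ((hinv.noQuota_restrict_iff hT).1 hq)
      refine ⟨_, (hs'.trans hrestrict).tail (.eliminate _ d hk hq hd hmin), ?_⟩
      simp only [State.restrict, Finset.erase_inter, Finset.inter_assoc, Finset.inter_self]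

theorem mem_STV_iff_of_coversTop (hT : CoversTop P T) :
    W ∈ STV P k ↔ W.card = k ∧ ∃ s, Reaches P k (.start T) s ∧ s.elected = W := by
  refine and_congr_right fun _ => ⟨?_, ?_⟩
  · rintro ⟨s, hs, rfl⟩
    exact ⟨_, Reaches.restrict hT hs, rfl⟩
  · rintro ⟨s, hs, rfl⟩
    obtain ⟨s', hs', rfl⟩ := Reaches.exists_restrict_eq hT hs
    exact ⟨s', hs', rfl⟩

theorem Reaches.cands_subset (h : Reaches P k s s') : s'.cands ⊆ s.cands := by
  induction h with
  | refl => exact subset_rfl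
  | tail _ hround ih => cases hround <;> exact (Finset.erase_subset _ _).trans ih

theorem Reaches.congr (hS : ∀ c ∈ S, ∀ d ∈ S, ∀ v, pos P v c ≤ pos P v d ↔ pos P' v c ≤ pos P' v d)
    (h : Reaches P k (.start S) s) : Reaches P' k (.start S) s := by
  induction h with
  | refl => exact .refl
  | @tail s₁ s₂ hreach hround ih =>
    have hsub : s₁.cands ⊆ S := Reaches.cands_subset hreach
    have hsupp : ∀ c, supporters P s₁ c = supporters P' s₁ c := fun c => by
      ext v
      simp only [mem_supporters]
      refine and_congr_right fun _ => and_congr_right fun hc => ?_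
      exact forall₂_congr fun d hd => hS c (hsub hc) d (hsub hd) v
    refine ih.tail ?_
    cases hround with
    | elect c D hk hc hq hD hDq =>
      rw [hsupp] at hq hD
      exact .elect s₁ c D hk hc hq hD hDq
    | eliminate d hk hq hd hmin =>
      simp only [hsupp] at hq hmin
      exact .eliminate s₁ d hk hq hd hmin

theorem STV_congr (hP : CoversTop P S) (hP' : CoversTop P' S)
    (hS : ∀ c ∈ S, ∀ d ∈ S, ∀ v, pos P v c ≤ pos P v d ↔ pos P' v c ≤ pos P' v d) :
    STV P k = STV P' k := by
  ext W
  rw [mem_STV_iff_of_coversTop hP, mem_STV_iff_of_coversTop hP']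
  refine and_congr_right fun _ => exists_congr fun s => and_congr_left fun _ =>
    ⟨Reaches.congr hS, Reaches.congr fun c hc d hd v => (hS c hc d hd v).symm⟩

end Count

/-! ### Swaps of adjacent candidates -/

section Swaps

variable {n m k B t t' i : ℕ} {S S' : Set (Fin m)} {P P' Q : Profile n m} {W : Finset (Fin m)}
  {u v : Fin n} {c : Fin m}

theorem SwapsTo.trans (h : SwapsTo S t P P') (h' : SwapsTo S t' P' Q) :
    SwapsTo S (t + t') P Q := by
  induction h' with
  | refl => exact h
  | step v i hi hS _ ih => exact .step v i hi hS (ih h)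

theorem SwapsTo.mono (hS : S ⊆ S') (h : SwapsTo S t P P') : SwapsTo S' t P P' := by
  induction h with
  | refl => exact .refl _
  | step v i hi hmem _ ih => exact .step v i hi (hmem.imp (@hS _) (@hS _)) ih

theorem CanChangeWith.mono {B' : ℕ} (hS : S ⊆ S') (hB : B ≤ B') (h : CanChangeWith S P k B) :
    CanChangeWith S' P k B' := by
  obtain ⟨t, ht, P', hP, hne⟩ := h
  exact ⟨t, ht.trans hB, P', hP.mono hS, hne⟩

theorem swapAt_self (P : Profile n m) (v : Fin n) (hi : i + 1 < m) :
    swapAt P v i hi v = P v * Equiv.swap ⟨i, Nat.lt_of_succ_lt hi⟩ ⟨i + 1, hi⟩ := by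
  simp [swapAt]

theorem swapAt_of_ne (P : Profile n m) (hi : i + 1 < m) (h : u ≠ v) :
    swapAt P v i hi u = P u := by
  simp [swapAt, h]

theorem symm_swapAt_self (P : Profile n m) (v : Fin n) (hi : i + 1 < m) (c : Fin m) :
    (swapAt P v i hi v).symm c =
      Equiv.swap ⟨i, Nat.lt_of_succ_lt hi⟩ ⟨i + 1, hi⟩ ((P v).symm c) := by
  rw [swapAt_self, Equiv.symm_apply_eq]
  simp

theorem pos_le_pos_swapAt (P : Profile n m) (u v : Fin n) (hi : i + 1 < m) (c : Fin m) :
    pos P u c ≤ pos (swapAt P v i hi) u c + 1 := by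
  by_cases huv : u = v
  · subst huv
    simp only [pos, symm_swapAt_self]
    rw [Equiv.swap_apply_def]
    split_ifs with h₁ h₂
    · simp [h₁]
    · simp [h₂]
    · omega
  · simp [pos, swapAt_of_ne P hi huv]

theorem SwapsTo.pos_le (h : SwapsTo S t P P') (v : Fin n) (c : Fin m) :
    pos P v c ≤ pos P' v c + t := by
  induction h with
  | refl => simp
  | @step t P P' u i hi _ _ ih =>
    have := pos_le_pos_swapAt P' v u hi c
    omega

/-- The candidates of `S` have the same places in both profiles. -/
def AgreeOn (S : Set (Fin m)) (P Q : Profile n m) : Prop :=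
  ∀ v i, P v i ∈ S ∨ Q v i ∈ S → P v i = Q v i

theorem AgreeOn.swapAt (h : AgreeOn S P Q) (v : Fin n) (hi : i + 1 < m) :
    AgreeOn S (swapAt P v i hi) (swapAt Q v i hi) := by
  intro u j
  by_cases huv : u = v
  · subst huv
    simpa only [swapAt_self, Equiv.Perm.mul_apply] using h u _
  · simpa only [swapAt_of_ne _ hi huv] using h u j

theorem AgreeOn.swapAt_left (h : AgreeOn S P Q) (hi : i + 1 < m)
    (hfst : Q v ⟨i, Nat.lt_of_succ_lt hi⟩ ∉ S) (hsnd : Q v ⟨i + 1, hi⟩ ∉ S) :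
    AgreeOn S (STVRobust.swapAt P v i hi) Q := by
  intro u j
  by_cases huv : u = v
  · subst huv
    have hnotMem : ∀ l, Q u l ∉ S → P u l ∉ S := fun l hl hP => hl (h u l (.inl hP) ▸ hP)
    rw [swapAt_self, Equiv.Perm.mul_apply, Equiv.swap_apply_def]
    split_ifs with h₁ h₂
    · subst h₁
      exact fun hS => (hS.elim (hnotMem _ hsnd) hfst).elim
    · subst h₂
      exact fun hS => (hS.elim (hnotMem _ hfst) hsnd).elim
    · exact h u j
  · simpa only [swapAt_of_ne _ hi huv] using h u j

theorem AgreeOn.pos_eq (h : AgreeOn S P Q) (hc : c ∈ S) (v : Fin n) : pos P v c = pos Q v c := by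
  have hplace : Q v ((P v).symm c) = c := by
    rw [← h v _ (.inl (by simpa using hc)), Equiv.apply_symm_apply]
  have : (P v).symm c = (Q v).symm c := by rw [Equiv.eq_symm_apply, hplace]
  rw [pos, pos, this]

theorem SwapsTo.exists_agreeOn (S : Set (Fin m)) (h : SwapsTo Set.univ t P P') :
    ∃ t' ≤ t, ∃ Q, SwapsTo S t' P Q ∧ AgreeOn S P' Q := by
  induction h with
  | refl P => exact ⟨0, le_rfl, P, .refl P, fun _ _ _ => rfl⟩
  | @step t P P' v i hi _ _ ih =>
    obtain ⟨t', ht', Q, hQ, hagree⟩ := ih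
    by_cases hmem : Q v ⟨i, Nat.lt_of_succ_lt hi⟩ ∈ S ∨ Q v ⟨i + 1, hi⟩ ∈ S
    · exact ⟨t' + 1, by omega, _, .step v i hi hmem hQ, hagree.swapAt v hi⟩
    · rw [not_or] at hmem
      exact ⟨t', by omega, Q, hQ, hagree.swapAt_left hi hmem.1 hmem.2⟩

theorem SwapsTo.coversTop (h : SwapsTo S t P P') (ht : t ≤ B) :
    CoversTop P' (Finset.univ.filter fun c => rank P c ≤ B + n) := by
  intro c hc v
  have := h.pos_le v c
  have := rank_le P v c
  simp only [Finset.mem_filter_univ] at hc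
  omega

/-- The swaps that move no candidate of rank at most `B + n` are left out: before and after, all
other candidates are below the first `n` places of every ranking. -/
theorem CanChange.canChangeWith_rank_le (h : CanChange P k B) :
    CanChangeWith {c | rank P c ≤ B + n} P k B := by
  obtain ⟨t, ht, P', hP', hne⟩ := h
  obtain ⟨t', ht', Q, hQ, hagree⟩ := hP'.exists_agreeOn {c | rank P c ≤ B + n}
  refine ⟨t', ht'.trans ht, Q, hQ, fun heq => hne (heq ▸ ?_)⟩
  refine STV_congr (hP'.coversTop ht) (hQ.coversTop (ht'.trans ht)) fun c hc d hd v => ?_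
  rw [hagree.pos_eq (by simpa using hc), hagree.pos_eq (by simpa using hd)]

theorem exists_swapsTo_top (P : Profile n m) (v : Fin n) (hi : i < m) :
    ∃ P', SwapsTo {P v ⟨i, hi⟩} i P P' ∧ P' v ⟨0, by omega⟩ = P v ⟨i, hi⟩ ∧
      ∀ u ≠ v, P' u = P u := by
  induction i generalizing P with
  | zero => exact ⟨P, .refl P, rfl, fun _ _ => rfl⟩
  | succ i ih =>
    have hQ : swapAt P v i hi v ⟨i, by omega⟩ = P v ⟨i + 1, hi⟩ := by simp [swapAt_self]
    obtain ⟨P', hswaps, htop, hothers⟩ := ih (swapAt P v i hi) (by omega)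
    rw [hQ] at hswaps htop
    refine ⟨P', ?_, htop, fun u hu => by rw [hothers u hu, swapAt_of_ne P hi hu]⟩
    have := (SwapsTo.step (S := {P v ⟨i + 1, hi⟩}) v i hi (.inr rfl) (.refl P)).trans hswaps
    rwa [Nat.zero_add, Nat.add_comm 1 i] at this

theorem exists_place_notMem (P : Profile n m) (v : Fin n) (hk : W.card < m) :
    ∃ i, ∃ hi : i < m, i ≤ W.card ∧ P v ⟨i, hi⟩ ∉ W := by
  by_contra! hcon
  have hle := Finset.card_le_card_of_injOn (s := Finset.univ) (t := W)
    (fun i : Fin (W.card + 1) => P v (i.castLE hk))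
    (fun i _ => hcon i (i.isLt.trans_le hk) (Nat.le_of_lt_succ i.isLt))
    (((P v).injective.comp (Fin.castLE_injective hk)).injOn)
  rw [Finset.card_fin] at hle
  omega

theorem exists_swapsTo_top_notMem (P : Profile n m) (hk : W.card < m) (A : Finset (Fin n)) :
    ∃ t ≤ A.card * W.card, ∃ P', SwapsTo {c | rank P c ≤ W.card + 1} t P P' ∧
      (∀ v ∈ A, P' v ⟨0, by omega⟩ ∉ W) ∧ ∀ v ∉ A, P' v = P v := by
  induction A using Finset.induction_on with
  | empty => exact ⟨0, by simp, P, .refl P, by simp, fun _ _ => rfl⟩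
  | insert v A hv ih =>
    obtain ⟨t, ht, Q, hPQ, htopQ, hothersQ⟩ := ih
    obtain ⟨i, hi, hiW, hnotMem⟩ := exists_place_notMem P v hk
    obtain ⟨P', hQP', htop, hothers⟩ := exists_swapsTo_top Q v hi
    rw [hothersQ v hv] at hQP' htop
    refine ⟨t + i, ?_, P', hPQ.trans (hQP'.mono ?_), fun u hu => ?_, fun u hu => ?_⟩
    · rw [Finset.card_insert_of_notMem hv, add_mul]
      omega
    · rintro c rfl
      refine (rank_le P v _).trans ?_
      simpa [pos] using hiW
    · by_cases huv : u = v
      · subst huv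
        rwa [htop]
      · rw [hothers u huv]
        exact htopQ u (Finset.mem_of_mem_insert_of_ne hu huv)
    · rw [Finset.mem_insert, not_or] at hu
      rw [hothers u hu.1, hothersQ u hu.2]

/-- In every ranking a candidate outside a winning committee `W` is moved to the top. -/
theorem canChangeWith_mul (P : Profile n m) (hN : Normal n k) (h1 : 1 ≤ k) (hk : k < m) :
    CanChangeWith {c | rank P c ≤ k + 1} P k (n * k) := by
  obtain ⟨W, hW⟩ := STV_nonempty P hN hk.le
  obtain rfl : W.card = k := hW.1
  obtain ⟨t, ht, P', hP', htop, -⟩ := exists_swapsTo_top_notMem P hk Finset.univ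
  refine ⟨t, by simpa using ht, P', hP', fun heq => ?_⟩
  exact notMem_STV_of_forall_top_notMem (k := W.card) (by omega) (Finset.card_pos.1 h1)
    (fun v => htop v (Finset.mem_univ v)) (heq ▸ hW)

theorem CanChangeWith.normal (h : CanChangeWith S P k B) : Normal n k := by
  obtain ⟨-, -, P', -, hne⟩ := h
  by_contra hN
  exact hne (by rw [STV_eq_empty_of_not_normal P hN, STV_eq_empty_of_not_normal P' hN])

theorem CanChangeWith.one_le_and_lt (h : CanChangeWith S P k B) : 1 ≤ k ∧ k < m := by
  have hN := h.normal
  obtain ⟨-, -, P', -, hne⟩ := h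
  constructor
  · by_contra! hk
    obtain rfl : k = 0 := by omega
    exact hne (by rw [STV_zero, STV_zero])
  · by_contra! hk
    exact hne (STV_eq_of_le P' P hN hk)

theorem CanChange.canChangeWith_min (h : CanChange P k B) :
    CanChangeWith {c | rank P c ≤ n * (k + 1)} P k (min B (n * k)) := by
  have hN : Normal n k := CanChangeWith.normal h
  obtain ⟨h1, hk⟩ := CanChangeWith.one_le_and_lt h
  obtain hB | hB := le_total B (n * k)
  · rw [min_eq_left hB]
    refine h.canChangeWith_rank_le.mono (fun c hc => ?_) le_rfl
    simp only [Set.mem_ofPred_eq] at hc ⊢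
    rw [mul_add_one]
    omega
  · rw [min_eq_right hB]
    refine (canChangeWith_mul P hN h1 hk).mono (fun c hc => ?_) le_rfl
    simp only [Set.mem_ofPred_eq] at hc ⊢
    exact hc.trans (Nat.le_mul_of_pos_left _ (h1.trans hN.le))

theorem canChange_min_iff : CanChange P (min k (n + 1)) B ↔ CanChange P k B := by
  obtain hk | hk := le_total k (n + 1)
  · rw [min_eq_left hk]
  · have hnot : ∀ l, n + 1 ≤ l → ¬ CanChange P l B := fun l hl h => by
      have := (CanChangeWith.normal h).le
      omega
    exact iff_of_false (hnot _ (le_min hk le_rfl)) (hnot _ hk)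

end Swaps

/-! ### Tables that describe the places of a few candidates -/

section Distances

variable {ι : Type*} {r r' : ℕ} {x y δ : ℤ} {X Y X' Y' : ι → ℤ}

/-- Two distances are equal or exceed the threshold `r` in the same direction. -/
def EqUpTo (r : ℕ) (x y : ℤ) : Prop :=
  x = y ∨ (r < x ∧ r < y) ∨ (x < -r ∧ y < -r)

theorem EqUpTo.mono (h : r ≤ r') (hs : EqUpTo r' x y) : EqUpTo r x y := by
  unfold EqUpTo at *
  omega

theorem EqUpTo.eq_iff (h : EqUpTo r x y) (hδ : |δ| ≤ r) : x = δ ↔ y = δ := by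
  unfold EqUpTo at h
  rw [abs_le] at hδ
  omega

/-- Two arrangements of points on a line have the same pairwise distances up to `r`. -/
def DistEqUpTo (r : ℕ) (X Y : ι → ℤ) : Prop :=
  ∀ x y, EqUpTo r (X x - X y) (Y x - Y y)

/-- `z` after the exchange of `p` and `q`. -/
def exch {α : Type*} [DecidableEq α] (p q z : α) : α :=
  if z = p then q else if z = q then p else z

theorem exch_of_ne {α : Type*} [DecidableEq α] {p q z : α} (hp : z ≠ p) (hq : z ≠ q) :
    exch p q z = z := by
  rw [exch, if_neg hp, if_neg hq]

theorem exch_comm {α : Type*} [DecidableEq α] (p q z : α) : exch p q z = exch q p z := by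
  unfold exch
  grind

theorem cast_exch (p q z : ℕ) : ((exch p q z : ℕ) : ℤ) = exch (p : ℤ) (q : ℤ) (z : ℤ) := by
  unfold exch
  push_cast
  simp only [Nat.cast_inj]

/-- The exchange changes each distance by at most two, but distances up to `r + 1` are the same
before, so that both arrangements exchange the same points. -/
theorem DistEqUpTo.exch (h : DistEqUpTo (r + 1) X Y) {a : ι} (hδ : |δ| = 1)
    (hX : ∀ x, X' x = exch (X a) (X a + δ) (X x)) (hY : ∀ x, Y' x = exch (Y a) (Y a + δ) (Y x)) :
    DistEqUpTo r X' Y' := by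
  have heq : ∀ x, X x = X a ↔ Y x = Y a := fun x => by
    have := (h x a).eq_iff (δ := 0) (by rw [abs_zero]; positivity)
    rwa [sub_eq_zero, sub_eq_zero] at this
  have hadd : ∀ x, X x = X a + δ ↔ Y x = Y a + δ := fun x => by
    have := (h x a).eq_iff (δ := δ) (by rw [hδ]; push_cast; omega)
    rwa [sub_eq_iff_eq_add', sub_eq_iff_eq_add'] at this
  intro x y
  have hxy := h x y
  have hxa := h x a
  have hya := h y a
  rw [hX, hX, hY, hY]
  simp only [STVRobust.exch, ← heq, ← hadd]
  rw [abs_eq zero_le_one] at hδ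
  clear h heq hadd hX hY
  unfold EqUpTo at *
  push_cast at hxy hxa hya
  split_ifs <;> omega

end Distances

section Tables

variable {n m k r r' t N i a u v : ℕ} {P P' : Profile n m} {S : Finset (Fin m)} {μ : Fin m → ℕ}
  {T T' : ℕ → ℕ → ℕ} {c d : Fin m} {w : Fin n} {up : Bool}

/-- The places of the two ends, which are `-1` and `m`, and of the candidates of `S` in the ranking
of a voter. -/
def points (P : Profile n m) (S : Finset (Fin m)) (w : Fin n) : Option (Option S) → ℤ
  | none => -1
  | some none => m
  | some (some c) => ((P w).symm c : ℕ)

/-- The counterpart of `points` for a table. Row `v` of a table lists the length of the ranking of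
voter `v` in column `0` and the place of the candidate `c` in column `μ c`. -/
def tablePoints (T : ℕ → ℕ → ℕ) (S : Finset (Fin m)) (μ : Fin m → ℕ) (v : ℕ) :
    Option (Option S) → ℤ
  | none => -1
  | some none => T v 0
  | some (some c) => T v (μ c)

/-- The table `T` describes the places of `S` in the profile `P` up to the threshold `r`. -/
def Similar (r : ℕ) (P : Profile n m) (S : Finset (Fin m)) (μ : Fin m → ℕ) (T : ℕ → ℕ → ℕ) :
    Prop :=
  ∀ w : Fin n, DistEqUpTo r (points P S w) (tablePoints T S μ w)

theorem Similar.mono (h : r ≤ r') (hs : Similar r' P S μ T) : Similar r P S μ T :=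
  fun w x y => (hs w x y).mono h

theorem Similar.congr (hs : Similar r P S μ T) (hμ : ∀ c ∈ S, μ c ≤ N)
    (hT : ∀ v < n, ∀ a ≤ N, T' v a = T v a) : Similar r P S μ T' := by
  intro w
  have : tablePoints T' S μ w = tablePoints T S μ w := by
    funext x
    rcases x with _ | _ | c
    · rfl
    · simp only [tablePoints, hT w w.isLt 0 (Nat.zero_le _)]
    · simp only [tablePoints, hT w w.isLt (μ c) (hμ c c.2)]
  rw [this]
  exact hs w

/-- The table `T` orders the candidates of `S` in the same way as the profile `P`. -/
def SameOrder (P : Profile n m) (S : Finset (Fin m)) (μ : Fin m → ℕ) (T : ℕ → ℕ → ℕ) : Prop :=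
  ∀ c ∈ S, ∀ d ∈ S, ∀ w : Fin n, pos P w c ≤ pos P w d ↔ T w (μ c) ≤ T w (μ d)

theorem Similar.sameOrder (hs : Similar r P S μ T) : SameOrder P S μ T := by
  intro c hc d hd w
  have := hs w (some (some ⟨c, hc⟩)) (some (some ⟨d, hd⟩))
  simp only [points, tablePoints, EqUpTo] at this
  simp only [pos]
  omega

theorem Similar.lt_end (hs : Similar r P S μ T) (hc : c ∈ S) (w : Fin n) : T w (μ c) < T w 0 := by
  have := hs w (some none) (some (some ⟨c, hc⟩))
  simp only [points, tablePoints, EqUpTo] at this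
  omega

/-- Whether entry `a` of row `v` can move by one place, up or down, without leaving the ranking. -/
def MoveAllowed (T : ℕ → ℕ → ℕ) (v a : ℕ) (up : Bool) : Prop :=
  up = true ∧ 0 < T v a ∨ up = false ∧ T v a + 1 < T v 0

instance (T : ℕ → ℕ → ℕ) (v a : ℕ) (up : Bool) : Decidable (MoveAllowed T v a up) :=
  inferInstanceAs (Decidable (_ ∨ _))

theorem moveAllowed_true : MoveAllowed T v a true ↔ 0 < T v a := by
  simp [MoveAllowed]

theorem moveAllowed_false : MoveAllowed T v a false ↔ T v a + 1 < T v 0 := by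
  simp [MoveAllowed]

/-- The place to which entry `a` of row `v` moves. -/
def moveTarget (T : ℕ → ℕ → ℕ) (v a : ℕ) (up : Bool) : ℕ :=
  bif up then T v a - 1 else T v a + 1

/-- The table after entry `a` of row `v` has moved by one place, up or down, if it can; an entry
that has been in its new place moves to its old place. -/
def moveTable (T : ℕ → ℕ → ℕ) (v a : ℕ) (up : Bool) (u x : ℕ) : ℕ :=
  if u = v ∧ MoveAllowed T v a up then exch (T v a) (moveTarget T v a up) (T v x) else T u x

theorem moveTable_of_not_moveAllowed (h : ¬ MoveAllowed T v a up) : moveTable T v a up = T := by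
  funext u x
  simp [moveTable, h]

theorem Similar.moveAllowed_true_iff (hs : Similar (r + 1) P S μ T) (hc : c ∈ S) (w : Fin n) :
    MoveAllowed T w (μ c) true ↔ 0 < ((P w).symm c : ℕ) := by
  have := hs w none (some (some ⟨c, hc⟩))
  simp only [points, tablePoints, EqUpTo] at this
  rw [moveAllowed_true]
  omega

theorem Similar.moveAllowed_false_iff (hs : Similar (r + 1) P S μ T) (hc : c ∈ S) (w : Fin n) :
    MoveAllowed T w (μ c) false ↔ ((P w).symm c : ℕ) + 1 < m := by
  have := hs w (some none) (some (some ⟨c, hc⟩))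
  simp only [points, tablePoints, EqUpTo] at this
  rw [moveAllowed_false]
  omega

theorem points_swapAt_of_ne (P : Profile n m) (S : Finset (Fin m)) {w w' : Fin n}
    (hi : i + 1 < m) (h : w' ≠ w) : points (swapAt P w i hi) S w' = points P S w' := by
  funext x
  rcases x with _ | _ | c <;> simp [points, swapAt_of_ne P hi h]

theorem points_swapAt_self (P : Profile n m) (S : Finset (Fin m)) (w : Fin n) (hi : i + 1 < m)
    (x : Option (Option S)) :
    points (swapAt P w i hi) S w x = exch (i : ℤ) ((i : ℤ) + 1) (points P S w x) := by
  rcases x with _ | _ | c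
  · simp only [points]
    rw [exch_of_ne (by omega) (by omega)]
  · simp only [points]
    rw [exch_of_ne (by omega) (by omega)]
  · simp only [points, symm_swapAt_self, Equiv.swap_apply_def, Fin.ext_iff]
    rw [← Nat.cast_succ, ← cast_exch, exch]
    split_ifs <;> rfl

theorem tablePoints_moveTable_of_ne (T : ℕ → ℕ → ℕ) (S : Finset (Fin m)) (μ : Fin m → ℕ) (a : ℕ)
    (up : Bool) (h : u ≠ v) :
    tablePoints (moveTable T v a up) S μ u = tablePoints T S μ u := by
  funext x
  rcases x with _ | _ | c <;> simp [tablePoints, moveTable, h]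

theorem cast_moveTarget (h : MoveAllowed T v a up) :
    (moveTarget T v a up : ℤ) = T v a + bif up then -1 else 1 := by
  cases up
  · simp [moveTarget]
  · rw [moveAllowed_true] at h
    simp only [moveTarget, cond_true]
    omega

theorem tablePoints_moveTable_self (S : Finset (Fin m)) (μ : Fin m → ℕ)
    (h : MoveAllowed T v a up) (hend : T v a < T v 0) (x : Option (Option S)) :
    tablePoints (moveTable T v a up) S μ v x =
      exch (T v a : ℤ) (T v a + bif up then -1 else 1) (tablePoints T S μ v x) := by
  have htarget : moveTarget T v a up < T v 0 := by
    cases up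
    · rwa [moveAllowed_false] at h
    · simp only [moveTarget, cond_true]
      omega
  rw [← cast_moveTarget h]
  rcases x with _ | _ | d
  · simp only [tablePoints]
    rw [exch_of_ne (by omega) (by omega)]
  · simp only [tablePoints, moveTable, h, and_self, if_true]
    rw [exch_of_ne (by omega) (by omega), exch_of_ne (by omega) (by omega)]
  · simp only [tablePoints, moveTable, h, and_self, if_true]
    rw [cast_exch]

theorem Similar.moveTable_swapAt (hs : Similar (r + 1) P S μ T) (hc : c ∈ S) (hi : i + 1 < m)
    (hall : MoveAllowed T w (μ c) up)
    (hexch : ∀ z : ℤ, exch (i : ℤ) (i + 1) z =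
      exch ((P w).symm c : ℤ) ((P w).symm c + bif up then -1 else 1) z) :
    Similar r (swapAt P w i hi) S μ (moveTable T w (μ c) up) := by
  intro u
  by_cases huw : u = w
  · subst huw
    refine (hs u).exch (a := some (some ⟨c, hc⟩)) (δ := bif up then -1 else 1)
      (by cases up <;> simp) (fun x => ?_) fun x => ?_
    · rw [points_swapAt_self, hexch, points]
    · rw [tablePoints_moveTable_self S μ hall (hs.lt_end hc u) x]
      rfl
  · rw [points_swapAt_of_ne P S hi huw,
      tablePoints_moveTable_of_ne T S μ _ _ (by simpa [Fin.ext_iff] using huw)]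
    exact fun x y => (hs u x y).mono (Nat.le_succ r)

theorem Similar.swapAt_down (hs : Similar (r + 1) P S μ T) (hi : i + 1 < m) (hc : c ∈ S)
    (hci : P w ⟨i, Nat.lt_of_succ_lt hi⟩ = c) :
    Similar r (swapAt P w i hi) S μ (moveTable T w (μ c) false) := by
  have hplace : ((P w).symm c : ℕ) = i := by simp [← hci]
  refine hs.moveTable_swapAt hc hi ((hs.moveAllowed_false_iff hc w).2 (by omega)) fun z => ?_
  rw [hplace, cond_false]

theorem Similar.swapAt_up (hs : Similar (r + 1) P S μ T) (hi : i + 1 < m) (hc : c ∈ S)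
    (hci : P w ⟨i + 1, hi⟩ = c) :
    Similar r (swapAt P w i hi) S μ (moveTable T w (μ c) true) := by
  have hplace : ((P w).symm c : ℕ) = i + 1 := by simp [← hci]
  refine hs.moveTable_swapAt hc hi ((hs.moveAllowed_true_iff hc w).2 (by omega)) fun z => ?_
  rw [hplace, exch_comm]
  push_cast
  rw [cond_true, add_neg_cancel_right]

theorem Similar.exists_swapsTo_of_moveTable (hs : Similar (r + 1) P S μ T) (w : Fin n)
    (hc : c ∈ S) (up : Bool) : ∃ t ≤ 1, ∃ P', SwapsTo (S : Set (Fin m)) t P P' ∧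
      Similar r P' S μ (moveTable T w (μ c) up) := by
  by_cases hall : MoveAllowed T w (μ c) up
  swap
  · rw [moveTable_of_not_moveAllowed hall]
    exact ⟨0, Nat.zero_le 1, P, .refl P, hs.mono (Nat.le_succ r)⟩
  cases up with
  | false =>
    have hi := (hs.moveAllowed_false_iff hc w).1 hall
    exact ⟨1, le_rfl, _, .step w _ hi (.inl (by simpa using hc)) (.refl P),
      hs.swapAt_down hi hc (Equiv.apply_symm_apply _ _)⟩
  | true =>
    have hpos := (hs.moveAllowed_true_iff hc w).1 hall
    have hi : ((P w).symm c : ℕ) - 1 + 1 < m := by omega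
    have hci : P w ⟨((P w).symm c : ℕ) - 1 + 1, hi⟩ = c := by
      simp [Nat.sub_add_cancel hpos]
    exact ⟨1, le_rfl, _, .step w _ hi (.inr (by simpa [hci] using hc)) (.refl P),
      hs.swapAt_up hi hc hci⟩

theorem Similar.exists_moveTable_of_swapAt (hs : Similar (r + 1) P S μ T) (w : Fin n)
    (hi : i + 1 < m) (hS : P w ⟨i, Nat.lt_of_succ_lt hi⟩ ∈ S ∨ P w ⟨i + 1, hi⟩ ∈ S) :
    ∃ c ∈ S, ∃ up, Similar r (swapAt P w i hi) S μ (moveTable T w (μ c) up) := by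
  rcases hS with h | h
  · exact ⟨_, h, false, hs.swapAt_down hi h rfl⟩
  · exact ⟨_, h, true, hs.swapAt_up hi h rfl⟩

end Tables

section Search

variable {α : Type*} {f : α → List α} {r r' : ℕ} {x y : α}

/-- Everything that can be reached from `x` in at most `r` steps, where `f y` lists the possible
results of one step from `y`. -/
def reachWithin (f : α → List α) (r : ℕ) (x : α) : List α :=
  (fun acc => acc ++ acc.flatMap f)^[r] [x]

theorem mem_reachWithin_zero : y ∈ reachWithin f 0 x ↔ y = x := by
  simp [reachWithin]

theorem mem_reachWithin_succ :
    y ∈ reachWithin f (r + 1) x ↔ y ∈ reachWithin f r x ∨ ∃ z ∈ reachWithin f r x, y ∈ f z := by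
  simp only [reachWithin, Function.iterate_succ_apply', List.mem_append, List.mem_flatMap]

theorem reachWithin_mono (h : r ≤ r') (hy : y ∈ reachWithin f r x) : y ∈ reachWithin f r' x := by
  induction h with
  | refl => exact hy
  | step _ ih => exact mem_reachWithin_succ.2 (.inl ih)

end Search

section TableLists

variable {n m N t r a u v : ℕ} {P P' : Profile n m} {S : Finset (Fin m)} {μ : Fin m → ℕ}
  {l l' : List ℕ} {c : Fin m} {up : Bool}

/-- Entry `a` of row `v` in a table with the columns `0, …, N` that is stored row by row. -/
def entry (N : ℕ) (l : List ℕ) (v a : ℕ) : ℕ := l.getD (v * (N + 1) + a) 0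

/-- The counterpart of `moveTable` for tables that are stored as lists. -/
def moveList (N : ℕ) (l : List ℕ) (v a : ℕ) (up : Bool) : List ℕ :=
  (List.range l.length).map fun j => moveTable (entry N l) v a up (j / (N + 1)) (j % (N + 1))

theorem length_moveList (N : ℕ) (l : List ℕ) (v a : ℕ) (up : Bool) :
    (moveList N l v a up).length = l.length := by
  simp [moveList]

theorem row_add_column_lt (hu : u < n) (ha : a ≤ N) : u * (N + 1) + a < n * (N + 1) :=
  calc u * (N + 1) + a < (u + 1) * (N + 1) := by rw [add_mul]; omega
    _ ≤ n * (N + 1) := Nat.mul_le_mul_right _ hu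

theorem entry_moveList {x : ℕ} (hl : l.length = n * (N + 1)) (hu : u < n) (hx : x ≤ N) :
    entry N (moveList N l v a up) u x = moveTable (entry N l) v a up u x := by
  have hrow : (u * (N + 1) + x) / (N + 1) = u := by
    rw [mul_comm, Nat.mul_add_div N.succ_pos, Nat.div_eq_of_lt (by omega), add_zero]
  have hcolumn : (u * (N + 1) + x) % (N + 1) = x := by
    rw [mul_comm, Nat.mul_add_mod, Nat.mod_eq_of_lt (by omega)]
  have hlt := row_add_column_lt hu hx
  rw [entry, List.getD_eq_getElem _ _ (by rwa [length_moveList, hl])]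
  simp only [moveList, List.getElem_map, List.getElem_range, hrow, hcolumn]

/-- All tables with `n` rows that arise by one move. -/
def moveAll (n N : ℕ) (l : List ℕ) : List (List ℕ) :=
  (List.range n).flatMap fun v => (List.range N).flatMap fun a =>
    [moveList N l v (a + 1) false, moveList N l v (a + 1) true]

theorem mem_moveAll :
    l' ∈ moveAll n N l ↔ ∃ v < n, ∃ a < N, ∃ up, l' = moveList N l v (a + 1) up := by
  simp [moveAll]

theorem length_of_mem_reachWithin_moveAll (h : l' ∈ reachWithin (moveAll n N) t l) :
    l'.length = l.length := by
  induction t generalizing l' with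
  | zero => rw [mem_reachWithin_zero.1 h]
  | succ t ih =>
    rcases mem_reachWithin_succ.1 h with h | ⟨l₁, hl₁, hl'⟩
    · exact ih h
    · obtain ⟨v, -, a, -, up, rfl⟩ := mem_moveAll.1 hl'
      rw [length_moveList, ih hl₁]

/-- The numbering `μ` numbers the candidates of `S` by `1, …, N`. -/
structure Numbering (S : Finset (Fin m)) (N : ℕ) (μ : Fin m → ℕ) : Prop where
  injOn : Set.InjOn μ S
  range : ∀ a, (∃ c ∈ S, μ c = a) ↔ 1 ≤ a ∧ a ≤ N

theorem Numbering.le (h : Numbering S N μ) (hc : c ∈ S) : μ c ≤ N :=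
  ((h.range _).1 ⟨c, hc, rfl⟩).2

theorem Numbering.one_le (h : Numbering S N μ) (hc : c ∈ S) : 1 ≤ μ c :=
  ((h.range _).1 ⟨c, hc, rfl⟩).1

theorem SwapsTo.exists_mem_reachWithin (hμ : Numbering S N μ) (hl : l.length = n * (N + 1))
    (h : SwapsTo (S : Set (Fin m)) t P P') (hs : Similar (r + t) P S μ (entry N l)) :
    ∃ l' ∈ reachWithin (moveAll n N) t l, Similar r P' S μ (entry N l') := by
  induction h generalizing r with
  | refl => exact ⟨l, mem_reachWithin_zero.2 rfl, hs⟩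
  | @step t P P' w i hi hS _ ih =>
    obtain ⟨l', hl', hs'⟩ := ih (r := r + 1) (by rwa [Nat.add_right_comm])
    obtain ⟨c, hc, up, hmove⟩ := hs'.exists_moveTable_of_swapAt w hi hS
    have hone := hμ.one_le hc
    have hle := hμ.le hc
    refine ⟨moveList N l' w (μ c) up, mem_reachWithin_succ.2 (.inr ⟨l', hl', ?_⟩), ?_⟩
    · refine mem_moveAll.2 ⟨w, w.isLt, μ c - 1, by omega, up, ?_⟩
      rw [Nat.sub_add_cancel hone]
    · exact hmove.congr (fun c hc => hμ.le hc) fun u hu x hx =>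
        entry_moveList ((length_of_mem_reachWithin_moveAll hl').trans hl) hu hx

theorem exists_swapsTo_of_mem_reachWithin (hμ : Numbering S N μ) (hl : l.length = n * (N + 1))
    (h : l' ∈ reachWithin (moveAll n N) t l) (hs : Similar (r + t) P S μ (entry N l)) :
    ∃ t' ≤ t, ∃ P', SwapsTo (S : Set (Fin m)) t' P P' ∧ Similar r P' S μ (entry N l') := by
  induction t generalizing r l' with
  | zero =>
    obtain rfl : l' = l := mem_reachWithin_zero.1 h
    exact ⟨0, le_rfl, P, .refl P, hs⟩
  | succ t ih =>
    rcases mem_reachWithin_succ.1 h with h | ⟨l₁, hl₁, hl'⟩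
    · obtain ⟨t', ht', P', hP', hs'⟩ := ih h (r := r) (hs.mono (by omega))
      exact ⟨t', by omega, P', hP', hs'⟩
    · obtain ⟨t', ht', P₁, hP₁, hs₁⟩ := ih hl₁ (r := r + 1) (by rwa [Nat.add_right_comm])
      obtain ⟨v, hv, a, ha, up, rfl⟩ := mem_moveAll.1 hl'
      obtain ⟨c, hc, hca⟩ := (hμ.range (a + 1)).2 ⟨by omega, by omega⟩
      obtain ⟨t₂, ht₂, P', hP', hs'⟩ := hs₁.exists_swapsTo_of_moveTable ⟨v, hv⟩ hc up
      rw [hca] at hs'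
      refine ⟨t' + t₂, by omega, P', hP₁.trans hP', ?_⟩
      exact hs'.congr (fun c hc => hμ.le hc) fun u hu x hx =>
        entry_moveList ((length_of_mem_reachWithin_moveAll hl₁).trans hl) hu hx

end TableLists

/-! ### The count on lists of numbers -/

section ListCount

variable {n m k N q r : ℕ} {T T' : ℕ → ℕ → ℕ} {P P' : Profile n m} {S W : Finset (Fin m)}
  {μ : Fin m → ℕ} {s s' : State n m} {l l' : List ℕ × List ℕ × List ℕ} {c d : Fin m}

/-- A state of the count in terms of numbers: remaining candidates, remaining voters, elected
candidates. -/
abbrev ListState : Type := List ℕ × List ℕ × List ℕ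

/-- The counterpart of `supporters` for a count that reads the rankings from the table `T`. -/
def listSupporters (T : ℕ → ℕ → ℕ) (l : ListState) (c : ℕ) : List ℕ :=
  l.2.1.filter fun v => ∀ d ∈ l.1, T v c ≤ T v d

/-- The states that follow the state `l` by the election of a candidate. -/
def listElect (T : ℕ → ℕ → ℕ) (q : ℕ) (l : ListState) : List ListState :=
  (l.1.filter fun c => q ≤ (listSupporters T l c).length).flatMap fun c =>
    ((listSupporters T l c).sublists.filter fun D => D.length = q).map fun D =>
      (l.1.filter fun x => x ≠ c, l.2.1.filter fun v => v ∉ D, c :: l.2.2)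

/-- The states that follow the state `l` by the elimination of a candidate. -/
def listEliminate (T : ℕ → ℕ → ℕ) (l : ListState) : List ListState :=
  (l.1.filter fun d => ∀ c ∈ l.1, (listSupporters T l d).length ≤ (listSupporters T l c).length).map
    fun d => (l.1.filter fun x => x ≠ d, l.2.1, l.2.2)

/-- The counterpart of `Round`: all states that can follow the state `l`. -/
def listRound (T : ℕ → ℕ → ℕ) (q k : ℕ) (l : ListState) : List ListState :=
  if l.2.2.length < k then
    if ∀ c ∈ l.1, (listSupporters T l c).length < q then listEliminate T l else listElect T q l
  else []

/-- The counterpart of `State.start` for the candidates `1, …, N` and the voters `0, …, n - 1`. -/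
def listStart (n N : ℕ) : ListState :=
  ((List.range N).map (· + 1), List.range n, [])

/-- The counterpart of `STV`: the committees of size `k` that can be elected. -/
def listOutcomes (T : ℕ → ℕ → ℕ) (n N k : ℕ) : List (List ℕ) :=
  ((reachWithin (listRound T (quota n k) k) N (listStart n N)).filter
    fun l => l.2.2.length = k).map fun l => l.2.2

theorem mem_listElect : l' ∈ listElect T q l ↔
    ∃ c ∈ l.1, q ≤ (listSupporters T l c).length ∧
      ∃ D : List ℕ, D.Sublist (listSupporters T l c) ∧ D.length = q ∧
        (l.1.filter fun x => x ≠ c, l.2.1.filter fun v => v ∉ D, c :: l.2.2) = l' := by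
  simp only [listElect, List.mem_flatMap, List.mem_map, List.mem_filter, List.mem_sublists,
    decide_eq_true_eq, and_assoc]

theorem mem_listEliminate : l' ∈ listEliminate T l ↔
    ∃ d ∈ l.1, (∀ c ∈ l.1, (listSupporters T l d).length ≤ (listSupporters T l c).length) ∧
      (l.1.filter fun x => x ≠ d, l.2.1, l.2.2) = l' := by
  simp only [listEliminate, List.mem_map, List.mem_filter, decide_eq_true_eq, and_assoc]

section Codes

variable {α : Type*} {f : α → ℕ} {A B C : Finset α} {a b : α} {e e' : List ℕ}

/-- The list `e` enumerates the image of `A` under `f`. -/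
def Codes (f : α → ℕ) (A : Finset α) (e : List ℕ) : Prop :=
  e.Nodup ∧ ∀ x, x ∈ e ↔ ∃ a ∈ A, f a = x

theorem Codes.apply_mem (h : Codes f A e) (ha : a ∈ A) : f a ∈ e :=
  (h.2 _).2 ⟨a, ha, rfl⟩

theorem Codes.mem_iff (h : Codes f A e) (hf : Set.InjOn f C) (hA : A ⊆ C) (ha : a ∈ C) :
    f a ∈ e ↔ a ∈ A := by
  refine ⟨fun he => ?_, h.apply_mem⟩
  obtain ⟨b, hb, hba⟩ := (h.2 _).1 he
  rwa [← hf (hA hb) ha hba]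

theorem Codes.length (h : Codes f A e) (hf : Set.InjOn f A) : e.length = A.card := by
  classical
  have himage : e.toFinset = A.image f := by
    ext x
    rw [List.mem_toFinset, h.2, Finset.mem_image]
  rw [← List.toFinset_card_of_nodup h.1, himage, Finset.card_image_of_injOn hf]

theorem Codes.filter (h : Codes f A e) (p : ℕ → Prop) [DecidablePred p]
    (hB : ∀ a, a ∈ B ↔ a ∈ A ∧ p (f a)) : Codes f B (e.filter fun x => p x) := by
  refine ⟨h.1.filter _, fun x => ?_⟩
  simp only [List.mem_filter, h.2, decide_eq_true_eq, hB]
  constructor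
  · rintro ⟨⟨a, ha, rfl⟩, hp⟩
    exact ⟨a, ⟨ha, hp⟩, rfl⟩
  · rintro ⟨a, ⟨ha, hp⟩, rfl⟩
    exact ⟨⟨a, ha, rfl⟩, hp⟩

theorem Codes.cons [DecidableEq α] (h : Codes f A e) (ha : f a ∉ e) :
    Codes f (insert a A) (f a :: e) := by
  refine ⟨List.nodup_cons.2 ⟨ha, h.1⟩, fun x => ?_⟩
  rw [List.mem_cons, h.2, Finset.exists_mem_insert]
  exact or_congr_left eq_comm

theorem Codes.exists_sublist (h : Codes f A e) (hf : Set.InjOn f A) (hB : B ⊆ A) :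
    ∃ e', e'.Sublist e ∧ Codes f B e' := by
  classical
  refine ⟨_, List.filter_sublist, h.filter (fun x => ∃ b ∈ B, f b = x) fun a => ?_⟩
  refine ⟨fun ha => ⟨hB ha, a, ha, rfl⟩, ?_⟩
  rintro ⟨ha, b, hb, hba⟩
  rwa [← hf (hB hb) ha hba]

theorem Codes.exists_subset (h : Codes f A e) (he : e'.Sublist e) : ∃ B ⊆ A, Codes f B e' := by
  refine ⟨A.filter fun a => f a ∈ e', Finset.filter_subset _ _, h.1.sublist he, fun x => ?_⟩
  constructor
  · intro hx
    obtain ⟨a, ha, rfl⟩ := (h.2 x).1 (he.subset hx)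
    exact ⟨a, Finset.mem_filter.2 ⟨ha, hx⟩, rfl⟩
  · rintro ⟨a, ha, rfl⟩
    exact (Finset.mem_filter.1 ha).2

end Codes

/-- The list state `l` describes the state `s` of a count among the candidates of `S`. -/
structure Describes (S : Finset (Fin m)) (μ : Fin m → ℕ) (s : State n m) (l : ListState) :
    Prop where
  cands_subset : s.cands ⊆ S
  elected_subset : s.elected ⊆ S
  disjoint : Disjoint s.cands s.elected
  cands : Codes μ s.cands l.1
  voters : Codes Fin.val s.voters l.2.1
  elected : Codes μ s.elected l.2.2

theorem Describes.supporters (h : Describes S μ s l) (hT : SameOrder P S μ T) (hc : c ∈ s.cands) :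
    Codes Fin.val (supporters P s c) (listSupporters T l (μ c)) := by
  refine h.voters.filter _ fun v => ?_
  rw [mem_supporters]
  refine and_congr_right fun _ => ⟨fun hmin x hx => ?_, fun hmin => ⟨hc, fun d hd => ?_⟩⟩
  · obtain ⟨d, hd, rfl⟩ := (h.cands.2 x).1 hx
    exact (hT c (h.cands_subset hc) d (h.cands_subset hd) v).1 (hmin.2 d hd)
  · exact (hT c (h.cands_subset hc) d (h.cands_subset hd) v).2 (hmin _ (h.cands.apply_mem hd))

theorem Describes.card_supporters (h : Describes S μ s l) (hT : SameOrder P S μ T)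
    (hc : c ∈ s.cands) :
    (listSupporters T l (μ c)).length = (STVRobust.supporters P s c).card :=
  (h.supporters hT hc).length Fin.val_injective.injOn

theorem Describes.card_elected (h : Describes S μ s l) (hμ : Set.InjOn μ S) :
    l.2.2.length = s.elected.card :=
  h.elected.length (hμ.mono h.elected_subset)

theorem Describes.erase_cands (h : Describes S μ s l) (hμ : Set.InjOn μ S) (hc : c ∈ s.cands) :
    Codes μ (s.cands.erase c) (l.1.filter fun x => x ≠ μ c) := by
  refine h.cands.filter _ fun a => ?_
  rw [Finset.mem_erase, and_comm]
  exact and_congr_right fun ha => (hμ.ne_iff (h.cands_subset ha) (h.cands_subset hc)).symm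

theorem Describes.elect (h : Describes S μ s l) (hμ : Set.InjOn μ S) (hc : c ∈ s.cands)
    {D : Finset (Fin n)} {D' : List ℕ} (hD : Codes Fin.val D D') :
    Describes S μ (s.elect c D)
      (l.1.filter fun x => x ≠ μ c, l.2.1.filter fun v => v ∉ D', μ c :: l.2.2) where
  cands_subset := (Finset.erase_subset _ _).trans h.cands_subset
  elected_subset := Finset.insert_subset (h.cands_subset hc) h.elected_subset
  disjoint := Finset.disjoint_insert_right.2
    ⟨Finset.notMem_erase _ _, h.disjoint.mono_left (Finset.erase_subset _ _)⟩
  cands := h.erase_cands hμ hc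
  voters := h.voters.filter _ fun v => by
    rw [Finset.mem_sdiff, hD.mem_iff Fin.val_injective.injOn (Finset.subset_univ D)
      (Finset.mem_univ v)]
  elected := h.elected.cons fun hmem => Finset.disjoint_left.1 h.disjoint hc
    ((h.elected.mem_iff hμ h.elected_subset (h.cands_subset hc)).1 hmem)

theorem Describes.eliminate (h : Describes S μ s l) (hμ : Set.InjOn μ S) (hd : d ∈ s.cands) :
    Describes S μ (s.eliminate d) (l.1.filter fun x => x ≠ μ d, l.2.1, l.2.2) where
  cands_subset := (Finset.erase_subset _ _).trans h.cands_subset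
  elected_subset := h.elected_subset
  disjoint := h.disjoint.mono_left (Finset.erase_subset _ _)
  cands := h.erase_cands hμ hd
  voters := h.voters
  elected := h.elected

theorem Describes.noQuota_iff (h : Describes S μ s l) (hT : SameOrder P S μ T) :
    NoQuota P k s ↔ ∀ c ∈ l.1, (listSupporters T l c).length < quota n k := by
  simp only [h.cands.2, forall_exists_index, and_imp, forall_apply_eq_imp_iff₂]
  exact forall₂_congr fun c hc => by rw [h.card_supporters hT hc]

theorem Describes.exists_mem_listElect (h : Describes S μ s l) (hμ : Set.InjOn μ S)
    (hT : SameOrder P S μ T) (hc : c ∈ s.cands) (hq : q ≤ (STVRobust.supporters P s c).card)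
    {D : Finset (Fin n)} (hD : D ⊆ STVRobust.supporters P s c) (hDq : D.card = q) :
    ∃ l' ∈ listElect T q l, Describes S μ (s.elect c D) l' := by
  obtain ⟨D', hD', hcodes⟩ := (h.supporters hT hc).exists_sublist Fin.val_injective.injOn hD
  refine ⟨_, mem_listElect.2 ⟨μ c, h.cands.apply_mem hc, ?_, D', hD', ?_, rfl⟩,
    h.elect hμ hc hcodes⟩
  · rwa [h.card_supporters hT hc]
  · rwa [hcodes.length Fin.val_injective.injOn]

theorem Describes.exists_mem_listEliminate (h : Describes S μ s l) (hμ : Set.InjOn μ S)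
    (hT : SameOrder P S μ T) (hd : d ∈ s.cands) (hmin : ∀ c ∈ s.cands,
      (STVRobust.supporters P s d).card ≤ (STVRobust.supporters P s c).card) :
    ∃ l' ∈ listEliminate T l, Describes S μ (s.eliminate d) l' := by
  refine ⟨_, mem_listEliminate.2 ⟨μ d, h.cands.apply_mem hd, fun x hx => ?_, rfl⟩,
    h.eliminate hμ hd⟩
  obtain ⟨c, hc, rfl⟩ := (h.cands.2 x).1 hx
  rw [h.card_supporters hT hc, h.card_supporters hT hd]
  exact hmin c hc

theorem Describes.exists_mem_listRound (h : Describes S μ s l) (hμ : Set.InjOn μ S)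
    (hT : SameOrder P S μ T) (hround : Round P k s s') :
    ∃ l' ∈ listRound T (quota n k) k l, Describes S μ s' l' := by
  cases hround with
  | elect c D hk hc hq hD hDq =>
    have hno : ¬ NoQuota P k s := fun hno => (hno c hc).not_ge hq
    rw [listRound, if_pos (by rwa [h.card_elected hμ]), if_neg (by rwa [← h.noQuota_iff hT])]
    exact h.exists_mem_listElect hμ hT hc hq hD hDq
  | eliminate d hk hq hd hmin =>
    rw [listRound, if_pos (by rwa [h.card_elected hμ]), if_pos ((h.noQuota_iff hT).1 hq)]
    exact h.exists_mem_listEliminate hμ hT hd hmin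

theorem Describes.exists_round_of_mem_listElect (h : Describes S μ s l) (hμ : Set.InjOn μ S)
    (hT : SameOrder P S μ T) (hk : s.elected.card < k) (hl' : l' ∈ listElect T (quota n k) l) :
    ∃ s', Round P k s s' ∧ Describes S μ s' l' := by
  obtain ⟨x, hx, hq, D', hD', hDq, rfl⟩ := mem_listElect.1 hl'
  obtain ⟨c, hc, rfl⟩ := (h.cands.2 x).1 hx
  obtain ⟨D, hD, hcodes⟩ := (h.supporters hT hc).exists_subset hD'
  refine ⟨_, .elect s c D hk hc ?_ hD ?_, h.elect hμ hc hcodes⟩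
  · rwa [← h.card_supporters hT hc]
  · rwa [← hcodes.length Fin.val_injective.injOn]

theorem Describes.exists_round_of_mem_listEliminate (h : Describes S μ s l) (hμ : Set.InjOn μ S)
    (hT : SameOrder P S μ T) (hk : s.elected.card < k) (hno : NoQuota P k s)
    (hl' : l' ∈ listEliminate T l) : ∃ s', Round P k s s' ∧ Describes S μ s' l' := by
  obtain ⟨x, hx, hmin, rfl⟩ := mem_listEliminate.1 hl'
  obtain ⟨d, hd, rfl⟩ := (h.cands.2 x).1 hx
  refine ⟨_, .eliminate s d hk hno hd fun c hc => ?_, h.eliminate hμ hd⟩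
  rw [← h.card_supporters hT hc, ← h.card_supporters hT hd]
  exact hmin _ (h.cands.apply_mem hc)

theorem Describes.exists_round (h : Describes S μ s l) (hμ : Set.InjOn μ S)
    (hT : SameOrder P S μ T) (hl' : l' ∈ listRound T (quota n k) k l) :
    ∃ s', Round P k s s' ∧ Describes S μ s' l' := by
  rw [listRound, h.card_elected hμ] at hl'
  split_ifs at hl' with hk hno
  · exact h.exists_round_of_mem_listEliminate hμ hT hk ((h.noQuota_iff hT).2 hno) hl'
  · exact h.exists_round_of_mem_listElect hμ hT hk hl'
  · exact absurd hl' List.not_mem_nil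

theorem Numbering.describes_start (hμ : Numbering S N μ) :
    Describes S μ (State.start S : State n m) (listStart n N) where
  cands_subset := subset_rfl
  elected_subset := Finset.empty_subset _
  disjoint := Finset.disjoint_empty_right _
  cands := by
    refine ⟨List.nodup_range.map (add_left_injective 1), fun x => ?_⟩
    simp only [State.start, listStart, hμ.range, List.mem_map, List.mem_range]
    exact ⟨fun ⟨a, _, hax⟩ => by omega, fun h => ⟨x - 1, by omega, by omega⟩⟩
  voters := by
    refine ⟨List.nodup_range, fun x => ?_⟩
    rw [listStart, List.mem_range]
    exact ⟨fun h => ⟨⟨x, h⟩, Finset.mem_univ _, rfl⟩, fun ⟨v, _, hv⟩ => hv ▸ v.isLt⟩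
  elected := ⟨List.nodup_nil, by simp [State.start, listStart]⟩

theorem Numbering.card (hμ : Numbering S N μ) : S.card = N := by
  simpa [listStart, State.start] using ((hμ.describes_start (n := 0)).cands.length hμ.injOn).symm

theorem Round.card_cands_add_one (h : Round P k s s') : s'.cands.card + 1 = s.cands.card := by
  cases h with
  | elect _ _ _ hc => exact Finset.card_erase_add_one hc
  | eliminate _ _ _ hd => exact Finset.card_erase_add_one hd

theorem Reaches.exists_mem_reachWithin (hμ : Numbering S N μ) (hT : SameOrder P S μ T)
    (h : Reaches P k (.start S) s) :
    ∃ r, r + s.cands.card = N ∧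
      ∃ l ∈ reachWithin (listRound T (quota n k) k) r (listStart n N), Describes S μ s l := by
  induction h with
  | refl => exact ⟨0, by simpa [State.start] using hμ.card, _, mem_reachWithin_zero.2 rfl,
      hμ.describes_start⟩
  | tail _ hround ih =>
    obtain ⟨r, hr, l, hl, hs⟩ := ih
    obtain ⟨l', hl', hs'⟩ := hs.exists_mem_listRound hμ.injOn hT hround
    have := hround.card_cands_add_one
    exact ⟨r + 1, by omega, l', mem_reachWithin_succ.2 (.inr ⟨l, hl, hl'⟩), hs'⟩

theorem exists_reaches_of_mem_reachWithin (hμ : Numbering S N μ) (hT : SameOrder P S μ T)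
    (h : l ∈ reachWithin (listRound T (quota n k) k) r (listStart n N)) :
    ∃ s, Reaches P k (.start S) s ∧ Describes S μ s l := by
  induction r generalizing l with
  | zero =>
    obtain rfl : l = listStart n N := mem_reachWithin_zero.1 h
    exact ⟨_, .refl, hμ.describes_start⟩
  | succ r ih =>
    rcases mem_reachWithin_succ.1 h with h | ⟨l₁, hl₁, hl⟩
    · exact ih h
    · obtain ⟨s, hs, hd⟩ := ih hl₁
      obtain ⟨s', hround, hd'⟩ := hd.exists_round hμ.injOn hT hl
      exact ⟨s', hs.tail hround, hd'⟩

theorem exists_mem_listOutcomes (hμ : Numbering S N μ) (hS : CoversTop P S)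
    (hT : SameOrder P S μ T) (hW : W ∈ STV P k) : ∃ e ∈ listOutcomes T n N k, Codes μ W e := by
  obtain ⟨hk, s, hs, rfl⟩ := (mem_STV_iff_of_coversTop hS).1 hW
  obtain ⟨r, hr, l, hl, hd⟩ := hs.exists_mem_reachWithin hμ hT
  refine ⟨l.2.2, List.mem_map.2 ⟨l, List.mem_filter.2
    ⟨reachWithin_mono (by omega) hl, ?_⟩, rfl⟩, hd.elected⟩
  simpa only [hd.card_elected hμ.injOn, decide_eq_true_eq] using hk

theorem exists_mem_STV (hμ : Numbering S N μ) (hS : CoversTop P S) (hT : SameOrder P S μ T)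
    {e : List ℕ} (he : e ∈ listOutcomes T n N k) : ∃ W ∈ STV P k, Codes μ W e := by
  obtain ⟨l, hl, rfl⟩ := List.mem_map.1 he
  obtain ⟨hl, hk⟩ := List.mem_filter.1 hl
  obtain ⟨s, hs, hd⟩ := exists_reaches_of_mem_reachWithin hμ hT hl
  refine ⟨s.elected, (mem_STV_iff_of_coversTop hS).2 ⟨?_, s, hs, rfl⟩, hd.elected⟩
  simpa only [hd.card_elected hμ.injOn, decide_eq_true_eq] using hk

/-- Every list of `A` is contained in some list of `B`. Between lists that enumerate committees of
the same size this means that every committee of `A` is a committee of `B`. -/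
def ListsCovered (A B : List (List ℕ)) : Prop := ∀ e ∈ A, ∃ e' ∈ B, ∀ x ∈ e, x ∈ e'

theorem listsCovered_listOutcomes_iff (hμ : Numbering S N μ) (hS : CoversTop P S)
    (hS' : CoversTop P' S) (hT : SameOrder P S μ T) (hT' : SameOrder P' S μ T') :
    ListsCovered (listOutcomes T n N k) (listOutcomes T' n N k) ↔ STV P k ⊆ STV P' k := by
  constructor
  · intro h W hW
    obtain ⟨e, he, hcodes⟩ := exists_mem_listOutcomes hμ hS hT hW
    obtain ⟨e', he', hsub⟩ := h e he
    obtain ⟨W', hW', hcodes'⟩ := exists_mem_STV hμ hS' hT' he'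
    have hsubset : W ⊆ W' := fun c hc =>
      (hcodes'.mem_iff hμ.injOn (subset_of_mem_STV hS' hW') (subset_of_mem_STV hS hW hc)).1
        (hsub _ (hcodes.apply_mem hc))
    rwa [Finset.eq_of_subset_of_card_le hsubset (by rw [hW.1, hW'.1])]
  · intro h e he
    obtain ⟨W, hW, hcodes⟩ := exists_mem_STV hμ hS hT he
    obtain ⟨e', he', hcodes'⟩ := exists_mem_listOutcomes hμ hS' hT' (h hW)
    exact ⟨e', he', fun x hx => by rwa [hcodes'.2, ← hcodes.2]⟩

end ListCount

section TableAnswer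

variable {n m k B N : ℕ} {P P' : Profile n m} {S : Finset (Fin m)} {μ : Fin m → ℕ}
  {l l' : List ℕ}

/-- The tables `l` and `l'` have the same committees of size `k`. -/
def SameOutcomes (n k N : ℕ) (l l' : List ℕ) : Prop :=
  ListsCovered (listOutcomes (entry N l) n N k) (listOutcomes (entry N l') n N k) ∧
    ListsCovered (listOutcomes (entry N l') n N k) (listOutcomes (entry N l) n N k)

theorem sameOutcomes_iff (hμ : Numbering S N μ) (hS : CoversTop P S) (hS' : CoversTop P' S)
    (hl : SameOrder P S μ (entry N l)) (hl' : SameOrder P' S μ (entry N l')) :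
    SameOutcomes n k N l l' ↔ STV P k = STV P' k := by
  rw [Set.Subset.antisymm_iff, SameOutcomes, listsCovered_listOutcomes_iff hμ hS hS' hl hl',
    listsCovered_listOutcomes_iff hμ hS' hS hl' hl]

/-- The decision procedure on a table: do at most `B` moves change the committees? -/
def TableAnswer (n k B N : ℕ) (l : List ℕ) : Prop :=
  ∃ l' ∈ reachWithin (moveAll n N) B l, ¬ SameOutcomes n k N l' l

theorem canChangeWith_iff_tableAnswer (hμ : Numbering S N μ) (hS : ∀ c ∉ S, ∀ v, B + n < pos P v c)
    (hl : l.length = n * (N + 1)) (hs : Similar B P S μ (entry N l)) :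
    CanChangeWith (S : Set (Fin m)) P k B ↔ TableAnswer n k B N l := by
  have hcovers : CoversTop P S := fun c hc v => (Nat.le_add_left n B).trans_lt (hS c hc v)
  have hcovers' {t : ℕ} {P' : Profile n m} (ht : t ≤ B) (h : SwapsTo (S : Set (Fin m)) t P P') :
      CoversTop P' S := fun c hc v => by
    have := hS c hc v
    have := h.pos_le v c
    omega
  constructor
  · rintro ⟨t, ht, P', hP', hne⟩
    obtain ⟨l', hl', hs'⟩ := hP'.exists_mem_reachWithin hμ hl (r := B - t)
      (by rwa [Nat.sub_add_cancel ht])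
    refine ⟨l', reachWithin_mono ht hl', ?_⟩
    rwa [sameOutcomes_iff hμ (hcovers' ht hP') hcovers hs'.sameOrder hs.sameOrder]
  · rintro ⟨l', hl', hne⟩
    obtain ⟨t, ht, P', hP', hs'⟩ := exists_swapsTo_of_mem_reachWithin hμ hl hl' (r := 0)
      (by rwa [Nat.zero_add])
    rw [sameOutcomes_iff hμ (hcovers' ht hP') hcovers hs'.sameOrder hs.sameOrder] at hne
    exact ⟨t, ht, P', hP', hne⟩

end TableAnswer

section PrimrecAnswer

open Primrec

variable {α β : Type*} [Primcodable α] [Primcodable β]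

theorem primrecPred_forall_mem {f : α → List β} (hf : Primrec f) {p : α → β → Prop}
    (hp : PrimrecPred fun y : β × α => p y.2 y.1) : PrimrecPred fun x => ∀ b ∈ f x, p x b :=
  (PrimrecRel.forall_mem_list (R := fun b x => p x b) hp).comp hf .id

theorem primrecPred_exists_mem {f : α → List β} (hf : Primrec f) {p : α → β → Prop}
    (hp : PrimrecPred fun y : β × α => p y.2 y.1) : PrimrecPred fun x => ∃ b ∈ f x, p x b :=
  (PrimrecRel.exists_mem_list (R := fun b x => p x b) hp).comp hf .id

theorem primrecPred_mem {f : α → List β} {g : α → β} (hf : Primrec f) (hg : Primrec g) :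
    PrimrecPred fun x => g x ∈ f x :=
  (primrecPred_exists_mem hf (p := fun x b => b = g x) (Primrec.eq.comp fst (hg.comp snd))).of_eq
    fun x => by simp

theorem primrec_filter {f : α → List β} (hf : Primrec f) {p : α → β → Prop}
    [∀ x b, Decidable (p x b)] (hp : PrimrecPred fun y : β × α => p y.2 y.1) :
    Primrec fun x => (f x).filter fun b => p x b :=
  (PrimrecRel.listFilter (R := fun b x => p x b) hp).comp hf .id

theorem primrec_sublists : Primrec (List.sublists : List α → List (List α)) := by
  have hstep : Primrec fun y : List α × α × List (List α) =>
      y.2.2.flatMap fun x => [x, y.2.1 :: x] :=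
    list_flatMap (snd.comp snd) (list_cons.comp snd
      (list_cons.comp (list_cons.comp (fst.comp (snd.comp fst)) snd) (.const [])))
  exact list_foldr (g := fun _ => [[]]) (h := fun _ p => p.2.flatMap fun x => [x, p.1 :: x])
    .id (.const _) hstep

theorem primrec_reachWithin {f : α → β → List β} {r : α → ℕ} {g : α → β}
    (hf : Primrec fun y : α × β => f y.1 y.2) (hr : Primrec r) (hg : Primrec g) :
    Primrec fun x => reachWithin (f x) (r x) (g x) :=
  nat_iterate hr (list_cons.comp hg (.const []))
    (list_append.comp snd (list_flatMap snd (hf.comp (pair (fst.comp fst) snd))))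

theorem primrec_entry {N v a : α → ℕ} {l : α → List ℕ} (hN : Primrec N) (hl : Primrec l)
    (hv : Primrec v) (ha : Primrec a) : Primrec fun x => entry (N x) (l x) (v x) (a x) :=
  (list_getD 0).comp hl (nat_add.comp (nat_mul.comp hv (succ.comp hN)) ha)

theorem primrec_moveTable {N v a u y : α → ℕ} {l : α → List ℕ} {up : α → Bool}
    (hN : Primrec N) (hl : Primrec l) (hv : Primrec v) (ha : Primrec a) (hup : Primrec up)
    (hu : Primrec u) (hy : Primrec y) :
    Primrec fun x => moveTable (entry (N x) (l x)) (v x) (a x) (up x) (u x) (y x) := by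
  have hplace := primrec_entry hN hl hv ha
  have hother := primrec_entry hN hl hv hy
  have hend := primrec_entry hN hl hv (.const 0)
  have htarget : Primrec fun x => moveTarget (entry (N x) (l x)) (v x) (a x) (up x) :=
    cond hup (nat_sub.comp hplace (.const 1)) (nat_add.comp hplace (.const 1))
  have hallowed : PrimrecPred fun x => MoveAllowed (entry (N x) (l x)) (v x) (a x) (up x) :=
    ((Primrec.eq.comp hup (.const true)).and (nat_lt.comp (.const 0) hplace)).or
      ((Primrec.eq.comp hup (.const false)).and
        (nat_lt.comp (nat_add.comp hplace (.const 1)) hend))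
  exact ite ((Primrec.eq.comp hu hv).and hallowed)
    (ite (Primrec.eq.comp hother hplace) htarget
      (ite (Primrec.eq.comp hother htarget) hplace hother))
    (primrec_entry hN hl hu hy)

theorem primrec_moveList {N v a : α → ℕ} {l : α → List ℕ} {up : α → Bool}
    (hN : Primrec N) (hl : Primrec l) (hv : Primrec v) (ha : Primrec a) (hup : Primrec up) :
    Primrec fun x => moveList (N x) (l x) (v x) (a x) (up x) :=
  list_map (list_range.comp (list_length.comp hl)) (primrec_moveTable (hN.comp fst)
    (hl.comp fst) (hv.comp fst) (ha.comp fst) (hup.comp fst)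
    (nat_div.comp snd (succ.comp (hN.comp fst))) (nat_mod.comp snd (succ.comp (hN.comp fst))))

theorem primrec_moveAll {n N : α → ℕ} {l : α → List ℕ} (hn : Primrec n) (hN : Primrec N)
    (hl : Primrec l) : Primrec fun x => moveAll (n x) (N x) (l x) := by
  have hmove (up : Bool) : Primrec fun y : (α × ℕ) × ℕ =>
      moveList (N y.1.1) (l y.1.1) y.1.2 (y.2 + 1) up :=
    primrec_moveList (hN.comp (fst.comp fst)) (hl.comp (fst.comp fst)) (snd.comp fst)
      (succ.comp snd) (.const up)
  exact list_flatMap (list_range.comp hn) (list_flatMap (list_range.comp (hN.comp fst))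
    (list_cons.comp (hmove false) (list_cons.comp (hmove true) (.const []))))

theorem primrec_listSupporters {N c : α → ℕ} {l : α → List ℕ} {s : α → ListState}
    (hN : Primrec N) (hl : Primrec l) (hs : Primrec s) (hc : Primrec c) :
    Primrec fun x => listSupporters (entry (N x) (l x)) (s x) (c x) := by
  have hx : Primrec fun y : ℕ × ℕ × α => y.2.2 := snd.comp snd
  exact primrec_filter (fst.comp (snd.comp hs)) (primrecPred_forall_mem (fst.comp (hs.comp snd))
    (nat_le.comp (primrec_entry (hN.comp hx) (hl.comp hx) (fst.comp snd) (hc.comp hx))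
      (primrec_entry (hN.comp hx) (hl.comp hx) (fst.comp snd) fst)))

theorem primrec_listElect {N q : α → ℕ} {l : α → List ℕ} {s : α → ListState}
    (hN : Primrec N) (hl : Primrec l) (hq : Primrec q) (hs : Primrec s) :
    Primrec fun x => listElect (entry (N x) (l x)) (q x) (s x) := by
  have hcands : Primrec fun x => (s x).1.filter fun c =>
      q x ≤ (listSupporters (entry (N x) (l x)) (s x) c).length :=
    primrec_filter (fst.comp hs) (nat_le.comp (hq.comp snd) (list_length.comp
      (primrec_listSupporters (hN.comp snd) (hl.comp snd) (hs.comp snd) fst)))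
  have hvoters : Primrec fun y : α × ℕ =>
      (listSupporters (entry (N y.1) (l y.1)) (s y.1) y.2).sublists.filter
        fun D => D.length = q y.1 :=
    primrec_filter (primrec_sublists.comp
      (primrec_listSupporters (hN.comp fst) (hl.comp fst) (hs.comp fst) snd))
      (Primrec.eq.comp (list_length.comp fst) (hq.comp (fst.comp snd)))
  have hx : Primrec fun y : (α × ℕ) × List ℕ => s y.1.1 := hs.comp (fst.comp fst)
  exact list_flatMap hcands (list_map hvoters
    (pair (primrec_filter (fst.comp hx) (Primrec.eq.comp fst (snd.comp (fst.comp snd))).not)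
      (pair (primrec_filter (fst.comp (snd.comp hx)) (primrecPred_mem (snd.comp snd) fst).not)
        (list_cons.comp (snd.comp fst) (snd.comp (snd.comp hx))))))

theorem primrec_listEliminate {N : α → ℕ} {l : α → List ℕ} {s : α → ListState}
    (hN : Primrec N) (hl : Primrec l) (hs : Primrec s) :
    Primrec fun x => listEliminate (entry (N x) (l x)) (s x) := by
  have hx : Primrec fun y : ℕ × ℕ × α => y.2.2 := snd.comp snd
  have hlength {f : ℕ × ℕ × α → ℕ} (hf : Primrec f) : Primrec fun y : ℕ × ℕ × α =>
      (listSupporters (entry (N y.2.2) (l y.2.2)) (s y.2.2) (f y)).length :=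
    list_length.comp (primrec_listSupporters (hN.comp hx) (hl.comp hx) (hs.comp hx) hf)
  have hs' : Primrec fun y : α × ℕ => s y.1 := hs.comp fst
  exact list_map (primrec_filter (fst.comp hs) (primrecPred_forall_mem (fst.comp (hs.comp snd))
      (nat_le.comp (hlength (fst.comp snd)) (hlength fst))))
    (pair (primrec_filter (fst.comp hs') (Primrec.eq.comp fst (snd.comp snd)).not)
      (pair (fst.comp (snd.comp hs')) (snd.comp (snd.comp hs'))))

theorem primrec_listRound {N q k : α → ℕ} {l : α → List ℕ} {s : α → ListState}
    (hN : Primrec N) (hl : Primrec l) (hq : Primrec q) (hk : Primrec k) (hs : Primrec s) :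
    Primrec fun x => listRound (entry (N x) (l x)) (q x) (k x) (s x) := by
  have hnone : PrimrecPred fun x =>
      ∀ c ∈ (s x).1, (listSupporters (entry (N x) (l x)) (s x) c).length < q x :=
    primrecPred_forall_mem (fst.comp hs) (nat_lt.comp (list_length.comp
      (primrec_listSupporters (hN.comp snd) (hl.comp snd) (hs.comp snd) fst)) (hq.comp snd))
  exact ite (nat_lt.comp (list_length.comp (snd.comp (snd.comp hs))) hk)
    (ite hnone (primrec_listEliminate hN hl hs) (primrec_listElect hN hl hq hs)) (.const [])

theorem primrec_listOutcomes {n N k : α → ℕ} {l : α → List ℕ} (hn : Primrec n) (hN : Primrec N)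
    (hk : Primrec k) (hl : Primrec l) :
    Primrec fun x => listOutcomes (entry (N x) (l x)) (n x) (N x) (k x) := by
  have hq : Primrec fun x => quota (n x) (k x) := succ.comp (nat_div.comp hn (succ.comp hk))
  have hstart : Primrec fun x => listStart (n x) (N x) :=
    pair (list_map (g := fun _ (a : ℕ) => a + 1) (list_range.comp hN) (succ.comp snd))
      (pair (list_range.comp hn) (.const []))
  have hreach : Primrec fun x =>
      reachWithin (listRound (entry (N x) (l x)) (quota (n x) (k x)) (k x)) (N x)
        (listStart (n x) (N x)) :=
    primrec_reachWithin (primrec_listRound (hN.comp fst) (hl.comp fst) (hq.comp fst) (hk.comp fst)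
      snd) hN hstart
  exact list_map (primrec_filter hreach
    (Primrec.eq.comp (list_length.comp (snd.comp (snd.comp fst))) (hk.comp snd)))
    (snd.comp (snd.comp snd))

theorem primrecPred_listsCovered {A B : α → List (List ℕ)} (hA : Primrec A) (hB : Primrec B) :
    PrimrecPred fun x => ListsCovered (A x) (B x) :=
  primrecPred_forall_mem hA (primrecPred_exists_mem (hB.comp snd)
    (primrecPred_forall_mem (fst.comp snd) (primrecPred_mem (fst.comp snd) fst)))

theorem primrecPred_tableAnswer {n k B N : α → ℕ} {l : α → List ℕ} (hn : Primrec n)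
    (hk : Primrec k) (hB : Primrec B) (hN : Primrec N) (hl : Primrec l) :
    PrimrecPred fun x => TableAnswer (n x) (k x) (B x) (N x) (l x) := by
  have hmoves : Primrec fun y : α × List ℕ => moveAll (n y.1) (N y.1) y.2 :=
    primrec_moveAll (hn.comp fst) (hN.comp fst) snd
  have houtcomes {f : List ℕ × α → List ℕ} (hf : Primrec f) :
      Primrec fun y => listOutcomes (entry (N y.2) (f y)) (n y.2) (N y.2) (k y.2) :=
    primrec_listOutcomes (hn.comp snd) (hN.comp snd) (hk.comp snd) hf
  have hnew := houtcomes fst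
  have hold := houtcomes (hl.comp snd)
  exact primrecPred_exists_mem (primrec_reachWithin hmoves hB hl)
    ((primrecPred_listsCovered hnew hold).and (primrecPred_listsCovered hold hnew)).not

open Classical in
/-- The decision procedure on a code of the list that consists of `n`, `k`, `B`, `N` and the
table. -/
noncomputable def answerCode (x : ℕ) : ℕ :=
  let L : List ℕ := (Encodable.decode x).getD []
  if TableAnswer (L.getD 0 0) (L.getD 1 0) (L.getD 2 0) (L.getD 3 0) (L.drop 4) then 1 else 0

open Classical in
theorem primrec_answerCode : Primrec answerCode := by
  have hL : Primrec fun x : ℕ => (Encodable.decode x : Option (List ℕ)).getD [] :=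
    option_getD.comp .decode (.const [])
  have hentry (i : ℕ) : Primrec fun x : ℕ =>
      ((Encodable.decode x : Option (List ℕ)).getD []).getD i 0 :=
    (list_getD 0).comp hL (.const i)
  exact Primrec.ite (primrecPred_tableAnswer (hentry 0) (hentry 1) (hentry 2) (hentry 3)
    (list_drop.comp (.const 4) hL)) (.const 1) (.const 0)

theorem answerCode_encode_ne_zero_iff {n k B N : ℕ} {l : List ℕ} :
    answerCode (Encodable.encode (n :: k :: B :: N :: l)) ≠ 0 ↔ TableAnswer n k B N l := by
  rw [answerCode, Encodable.encodek]
  simp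

end PrimrecAnswer

/-! ### Programs for primitive recursive functions -/

/-- The program `p`, started in `s`, halts within `T` steps in a memory that satisfies `Q`. -/
def Runs (p : Prog) (s : Memory) (T : ℕ) (Q : Memory → Prop) : Prop :=
  ∃ t s', Exec p s t s' ∧ t ≤ T ∧ Q s'

section Rules

variable {p q : Prog} {e : Expr} {s : Memory} {T T' : ℕ} {Q Q' : Memory → Prop}

theorem Runs.mono (h : Runs p s T Q) (hT : T ≤ T') (hQ : ∀ s', Q s' → Q' s') :
    Runs p s T' Q' := by
  obtain ⟨t, s', hp, ht, hs'⟩ := h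
  exact ⟨t, s', hp, ht.trans hT, hQ s' hs'⟩

theorem Runs.assign {x : ℕ} (hT : e.cost + 1 ≤ T) (hQ : Q (s.setVar x (e.eval s))) :
    Runs (.assign x e) s T Q :=
  ⟨_, _, .assign x e s, hT, hQ⟩

theorem Runs.put {a : ℕ} {i : Expr} (hT : i.cost + e.cost + 1 ≤ T)
    (hQ : Q (s.setArr a (i.eval s) (e.eval s))) : Runs (.put a i e) s T Q :=
  ⟨_, _, .put a i e s, hT, hQ⟩

theorem Runs.seq (hp : Runs p s T Q) (hq : ∀ s', Q s' → Runs q s' T' Q') :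
    Runs (.seq p q) s (T + T') Q' := by
  obtain ⟨t, s', hps', ht, hs'⟩ := hp
  obtain ⟨t', s'', hqs'', ht', hs''⟩ := hq s' hs'
  exact ⟨_, s'', .seq hps' hqs'', Nat.add_le_add ht ht', hs''⟩

theorem Runs.ite (hp : e.eval s ≠ 0 → Runs p s T Q) (hq : e.eval s = 0 → Runs q s T Q) :
    Runs (.ite e p q) s (e.cost + 1 + T) Q := by
  by_cases he : e.eval s = 0
  · obtain ⟨t, s', hqs', ht, hs'⟩ := hq he
    exact ⟨_, s', .ite_false he hqs', Nat.add_le_add_left ht _, hs'⟩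
  · obtain ⟨t, s', hps', ht, hs'⟩ := hp he
    exact ⟨_, s', .ite_true he hps', Nat.add_le_add_left ht _, hs'⟩

theorem Runs.loop_sum (K : ℕ) (τ : ℕ → ℕ) (I : ℕ → Memory → Prop)
    (hstep : ∀ j < K, ∀ s, I j s → e.eval s ≠ 0 ∧ Runs p s (τ j) (I (j + 1)))
    (hend : ∀ s, I K s → e.eval s = 0) (h0 : I 0 s) :
    Runs (.loop e p) s ((∑ j ∈ Finset.range K, (e.cost + 1 + τ j)) + (e.cost + 1)) (I K) := by
  induction K generalizing τ I s with
  | zero => exact ⟨_, s, .loop_done (hend s h0), by simp, h0⟩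
  | succ K ih =>
    obtain ⟨he, t, s', hp, ht, hs'⟩ := hstep 0 (by lia) s h0
    obtain ⟨t', s'', hl, ht', hs''⟩ := ih (fun j => τ (j + 1)) (fun j => I (j + 1))
      (fun j hj s hs => hstep (j + 1) (by lia) s hs) hend hs'
    refine ⟨_, s'', .loop_step he hp hl, ?_, hs''⟩
    rw [Finset.sum_range_succ']
    lia

theorem Runs.loop (K τ : ℕ) (I : ℕ → Memory → Prop)
    (hstep : ∀ j < K, ∀ s, I j s → e.eval s ≠ 0 ∧ Runs p s τ (I (j + 1)))
    (hend : ∀ s, I K s → e.eval s = 0) (h0 : I 0 s) :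
    Runs (.loop e p) s (K * (e.cost + 1 + τ) + (e.cost + 1)) (I K) := by
  simpa using Runs.loop_sum K (fun _ => τ) I hstep hend h0

theorem Runs.loop_sub {x y : ℕ} (K τ : ℕ) (I : ℕ → Memory → Prop)
    (hI : ∀ j s, I j s → s.var x = K ∧ s.var y = j)
    (hstep : ∀ j < K, ∀ s, I j s → Runs p s τ (I (j + 1))) (h0 : I 0 s) :
    Runs (.loop (.sub (.var x) (.var y)) p) s (K * (4 + τ) + 4) (I K) := by
  refine .loop K τ I (fun j hj s hs => ⟨?_, hstep j hj s hs⟩) (fun s hs => ?_) h0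
  · simp only [Expr.eval, hI j s hs]
    lia
  · simp only [Expr.eval, hI K s hs, Nat.sub_self]

theorem Runs.seq_assign {x : ℕ} (h : Runs q (s.setVar x (e.eval s)) T Q) :
    Runs (.seq (.assign x e) q) s (e.cost + 1 + T) Q :=
  (Runs.assign (Q := (· = s.setVar x (e.eval s))) le_rfl rfl).seq fun _ hs' => hs' ▸ h

theorem Runs.seq_put {a : ℕ} {i : Expr} (h : Runs q (s.setArr a (i.eval s) (e.eval s)) T Q) :
    Runs (.seq (.put a i e) q) s (i.cost + e.cost + 1 + T) Q :=
  (Runs.put (Q := (· = s.setArr a (i.eval s) (e.eval s))) le_rfl rfl).seq fun _ hs' => hs' ▸ h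

end Rules

@[simp]
theorem Memory.setVar_var (s : Memory) (x a y : ℕ) :
    (s.setVar x a).var y = if y = x then a else s.var y := by
  simp [Memory.setVar, Function.update_apply]

@[simp]
theorem Memory.setVar_arr (s : Memory) (x a : ℕ) : (s.setVar x a).arr = s.arr := rfl

@[simp]
theorem Memory.setArr_var (s : Memory) (a i b : ℕ) : (s.setArr a i b).var = s.var := rfl

@[simp]
theorem Memory.setArr_arr (s : Memory) (a i b c : ℕ) :
    (s.setArr a i b).arr c = if c = a then Function.update (s.arr a) i b else s.arr c := by
  simp [Memory.setArr, Function.update_apply]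

/-- The memories `s` and `s'` agree on all arrays and on the variables below `b`: the variables
from `b` on serve as scratch space. -/
def KeepsBelow (b : ℕ) (s s' : Memory) : Prop :=
  (∀ x < b, s'.var x = s.var x) ∧ s'.arr = s.arr

section KeepsBelow

variable {b b' : ℕ} {s s' s'' : Memory}

theorem KeepsBelow.refl (b : ℕ) (s : Memory) : KeepsBelow b s s :=
  ⟨fun _ _ => rfl, rfl⟩

theorem KeepsBelow.mono (h : KeepsBelow b' s s') (hb : b ≤ b') : KeepsBelow b s s' :=
  ⟨fun x hx => h.1 x (hx.trans_le hb), h.2⟩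

theorem KeepsBelow.trans (h : KeepsBelow b s s') (h' : KeepsBelow b s' s'') :
    KeepsBelow b s s'' :=
  ⟨fun x hx => (h'.1 x hx).trans (h.1 x hx), h'.2.trans h.2⟩

theorem KeepsBelow.setVar (h : KeepsBelow b s s') {x : ℕ} (hx : b ≤ x) (a : ℕ) :
    KeepsBelow b s (s'.setVar x a) :=
  ⟨fun y hy => by rw [Memory.setVar_var, if_neg (by lia), h.1 y hy], h.2⟩

end KeepsBelow

/-- The values of the variables `a 0, a 1, …`, as the argument of a function. -/
def Memory.args {n : ℕ} (s : Memory) (a : Fin n → ℕ) : List.Vector ℕ n :=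
  .ofFn fun i => s.var (a i)

theorem KeepsBelow.args_eq {n b : ℕ} {s s' : Memory} (h : KeepsBelow b s s') {a : Fin n → ℕ}
    (ha : ∀ i, a i < b) : s'.args a = s.args a :=
  congrArg List.Vector.ofFn (funext fun i => h.1 _ (ha i))

theorem Memory.args_cons {n : ℕ} (s : Memory) (x : ℕ) (a : Fin n → ℕ) :
    s.args (Fin.cons x a : Fin (n + 1) → ℕ) = s.var x ::ᵥ s.args a := by
  simp [Memory.args, List.Vector.ofFn]

/-- The program `p` computes `f` of the variables `a` into the variable `b`, in time `T`, using
only the variables from `b` on. -/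
def Computes {n : ℕ} (p : Prog) (b : ℕ) (a : Fin n → ℕ) (f T : List.Vector ℕ n → ℕ) : Prop :=
  ∀ s : Memory, Runs p s (T (s.args a)) fun s' => s'.var b = f (s.args a) ∧ KeepsBelow b s s'

/-- Wherever its arguments and its value are stored, `f` can be computed within a number of steps
that is a primitive recursive function of the arguments. -/
def MachineComputable {n : ℕ} (f : List.Vector ℕ n → ℕ) : Prop :=
  ∃ T, Primrec T ∧ ∀ (b : ℕ) (a : Fin n → ℕ), (∀ i, a i < b) → ∃ p, Computes p b a f T

theorem machineComputable_of_expr {n : ℕ} {f : List.Vector ℕ n → ℕ} (e : (Fin n → ℕ) → Expr)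
    (c : ℕ) (hc : ∀ a, (e a).cost = c) (he : ∀ a s, (e a).eval s = f (s.args a)) :
    MachineComputable f := by
  refine ⟨fun _ => c + 1, .const _, fun b a _ => ⟨.assign b (e a), fun s => ?_⟩⟩
  refine .assign (by rw [hc]) ⟨?_, (KeepsBelow.refl b s).setVar le_rfl _⟩
  rw [Memory.setVar_var, if_pos rfl, he]

theorem exists_prog_of_forall_machineComputable {n m : ℕ} (g : Fin n → List.Vector ℕ m → ℕ)
    (hg : ∀ i, MachineComputable (g i)) (j : ℕ) (hj : j ≤ n) :
    ∃ T, Primrec T ∧ ∀ (b : ℕ) (a : Fin m → ℕ), (∀ i, a i < b) → ∃ p, ∀ s : Memory,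
      Runs p s (T (s.args a)) fun s' =>
        (∀ i : Fin n, (i : ℕ) < j → s'.var (b + i) = g i (s.args a)) ∧ KeepsBelow b s s' := by
  induction j with
  | zero =>
    refine ⟨fun _ => 2, .const 2, fun b a _ => ⟨.assign b (.num 0), fun s => ?_⟩⟩
    exact .assign le_rfl ⟨by simp, (KeepsBelow.refl b s).setVar le_rfl _⟩
  | succ j ih =>
    obtain ⟨T, hT, h⟩ := ih (by lia)
    obtain ⟨T', hT', h'⟩ := hg ⟨j, hj⟩
    refine ⟨fun v => T v + T' v, Primrec.nat_add.comp hT hT', fun b a ha => ?_⟩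
    obtain ⟨p, hp⟩ := h b a ha
    obtain ⟨p', hp'⟩ := h' (b + j) a fun i => (ha i).trans_le (Nat.le_add_right _ _)
    refine ⟨.seq p p', fun s => (hp s).seq fun s₁ ⟨hval, hs₁⟩ => ?_⟩
    have hp₁ := hp' s₁
    rw [hs₁.args_eq ha] at hp₁
    refine hp₁.mono le_rfl fun s₂ ⟨hval₂, hs₂⟩ =>
      ⟨fun i hi => ?_, hs₁.trans (hs₂.mono (Nat.le_add_right _ _))⟩
    rcases Nat.lt_succ_iff_lt_or_eq.1 hi with hi | rfl
    · rw [hs₂.1 _ (by lia), hval i hi]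
    · exact hval₂

theorem MachineComputable.comp {n m : ℕ} {f : List.Vector ℕ n → ℕ}
    {g : Fin n → List.Vector ℕ m → ℕ} (hf : MachineComputable f)
    (hg : ∀ i, MachineComputable (g i)) (hg' : ∀ i, Primrec (g i)) :
    MachineComputable fun v => f (.ofFn fun i => g i v) := by
  obtain ⟨T, hT, h⟩ := exists_prog_of_forall_machineComputable g hg n le_rfl
  obtain ⟨T', hT', h'⟩ := hf
  refine ⟨fun v => T v + (T' (.ofFn fun i => g i v) + 2), Primrec.nat_add.comp hT
    (Primrec.nat_add.comp (hT'.comp (.vector_ofFn hg')) (.const 2)), fun b a ha => ?_⟩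
  obtain ⟨p, hp⟩ := h b a ha
  obtain ⟨p', hp'⟩ := h' (b + n) (fun i => b + i) fun i => by lia
  refine ⟨.seq p (.seq p' (.assign b (.var (b + n)))), fun s =>
    (hp s).seq fun s₁ ⟨hval₁, hs₁⟩ => ?_⟩
  have hargs : s₁.args (fun i : Fin n => b + i) = .ofFn fun i => g i (s.args a) :=
    congrArg List.Vector.ofFn (funext fun i => hval₁ i i.isLt)
  have hp₁ := hp' s₁
  rw [hargs] at hp₁
  refine hp₁.seq fun s₂ ⟨hval₂, hs₂⟩ => .assign le_rfl
    ⟨?_, (hs₁.trans (hs₂.mono (Nat.le_add_right _ _))).setVar le_rfl _⟩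
  simpa [Expr.eval] using hval₂

theorem primrec₂_of_succ {α : Type*} [Primcodable α] {r : α → ℕ → ℕ} {g : α → ℕ × ℕ → ℕ}
    (h0 : Primrec fun x => r x 0) (hg : Primrec₂ g) (hr : ∀ x y, r x (y + 1) = g x (y, r x y)) :
    Primrec₂ r :=
  (Primrec.nat_rec h0 hg).of_eq fun x y => by
    induction y with
    | zero => rfl
    | succ y ih => rw [hr, ← ih]

theorem primrec₂_sum_range {α : Type*} [Primcodable α] {f : α → ℕ → ℕ} (hf : Primrec₂ f) :
    Primrec₂ fun x K => ∑ j ∈ Finset.range K, f x j :=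
  primrec₂_of_succ (g := fun x p => p.2 + f x p.1) (.const 0)
    (Primrec.nat_add.comp (Primrec.snd.comp .snd) (hf.comp .fst (Primrec.fst.comp .snd)))
    fun _ _ => Finset.sum_range_succ _ _

/-- The value at `y` of the function that is defined from `f` and `g` by primitive recursion, with
parameters `w`. -/
def recValue {n : ℕ} (f : List.Vector ℕ n → ℕ) (g : List.Vector ℕ (n + 2) → ℕ)
    (w : List.Vector ℕ n) : ℕ → ℕ
  | 0 => f w
  | y + 1 => g (y ::ᵥ recValue f g w y ::ᵥ w)

theorem primrec₂_recValue {n : ℕ} {f : List.Vector ℕ n → ℕ} {g : List.Vector ℕ (n + 2) → ℕ}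
    (hf : Primrec f) (hg : Primrec g) : Primrec₂ (recValue f g) :=
  primrec₂_of_succ (g := fun w p => g (p.1 ::ᵥ p.2 ::ᵥ w)) hf
    (hg.comp (Primrec.vector_cons.comp (Primrec.fst.comp .snd)
      (Primrec.vector_cons.comp (Primrec.snd.comp .snd) .fst))) fun _ _ => rfl

section Recursion

variable {n b : ℕ} {a : Fin n → ℕ} {x : ℕ} {f T : List.Vector ℕ n → ℕ}
  {g T' : List.Vector ℕ (n + 2) → ℕ} {p p' : Prog}

/-- One round of the recursion with counter `b + 1` and current value `b`: the program `p'`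
computes the next value into `b + 2`. -/
def recBody (b : ℕ) (p' : Prog) : Prog :=
  .seq p' (.seq (.assign b (.var (b + 2))) (.assign (b + 1) (.add (.var (b + 1)) (.num 1))))

/-- The program that computes a function defined by primitive recursion, with the recursion
argument in variable `x`. -/
def recProg (b x : ℕ) (p p' : Prog) : Prog :=
  .seq p (.seq (.assign (b + 1) (.num 0))
    (.loop (.sub (.var x) (.var (b + 1))) (recBody b p')))

theorem runs_recBody (hp' : Computes p' (b + 2) (Fin.cons (b + 1) (Fin.cons b a)) g T')
    (ha : ∀ i, a i < b) {s s₁ : Memory} (hs₁ : KeepsBelow b s s₁) {j : ℕ}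
    (hval : s₁.var b = recValue f g (s.args a) j) (hj : s₁.var (b + 1) = j) :
    Runs (recBody b p') s₁ (T' (j ::ᵥ recValue f g (s.args a) j ::ᵥ s.args a) + (2 + 4))
      fun s' => s'.var b = recValue f g (s.args a) (j + 1) ∧ s'.var (b + 1) = j + 1 ∧
        KeepsBelow b s s' := by
  have hp₁ := hp' s₁
  rw [Memory.args_cons, Memory.args_cons, hval, hj, hs₁.args_eq ha] at hp₁
  refine hp₁.seq fun s₂ ⟨hval₂, hs₂⟩ => ?_
  have hs := hs₁.trans (hs₂.mono (Nat.le_add_right b 2))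
  refine (Runs.assign (Q := fun s' => s'.var b = recValue f g (s.args a) (j + 1) ∧
    s'.var (b + 1) = j ∧ KeepsBelow b s s') le_rfl ⟨?_, ?_, hs.setVar le_rfl _⟩).seq
    fun s₃ ⟨hval₃, hj₃, hs₃⟩ => .assign le_rfl ⟨?_, ?_, hs₃.setVar (Nat.le_succ b) _⟩
  · simpa [Expr.eval, recValue] using hval₂
  · rw [Memory.setVar_var, if_neg (by lia), hs₂.1 _ (by lia), hj]
  · rw [Memory.setVar_var, if_neg (by lia), hval₃]
  · simpa [Expr.eval] using hj₃

theorem Computes.recProg (hp : Computes p b a f T)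
    (hp' : Computes p' (b + 2) (Fin.cons (b + 1) (Fin.cons b a)) g T') (ha : ∀ i, a i < b)
    (hx : x < b) :
    Computes (recProg b x p p') b (Fin.cons x a) (fun v => recValue f g v.tail v.head)
      fun v => T v.tail + (2 + ((∑ j ∈ Finset.range v.head,
        (4 + (T' (j ::ᵥ recValue f g v.tail j ::ᵥ v.tail) + (2 + 4)))) + 4)) := by
  intro s
  simp only [Memory.args_cons, List.Vector.head_cons, List.Vector.tail_cons]
  refine (hp s).seq fun s₁ ⟨hval₁, hs₁⟩ => ?_
  refine (Runs.assign (Q := fun s' => s'.var b = recValue f g (s.args a) 0 ∧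
    s'.var (b + 1) = 0 ∧ KeepsBelow b s s') le_rfl
    ⟨?_, ?_, hs₁.setVar (Nat.le_succ b) _⟩).seq fun s₂ hs₂ => ?_
  · rw [Memory.setVar_var, if_neg (by lia), hval₁, recValue]
  · simp [Expr.eval]
  refine (Runs.loop_sum (s.var x) _ (fun j s' => s'.var b = recValue f g (s.args a) j ∧
    s'.var (b + 1) = j ∧ KeepsBelow b s s') ?_ ?_ hs₂).mono le_rfl fun s' h => ⟨h.1, h.2.2⟩
  · rintro j hj s₃ ⟨hval₃, hj₃, hs₃⟩
    refine ⟨?_, runs_recBody hp' ha hs₃ hval₃ hj₃⟩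
    simp only [Expr.eval, hj₃, hs₃.1 x hx]
    lia
  · rintro s₃ ⟨-, hj₃, hs₃⟩
    simp [Expr.eval, hj₃, hs₃.1 x hx]

end Recursion

theorem MachineComputable.prec {n : ℕ} {f : List.Vector ℕ n → ℕ}
    {g : List.Vector ℕ (n + 2) → ℕ} (hf : MachineComputable f) (hg : MachineComputable g)
    (hf' : Primrec f) (hg' : Primrec g) :
    MachineComputable fun v : List.Vector ℕ (n + 1) => recValue f g v.tail v.head := by
  obtain ⟨T, hT, h⟩ := hf
  obtain ⟨T', hT', h'⟩ := hg
  have hround : Primrec₂ fun (w : List.Vector ℕ n) j =>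
      4 + (T' (j ::ᵥ recValue f g w j ::ᵥ w) + (2 + 4)) :=
    Primrec.nat_add.comp (.const 4) (Primrec.nat_add.comp
      (hT'.comp (Primrec.vector_cons.comp .snd (Primrec.vector_cons.comp
        ((primrec₂_recValue hf' hg').comp .fst .snd) .fst))) (.const _))
  refine ⟨_, Primrec.nat_add.comp (hT.comp .vector_tail) (Primrec.nat_add.comp (.const 2)
    (Primrec.nat_add.comp ((primrec₂_sum_range hround).comp .vector_tail .vector_head)
      (.const 4))), fun b a ha => ?_⟩
  obtain ⟨p, hp⟩ := h b (Fin.tail a) fun i => ha _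
  obtain ⟨p', hp'⟩ := h' (b + 2) (Fin.cons (b + 1) (Fin.cons b (Fin.tail a))) <|
    Fin.cases (by simp) (Fin.cases (by simp) fun i => Nat.lt_add_right 2 (ha i.succ))
  have hrec := hp.recProg hp' (fun i => ha i.succ) (ha 0)
  rw [Fin.cons_self_tail] at hrec
  exact ⟨_, hrec⟩

theorem machineComputable_of_primrec' {n : ℕ} {f : List.Vector ℕ n → ℕ}
    (hf : Nat.Primrec' f) : MachineComputable f := by
  induction hf with
  | zero => exact machineComputable_of_expr (fun _ => .num 0) 1 (fun _ => rfl) fun _ _ => rfl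
  | succ =>
    exact machineComputable_of_expr (fun a => .add (.var (a 0)) (.num 1)) 3 (fun _ => rfl)
      fun _ _ => rfl
  | get i =>
    exact machineComputable_of_expr (fun a => .var (a i)) 1 (fun _ => rfl)
      fun a s => by simp [Expr.eval, Memory.args]
  | comp g _ hg ihf ihg => exact ihf.comp ihg fun i => (hg i).to_prim
  | @prec n f g hf hg ihf ihg =>
    have hrec : (fun v : List.Vector ℕ (n + 1) => v.head.rec (f v.tail)
        fun y IH => g (y ::ᵥ IH ::ᵥ v.tail)) = fun v => recValue f g v.tail v.head := by
      funext v
      induction v.head with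
      | zero => rfl
      | succ y ih => simp only [recValue, ih]
    rw [hrec]
    exact ihf.prec ihg hf.to_prim hg.to_prim

theorem exists_prog_of_primrec {f : ℕ → ℕ} (hf : Primrec f) : ∃ T : ℕ → ℕ, Primrec T ∧
    ∀ b a, a < b → ∃ p, ∀ s : Memory, Runs p s (T (s.var a)) fun s' =>
      s'.var b = f (s.var a) ∧ KeepsBelow b s s' := by
  obtain ⟨T, hT, h⟩ := machineComputable_of_primrec' (Nat.Primrec'.prim_iff₁.2 hf)
  refine ⟨fun x => T (x ::ᵥ .nil), hT.comp (Primrec.vector_cons.comp .id (.const _)),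
    fun b a hab => ?_⟩
  exact h b (fun _ => a) fun _ => hab

theorem exists_prog_of_primrec₂ {f : ℕ → ℕ → ℕ} (hf : Primrec₂ f) :
    ∃ T : ℕ → ℕ → ℕ, Primrec₂ T ∧ ∀ b a a', a < b → a' < b → ∃ p, ∀ s : Memory,
      Runs p s (T (s.var a) (s.var a')) fun s' =>
        s'.var b = f (s.var a) (s.var a') ∧ KeepsBelow b s s' := by
  obtain ⟨T, hT, h⟩ := machineComputable_of_primrec' (Nat.Primrec'.prim_iff₂.2 hf)
  refine ⟨fun x y => T (x ::ᵥ y ::ᵥ .nil), hT.comp (Primrec.vector_cons.comp .fst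
    (Primrec.vector_cons.comp .snd (.const _))), fun b a a' hab hab' => ?_⟩
  exact h b (Fin.cons a fun _ => a') (Fin.cases hab fun _ => hab')

/-! ### Compressed tables -/

section Walk

variable {R : ℕ} {q : ℕ → ℕ} {i j : ℕ}

/-- The walk through a ranking in which place `i` holds the relevant candidate number `q i`, or an
irrelevant candidate if `q i = 0`. It records the length after `i` places when runs of irrelevant
candidates are cut to length `R + 1`, and the length of the current run. -/
def walk (R : ℕ) (q : ℕ → ℕ) : ℕ → ℕ × ℕ
  | 0 => (0, 0)
  | i + 1 =>
    if q i ≠ 0 then ((walk R q i).1 + 1, 0)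
    else if (walk R q i).2 ≤ R then ((walk R q i).1 + 1, (walk R q i).2 + 1)
    else walk R q i

theorem walk_add_bounds (h : (walk R q i).2 = 0) (d : ℕ) :
    ((walk R q (i + d)).1 = (walk R q i).1 + d ∨
      R < d ∧ (walk R q i).1 + R < (walk R q (i + d)).1) ∧
    (walk R q i).1 + (walk R q (i + d)).2 ≤ (walk R q (i + d)).1 ∧
    (walk R q (i + d)).1 ≤ (walk R q i).1 + d := by
  induction d with
  | zero => simp [h]
  | succ d ih =>
    rw [← add_assoc, walk]
    split_ifs <;> lia

theorem eqUpTo_walk_sub (h : q i ≠ 0) (hij : i < j) :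
    EqUpTo R ((j : ℤ) - i) ((walk R q j).1 - (walk R q i).1) := by
  have hsucc : walk R q (i + 1) = ((walk R q i).1 + 1, 0) := by rw [walk, if_pos h]
  have hbounds := walk_add_bounds (R := R) (q := q) (i := i + 1) (by rw [hsucc]) (j - (i + 1))
  rw [Nat.add_sub_cancel' hij, hsucc] at hbounds
  unfold EqUpTo
  lia

theorem eqUpTo_walk_add_one (R : ℕ) (q : ℕ → ℕ) (j : ℕ) :
    EqUpTo R ((j : ℤ) + 1) ((walk R q j).1 + 1) := by
  have hbounds := walk_add_bounds (R := R) (q := q) (i := 0) rfl j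
  rw [Nat.zero_add, walk] at hbounds
  unfold EqUpTo
  lia

theorem walk_le (R : ℕ) (q : ℕ → ℕ) (i : ℕ) :
    (walk R q i).1 ≤ ((Finset.range i).filter fun j => q j ≠ 0).card * (R + 2) + (walk R q i).2 ∧
      (walk R q i).2 ≤ R + 1 := by
  induction i with
  | zero => simp [walk]
  | succ i ih =>
    rw [walk, Finset.range_add_one, Finset.filter_insert]
    by_cases h : q i ≠ 0
    · rw [if_pos h, if_pos h, Finset.card_insert_of_notMem (by simp), add_mul]
      lia
    · rw [if_neg h, if_neg h]
      split_ifs <;> lia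

end Walk

variable {n m N R : ℕ} {P : Profile n m} {S : Finset (Fin m)} {μ : Fin m → ℕ}

section Marks

/-- A numbering of `S` that assigns `0` to all other candidates. -/
structure Marks (S : Finset (Fin m)) (N : ℕ) (μ : Fin m → ℕ) : Prop extends Numbering S N μ where
  eq_zero : ∀ c ∉ S, μ c = 0

theorem Marks.ne_zero_iff (h : Marks S N μ) {c : Fin m} : μ c ≠ 0 ↔ c ∈ S :=
  ⟨fun hc => by_contra fun hcS => hc (h.eq_zero c hcS), fun hc =>
    (Nat.succ_le_iff.1 (h.one_le hc)).ne'⟩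

theorem Marks.empty : Marks (∅ : Finset (Fin m)) 0 fun _ => 0 where
  injOn := by simp
  range a := by
    simp only [Finset.notMem_empty, false_and, exists_false, false_iff]
    lia
  eq_zero _ _ := rfl

theorem Marks.insert (h : Marks S N μ) {c : Fin m} (hc : c ∉ S) :
    Marks (insert c S) (N + 1) (Function.update μ c (N + 1)) := by
  have hne : ∀ d ∈ S, d ≠ c := fun d hd hdc => hc (hdc ▸ hd)
  have hS : Set.EqOn (Function.update μ c (N + 1)) μ S := fun d hd =>
    Function.update_of_ne (hne d hd) _ _
  refine ⟨⟨?_, fun a => ?_⟩, fun d hd => ?_⟩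
  · rw [Finset.coe_insert, Set.injOn_insert (by simpa using hc), hS.injOn_iff, hS.image_eq]
    refine ⟨h.injOn, ?_⟩
    rintro ⟨d, hd, hdc⟩
    have := h.le hd
    rw [Function.update_self] at hdc
    lia
  · have hrange : (∃ d ∈ S, Function.update μ c (N + 1) d = a) ↔ 1 ≤ a ∧ a ≤ N := by
      rw [← h.range]
      exact exists_congr fun d => and_congr_right fun hd => by rw [hS hd]
    rw [Finset.exists_mem_insert, hrange, Function.update_self]
    lia
  · rw [Finset.mem_insert, not_or] at hd
    rw [Function.update_of_ne hd.1, h.eq_zero d hd.2]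

/-- The number of the candidate in place `i` of the ranking of voter `v`. -/
def numberAt (P : Profile n m) (μ : Fin m → ℕ) (v i : ℕ) : ℕ :=
  if h : v < n ∧ i < m then μ (P ⟨v, h.1⟩ ⟨i, h.2⟩) else 0

theorem numberAt_of_lt (P : Profile n m) (μ : Fin m → ℕ) (v : Fin n) {i : ℕ} (hi : i < m) :
    numberAt P μ v i = μ (P v ⟨i, hi⟩) :=
  dif_pos ⟨v.isLt, hi⟩

theorem numberAt_symm (P : Profile n m) (μ : Fin m → ℕ) (v : Fin n) (c : Fin m) :
    numberAt P μ v ((P v).symm c) = μ c := by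
  rw [numberAt_of_lt P μ v ((P v).symm c).isLt, Fin.eta, Equiv.apply_symm_apply]

theorem Marks.card_numberAt_ne_zero_le (h : Marks S N μ) (P : Profile n m) (v i : ℕ) :
    ((Finset.range i).filter fun j => numberAt P μ v j ≠ 0).card ≤ N := by
  have hmem : ∀ j, numberAt P μ v j ≠ 0 → ∃ h : v < n ∧ j < m, P ⟨v, h.1⟩ ⟨j, h.2⟩ ∈ S := by
    intro j hj
    rw [numberAt] at hj
    split_ifs at hj with hvj
    · exact ⟨hvj, h.ne_zero_iff.1 hj⟩
    · exact absurd rfl hj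
  calc ((Finset.range i).filter fun j => numberAt P μ v j ≠ 0).card
      ≤ (Finset.Icc 1 N).card := by
        refine Finset.card_le_card_of_injOn (numberAt P μ v) (fun j hj => ?_)
          fun j hj j' hj' he => ?_
        · obtain ⟨hvj, hS⟩ := hmem j (Finset.mem_filter.1 hj).2
          rw [numberAt, dif_pos hvj]
          exact Finset.mem_coe.2 (Finset.mem_Icc.2 ((h.range _).1 ⟨_, hS, rfl⟩))
        · obtain ⟨hvj, hS⟩ := hmem j (Finset.mem_filter.1 hj).2
          obtain ⟨hvj', hS'⟩ := hmem j' (Finset.mem_filter.1 hj').2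
          rw [numberAt, numberAt, dif_pos hvj, dif_pos hvj'] at he
          simpa using (P _).injective (h.injOn hS hS' he)
    _ = N := by simp

theorem Marks.walk_numberAt_le (h : Marks S N μ) (P : Profile n m) (R v i : ℕ) :
    (walk R (numberAt P μ v) i).1 ≤ N * (R + 2) + (R + 1) := by
  obtain ⟨hle, hrun⟩ := walk_le R (numberAt P μ v) i
  exact hle.trans (Nat.add_le_add (Nat.mul_le_mul_right _ (h.card_numberAt_ne_zero_le P v i)) hrun)

end Marks

section Similar

theorem distEqUpTo_of_lt {ι : Type*} {r : ℕ} {X Y : ι → ℤ}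
    (hlt : ∀ x y, X x < X y → EqUpTo r (X y - X x) (Y y - Y x))
    (heq : ∀ x y, X x = X y → Y x = Y y) : DistEqUpTo r X Y := by
  intro x y
  obtain h | h | h := lt_trichotomy (X x) (X y)
  · have := hlt x y h
    unfold EqUpTo at *
    lia
  · rw [h, heq x y h]
    exact .inl (by lia)
  · exact hlt y x h

theorem Numbering.similar_of_walk (hμ : Numbering S N μ) {T : ℕ → ℕ → ℕ}
    (hT : ∀ v : Fin n, ∀ c ∈ S, T v (μ c) = (walk R (numberAt P μ v) ((P v).symm c)).1)
    (hT0 : ∀ v : Fin n, T v 0 = (walk R (numberAt P μ v) m).1) : Similar R P S μ T := by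
  have hne : ∀ v : Fin n, ∀ c ∈ S, numberAt P μ v ((P v).symm c) ≠ 0 := by
    intro v c hc
    rw [numberAt_symm]
    exact Nat.one_le_iff_ne_zero.1 (hμ.one_le hc)
  have hlt : ∀ v : Fin n, ∀ c, ((P v).symm c : ℕ) < m := fun v c => ((P v).symm c).isLt
  intro v
  refine distEqUpTo_of_lt ?_ ?_
  · rintro (_ | _ | c) (_ | _ | d) h <;> simp only [points, tablePoints] at h ⊢
    · lia
    · rw [hT0, sub_neg_eq_add, sub_neg_eq_add]
      exact eqUpTo_walk_add_one _ _ _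
    · rw [hT v d d.2, sub_neg_eq_add, sub_neg_eq_add]
      exact eqUpTo_walk_add_one _ _ _
    · lia
    · lia
    · exact absurd (Int.ofNat_lt.1 h) (hlt v d).not_gt
    · lia
    · rw [hT0, hT v c c.2]
      exact eqUpTo_walk_sub (hne v c c.2) (hlt v c)
    · rw [hT v c c.2, hT v d d.2]
      exact eqUpTo_walk_sub (hne v c c.2) (by exact_mod_cast h)
  · rintro (_ | _ | c) (_ | _ | d) h <;> simp only [points, tablePoints] at h ⊢
    any_goals lia
    · exact absurd (Int.ofNat_inj.1 h) (hlt v d).ne'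
    · exact absurd (Int.ofNat_inj.1 h) (hlt v c).ne
    · rw [hT v c c.2, hT v d d.2, Int.ofNat_inj.1 h]

end Similar

section Seen

variable {lim v i : ℕ} {c : Fin m}

/-- The candidates in the first `lim` places of the voters before `v` and in the first `i` places
of voter `v`. -/
def seen (P : Profile n m) (lim v i : ℕ) : Finset (Fin m) :=
  {c | ∃ u : Fin n, ((u : ℕ) < v ∧ ((P u).symm c : ℕ) < lim) ∨
    ((u : ℕ) = v ∧ ((P u).symm c : ℕ) < i)}

theorem mem_seen : c ∈ seen P lim v i ↔
    ∃ u : Fin n, ((u : ℕ) < v ∧ ((P u).symm c : ℕ) < lim) ∨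
      ((u : ℕ) = v ∧ ((P u).symm c : ℕ) < i) := by
  simp [seen]

theorem seen_zero (P : Profile n m) (lim : ℕ) : seen P lim 0 0 = ∅ := by
  ext c
  simp [mem_seen]

theorem seen_add_one (P : Profile n m) (lim : ℕ) (v : Fin n) (hi : i < m) :
    seen P lim v (i + 1) = insert (P v ⟨i, hi⟩) (seen P lim v i) := by
  ext c
  rw [Finset.mem_insert, mem_seen, mem_seen]
  constructor
  · rintro ⟨u, h | ⟨huv, hc⟩⟩
    · exact .inr ⟨u, .inl h⟩
    · obtain hc | hc := Nat.lt_succ_iff_lt_or_eq.1 hc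
      · exact .inr ⟨u, .inr ⟨huv, hc⟩⟩
      · left
        obtain rfl : u = v := Fin.ext huv
        rw [← Equiv.symm_apply_eq]
        exact Fin.ext hc
  · rintro (rfl | ⟨u, h | ⟨huv, hc⟩⟩)
    · exact ⟨v, .inr ⟨rfl, by simp⟩⟩
    · exact ⟨u, .inl h⟩
    · exact ⟨u, .inr ⟨huv, by lia⟩⟩

theorem seen_row (P : Profile n m) (lim v : ℕ) : seen P lim (v + 1) 0 = seen P lim v lim := by
  ext c
  rw [mem_seen, mem_seen]
  exact exists_congr fun u => by lia

theorem card_seen_le (P : Profile n m) (lim : ℕ) : (seen P lim n 0).card ≤ n * lim := by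
  have hsub : seen P lim n 0 ⊆
      Finset.univ.biUnion fun v => {c | ((P v).symm c : ℕ) < lim} := by
    intro c hc
    obtain ⟨u, hu⟩ := mem_seen.1 hc
    simpa using ⟨u, by lia⟩
  have hcard : ∀ v ∈ Finset.univ,
      (Finset.univ.filter fun c => ((P v).symm c : ℕ) < lim).card ≤ lim := by
    intro v _
    simpa using Finset.card_le_card_of_injOn (t := Finset.range lim) (fun c => ((P v).symm c : ℕ))
      (fun c hc => by simpa using hc) (Fin.val_injective.comp (P v).symm.injective).injOn
  simpa using (Finset.card_le_card hsub).trans (Finset.card_biUnion_le_card_mul _ _ lim hcard)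

theorem lt_pos_of_notMem_seen {L : ℕ} (hc : c ∉ seen P (min m L) n 0) (v : Fin n) :
    L < pos P v c := by
  rw [mem_seen] at hc
  push Not at hc
  have := (hc v).1 v.isLt
  have := ((P v).symm c).isLt
  rw [pos]
  lia

theorem mem_seen_of_rank_le {L : ℕ} (hn : 0 < n) (hc : rank P c ≤ L) :
    c ∈ seen P (min m L) n 0 := by
  by_contra h
  have : Nonempty (Fin n) := ⟨⟨0, hn⟩⟩
  obtain ⟨v, hv⟩ : ∃ v, pos P v c = rank P c := exists_eq_ciInf_of_finite
  have := lt_pos_of_notMem_seen h v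
  lia

/-- A winning committee of size `k` exists only if `k ≤ n`, so that a larger `k` may be replaced by
`n + 1`. -/
theorem canChange_iff_tableAnswer {k B : ℕ} (hμ : Numbering (seen P (min m (n ^ 2 + n)) n 0) N μ)
    {l : List ℕ} (hl : l.length = n * (N + 1))
    (hs : Similar (n ^ 2) P (seen P (min m (n ^ 2 + n)) n 0) μ (entry N l)) :
    CanChange P k B ↔ TableAnswer n (min k (n + 1)) (min B (n ^ 2)) N l := by
  rw [← canChange_min_iff, ← canChangeWith_iff_tableAnswer hμ (fun c hc v => ?_) hl
    (hs.mono (min_le_right _ _))]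
  · refine ⟨fun h => ?_, fun h => h.mono (Set.subset_univ _) (min_le_left _ _)⟩
    have hk := (CanChangeWith.normal h).le
    have hn : 0 < n := (CanChangeWith.one_le_and_lt h).1.trans hk
    have hnk := Nat.mul_le_mul_left n hk
    exact h.canChangeWith_min.mono
      (fun c hc => mem_seen_of_rank_le hn (hc.trans (by rw [Nat.mul_add_one]; lia)))
      (min_le_min_left _ (by lia))
  · have := lt_pos_of_notMem_seen hc v
    have := min_le_right B (n ^ 2)
    lia

end Seen

section Filled

variable {a : ℕ → ℕ} {v i : ℕ}

/-- The array `a` holds the compressed table as far as it is determined by the voters before `v`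
and by the first `i` places of voter `v`. -/
structure Filled (P : Profile n m) (S : Finset (Fin m)) (N R : ℕ) (μ : Fin m → ℕ) (v i : ℕ)
    (a : ℕ → ℕ) : Prop where
  entries : ∀ u : Fin n, ∀ c ∈ S, (u : ℕ) < v ∨ (u : ℕ) = v ∧ ((P u).symm c : ℕ) < i →
    a (u * (N + 1) + μ c) = (walk R (numberAt P μ u) ((P u).symm c)).1
  ends : ∀ u : Fin n, (u : ℕ) < v → a (u * (N + 1)) = (walk R (numberAt P μ u) m).1

theorem filled_zero (P : Profile n m) (S : Finset (Fin m)) (N R : ℕ) (μ : Fin m → ℕ)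
    (a : ℕ → ℕ) : Filled P S N R μ 0 0 a :=
  ⟨fun _ _ _ _ => by lia, fun _ _ => by lia⟩

theorem index_inj {b c u : ℕ} (hb : b ≤ N) (hc : c ≤ N)
    (h : u * (N + 1) + b = v * (N + 1) + c) : u = v ∧ b = c := by
  have hbc := congrArg (· % (N + 1)) h
  simp only [Nat.mul_add_mod', Nat.mod_eq_of_lt (Nat.lt_succ_of_le hb),
    Nat.mod_eq_of_lt (Nat.lt_succ_of_le hc)] at hbc
  subst hbc
  exact ⟨Nat.eq_of_mul_eq_mul_right N.succ_pos (Nat.add_right_cancel h), rfl⟩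

theorem Filled.of_notMem {v : Fin n} (h : Filled P S N R μ v i a) (hi : i < m)
    (hc : P v ⟨i, hi⟩ ∉ S) : Filled P S N R μ v (i + 1) a := by
  refine ⟨fun u c hcS hu => h.entries u c hcS (hu.imp_right fun ⟨huv, hci⟩ => ⟨huv, ?_⟩), h.ends⟩
  obtain hci | hci := Nat.lt_succ_iff_lt_or_eq.1 hci
  · exact hci
  · obtain rfl : u = v := Fin.ext huv
    have : (P u).symm c = ⟨i, hi⟩ := Fin.ext hci
    rw [Equiv.symm_apply_eq] at this
    exact absurd (this ▸ hcS) hc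

theorem Filled.update_entry {v : Fin n} (h : Filled P S N R μ v i a) (hμ : Numbering S N μ)
    (hi : i < m) (hc : P v ⟨i, hi⟩ ∈ S) :
    Filled P S N R μ v (i + 1) (Function.update a (v * (N + 1) + μ (P v ⟨i, hi⟩))
      (walk R (numberAt P μ v) i).1) := by
  refine ⟨fun u d hd hu => ?_, fun u hu => ?_⟩ <;> rw [Function.update_apply]
  · split_ifs with hidx
    · obtain ⟨huv, hdc⟩ := index_inj (hμ.le hd) (hμ.le hc) hidx
      obtain rfl : u = v := Fin.ext huv
      obtain rfl := hμ.injOn hd hc hdc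
      rw [Equiv.symm_apply_apply]
    · refine h.entries u d hd (hu.imp_right fun ⟨huv, hdi⟩ => ⟨huv, ?_⟩)
      obtain hdi | hdi := Nat.lt_succ_iff_lt_or_eq.1 hdi
      · exact hdi
      · obtain rfl : u = v := Fin.ext huv
        have : (P u).symm d = ⟨i, hi⟩ := Fin.ext hdi
        rw [Equiv.symm_apply_eq] at this
        exact absurd (by rw [this]) hidx
  · rw [if_neg, h.ends u hu]
    intro hidx
    have := (index_inj (b := 0) (Nat.zero_le N) (hμ.le hc) hidx).2
    have := hμ.one_le hc
    lia

theorem Filled.update_end {v : Fin n} (h : Filled P S N R μ v m a) (hμ : Numbering S N μ) :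
    Filled P S N R μ (v + 1) 0 (Function.update a (v * (N + 1))
      (walk R (numberAt P μ v) m).1) := by
  refine ⟨fun u d hd hu => ?_, fun u hu => ?_⟩ <;> rw [Function.update_apply]
  · rw [if_neg]
    · have := ((P u).symm d).isLt
      exact h.entries u d hd (by lia)
    · intro hidx
      have := (index_inj (c := 0) (hμ.le hd) (Nat.zero_le N) hidx).2
      have := hμ.one_le hd
      lia
  · split_ifs with hidx
    · obtain rfl : u = v :=
        Fin.ext (index_inj (b := 0) (c := 0) (Nat.zero_le N) (Nat.zero_le N) hidx).1
      rfl
    · obtain hu | hu := Nat.lt_succ_iff_lt_or_eq.1 hu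
      · exact h.ends u hu
      · exact absurd (by rw [hu]) hidx

/-- The table with `n` rows that is stored in the array `a`, as a list. -/
def tableList (a : ℕ → ℕ) (n N : ℕ) : List ℕ := (List.range (n * (N + 1))).map a

theorem length_tableList (a : ℕ → ℕ) (n N : ℕ) : (tableList a n N).length = n * (N + 1) := by
  simp [tableList]

theorem entry_tableList (a : ℕ → ℕ) {u x : ℕ} (hu : u < n) (hx : x ≤ N) :
    entry N (tableList a n N) u x = a (u * (N + 1) + x) := by
  rw [entry, List.getD_eq_getElem _ _ (by rw [length_tableList]; exact row_add_column_lt hu hx)]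
  simp [tableList]

theorem Filled.similar (h : Filled P S N R μ n 0 a) (hμ : Numbering S N μ) :
    Similar R P S μ (entry N (tableList a n N)) := by
  refine hμ.similar_of_walk (fun v c hc => ?_) fun v => ?_
  · rw [entry_tableList _ v.isLt (hμ.le hc)]
    exact h.entries v c hc (.inl v.isLt)
  · rw [entry_tableList _ v.isLt (Nat.zero_le _), add_zero]
    exact h.ends v v.isLt

theorem Filled.le (h : Filled P S N R μ n 0 a) (hμ : Marks S N μ) {j : ℕ}
    (hj : j < n * (N + 1)) : a j ≤ N * (R + 2) + (R + 1) := by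
  have hv : j / (N + 1) < n := Nat.div_lt_of_lt_mul (by rwa [mul_comm])
  have hcol : j % (N + 1) < N + 1 := Nat.mod_lt _ N.succ_pos
  rw [← Nat.div_add_mod' j (N + 1)]
  by_cases h0 : j % (N + 1) = 0
  · rw [h0, add_zero]
    exact (h.ends ⟨_, hv⟩ hv).trans_le (hμ.walk_numberAt_le _ _ _ _)
  · obtain ⟨c, hc, hcj⟩ := (hμ.range (j % (N + 1))).2 ⟨by lia, by lia⟩
    rw [← hcj]
    exact (h.entries ⟨_, hv⟩ c hc (.inl hv)).trans_le (hμ.walk_numberAt_le _ _ _ _)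

end Filled

/-! ### The algorithm -/

section Bounds

theorem pair_le_pair {a a' b b' : ℕ} (ha : a ≤ a') (hb : b ≤ b') :
    Nat.pair a b ≤ Nat.pair a' b' :=
  (StrictMono.monotone (fun _ _ h => Nat.pair_lt_pair_left b h) ha).trans
    (StrictMono.monotone (fun _ _ h => Nat.pair_lt_pair_right a' h) hb)

theorem exists_monotone_primrec_bound {f : ℕ → ℕ} (hf : Primrec f) :
    ∃ g, Primrec g ∧ Monotone g ∧ ∀ x, f x ≤ g x := by
  refine ⟨fun y => ∑ j ∈ Finset.range (y + 1), f j, ?_, fun x y hxy => ?_, fun x => ?_⟩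
  · exact (primrec₂_sum_range (f := fun (_ : Unit) j => f j) (hf.comp .snd)).comp (.const ()) .succ
  · exact Finset.sum_le_sum_of_subset (Finset.range_mono (Nat.succ_le_succ hxy))
  · exact Finset.single_le_sum (fun _ _ => Nat.zero_le _) (Finset.self_mem_range_succ x)

theorem exists_monotone_primrec₂_bound {f : ℕ → ℕ → ℕ} (hf : Primrec₂ f) :
    ∃ g, Primrec₂ g ∧ (∀ x x' y y', x ≤ x' → y ≤ y' → g x y ≤ g x' y') ∧
      ∀ x y, f x y ≤ g x y := by
  obtain ⟨g, hg, hmono, hle⟩ := exists_monotone_primrec_bound (Primrec₂.unpaired.2 hf)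
  refine ⟨fun x y => g (Nat.pair x y), hg.comp Primrec₂.natPair,
    fun x x' y y' hx hy => hmono (pair_le_pair hx hy), fun x y => ?_⟩
  simpa using hle (Nat.pair x y)

/-- A bound on the codes of the lists of `len` numbers that are at most `E`. -/
def codeBound (E : ℕ) : ℕ → ℕ
  | 0 => 0
  | len + 1 => Nat.succ (Nat.pair E (codeBound E len))

theorem primrec₂_codeBound : Primrec₂ codeBound :=
  primrec₂_of_succ (g := fun E p => Nat.succ (Nat.pair E p.2)) (.const 0)
    (Primrec.succ.comp (Primrec₂.natPair.comp .fst (Primrec.snd.comp .snd))) fun _ _ => rfl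

theorem codeBound_monotone (E : ℕ) : Monotone (codeBound E) :=
  monotone_nat_of_le_succ fun len =>
    (Nat.right_le_pair E (codeBound E len)).trans (Nat.le_succ _)

theorem encode_le_codeBound {E : ℕ} {l : List ℕ} (h : ∀ a ∈ l, a ≤ E) :
    Encodable.encode l ≤ codeBound E l.length := by
  induction l with
  | nil => exact Nat.zero_le _
  | cons a l ih =>
    rw [List.forall_mem_cons] at h
    rw [Encodable.encode_list_cons]
    exact Nat.succ_le_succ (pair_le_pair h.1 (ih h.2))

end Bounds

section Encoding

theorem getD_flatMap {α : Type*} {f : α → List ℕ} {w : ℕ} (hf : ∀ a, (f a).length = w)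
    (l : List α) {j i : ℕ} (hj : j < l.length) (hi : i < w) :
    (l.flatMap f).getD (j * w + i) 0 = (f l[j]).getD i 0 := by
  induction l generalizing j with
  | nil => exact absurd hj (Nat.not_lt_zero j)
  | cons a l ih =>
    rw [List.flatMap_cons]
    cases j with
    | zero =>
      rw [Nat.zero_mul, Nat.zero_add, List.getD_append _ _ _ _ (by rwa [hf])]
      rfl
    | succ j =>
      have hidx : (j + 1) * w + i = w + (j * w + i) := by ring
      rw [List.getD_append_right _ _ _ _ (by rw [hf]; lia), hf, hidx, Nat.add_sub_cancel_left]
      exact ih (Nat.lt_of_succ_lt_succ hj)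

theorem Instance.getD_encode (I : Instance) (v : Fin I.n) {i : ℕ} (hi : i < I.m) :
    I.encode.getD (4 + v * I.m + i) 0 = I.P v ⟨i, hi⟩ := by
  rw [Instance.encode, add_assoc, List.getD_append_right _ _ _ _ (by simp)]
  simp only [List.length_cons, List.length_nil, Nat.add_sub_cancel_left]
  rw [getD_flatMap (w := I.m) (by simp) _ (by simp) hi, List.getD_eq_getElem _ _ (by simpa)]
  simp

theorem length_le_bitLength (l : List ℕ) : l.length ≤ bitLength l := by
  simp [bitLength]

theorem Instance.le_bitLength_encode (I : Instance) : 4 + I.n * I.m ≤ bitLength I.encode := by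
  have hlen : I.encode.length = 4 + I.n * I.m := by
    simp only [Instance.encode, List.length_append, List.length_flatMap, List.length_ofFn]
    simp [List.length_finRange]
  exact hlen ▸ length_le_bitLength _

end Encoding

section Algorithm

local infix:30 "::=" => Prog.assign
local infixr:25 ";;" => Prog.seq

-- The programs for primitive recursive functions are free to use the variables from 17 on.
local notation "acceptReg" => 0
local notation "votersReg" => 1
local notation "candsReg" => 2
local notation "sizeReg" => 3
local notation "budgetReg" => 4
local notation "squareReg" => 5
local notation "limitReg" => 6
local notation "countReg" => 7
local notation "voterReg" => 8
local notation "baseReg" => 9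
local notation "placeReg" => 10
local notation "candReg" => 11
local notation "lengthReg" => 12
local notation "gapReg" => 13
local notation "rowReg" => 14
local notation "codeReg" => 15
local notation "itemReg" => 16
local notation "scratchReg" => 17
local notation "inputArr" => 0
local notation "numberArr" => 1
local notation "tableArr" => 2

attribute [local simp] Expr.eval Expr.cost

variable {I : Instance} {N i : ℕ} {μ : Fin I.m → ℕ} {s : Memory}

/-- The number of places at the top of each ranking whose candidates are kept. -/
def Instance.limit (I : Instance) : ℕ := min I.m (I.n ^ 2 + I.n)

/-- The memory contains the input together with the numbers that control the compression. -/
structure InputRead (I : Instance) (s : Memory) : Prop where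
  voters : s.var votersReg = I.n
  cands : s.var candsReg = I.m
  size : s.var sizeReg = min I.k (I.n + 1)
  budget : s.var budgetReg = min I.B (I.n ^ 2)
  square : s.var squareReg = I.n ^ 2
  limit : s.var limitReg = I.limit
  input : ∀ j, s.arr inputArr j = I.encode.getD j 0

theorem InputRead.setVar (h : InputRead I s) {x : ℕ} (hx : limitReg < x) (a : ℕ) :
    InputRead I (s.setVar x a) := by
  have hvar : ∀ y ≤ limitReg, (s.setVar x a).var y = s.var y := fun y hy => by
    rw [Memory.setVar_var, if_neg (hy.trans_lt hx).ne]
  constructor <;> simp only [hvar, Nat.reduceLeDiff, h.voters, h.cands, h.size, h.budget, h.square,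
    h.limit, Memory.setVar_arr, h.input, implies_true]

theorem InputRead.setArr (h : InputRead I s) {x : ℕ} (hx : inputArr < x) (j a : ℕ) :
    InputRead I (s.setArr x j a) :=
  ⟨h.voters, h.cands, h.size, h.budget, h.square, h.limit, fun j' => by
    rw [Memory.setArr_arr, if_neg hx.ne, h.input]⟩

/-- The input is being scanned and the next entry is place `i` of voter `v`. -/
structure Scanning (I : Instance) (v i : ℕ) (s : Memory) : Prop extends InputRead I s where
  voter : s.var voterReg = v
  base : s.var baseReg = 4 + v * I.m
  place : s.var placeReg = i

/-- The entry of the input that is scanned. -/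
def scanExpr : Expr := .get inputArr (.add (.var baseReg) (.var placeReg))

theorem Scanning.eval_scanExpr {v : Fin I.n} (h : Scanning I v i s) (hi : i < I.m) :
    scanExpr.eval s = I.P v ⟨i, hi⟩ := by
  simp only [scanExpr, Expr.eval, h.base, h.place, h.input, I.getD_encode v hi]

/-- The candidates met before place `i` of voter `v` within the first `I.limit` places of a voter
have been numbered. -/
structure Marking (I : Instance) (v i : ℕ) (s : Memory) : Prop extends Scanning I v i s where
  marks : Marks (seen I.P I.limit v i) (s.var countReg) fun c => s.arr numberArr c

/-- Numbers the scanned candidate unless it already has a number. -/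
def markBody : Prog :=
  candReg ::= scanExpr ;;
  placeReg ::= .add (.var placeReg) (.num 1) ;;
  .ite (.get numberArr (.var candReg)) (candReg ::= .var candReg)
    (countReg ::= .add (.var countReg) (.num 1) ;;
      .put numberArr (.var candReg) (.var countReg))

theorem Marking.runs_markBody {v : Fin I.n} (h : Marking I v i s) (hi : i < I.m) :
    Runs markBody s 19 (Marking I v (i + 1)) := by
  have hcand := h.eval_scanExpr hi
  have hseen := seen_add_one I.P I.limit v hi
  generalize I.P v ⟨i, hi⟩ = c at hcand hseen
  refine (Runs.seq_assign (Runs.seq_assign (Runs.ite (T := 7) (fun he => ?_) fun he => ?_))).mono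
    (T' := 19) (by simp [scanExpr]) fun _ h => h
  · have hc : c ∈ seen I.P I.limit v i := h.marks.ne_zero_iff.1 (by simpa [hcand] using he)
    rw [Finset.insert_eq_self.2 hc] at hseen
    refine .assign (by simp) ⟨⟨?_, ?_, ?_, ?_⟩, ?_⟩
    · exact ((h.setVar (by simp) _).setVar (by simp) _).setVar (by simp) _
    · simp [h.voter]
    · simp [h.base]
    · simp [h.place]
    · simpa [hseen] using h.marks
  · have hc : c ∉ seen I.P I.limit v i := fun hc =>
      h.marks.ne_zero_iff.2 hc (by simpa [hcand] using he)
    refine (Runs.seq_assign (.put le_rfl ⟨⟨?_, ?_, ?_, ?_⟩, ?_⟩)).mono (by simp) fun _ h => h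
    · exact (((h.setVar (by simp) _).setVar (by simp) _).setVar (by simp) _).setArr (by simp) _ _
    · simp [h.voter]
    · simp [h.base]
    · simp [h.place]
    · have hcomp : (fun d : Fin I.m => Function.update (s.arr numberArr) c (s.var countReg + 1) d)
          = Function.update (fun d : Fin I.m => s.arr numberArr d) c (s.var countReg + 1) :=
        Function.update_comp_eq_of_injective' _ Fin.val_injective _ _
      simpa [hcand, hseen, hcomp] using h.marks.insert hc

/-- Moves on to the first place of the next voter. -/
def nextVoter : Prog :=
  baseReg ::= .add (.var baseReg) (.var candsReg) ;;
  voterReg ::= .add (.var voterReg) (.num 1) ;;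
  placeReg ::= .num 0

theorem Scanning.runs_nextVoter {v : ℕ} (h : Scanning I v i s) :
    Runs nextVoter s 10 fun s' => Scanning I (v + 1) 0 s' ∧
      (∀ x, x ∉ [voterReg, baseReg, placeReg] → s'.var x = s.var x) ∧ s'.arr = s.arr := by
  refine (Runs.seq_assign (Runs.seq_assign (.assign le_rfl ⟨⟨?_, ?_, ?_, ?_⟩, ?_, ?_⟩))).mono
    (by simp) fun _ h => h
  · exact ((h.setVar (by simp) _).setVar (by simp) _).setVar (by simp) _
  · simp [h.voter]
  · simp [h.base, h.cands, add_one_mul, add_assoc]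
  · simp
  · intro x hx
    simp only [List.mem_cons, List.not_mem_nil, or_false, not_or] at hx
    simp [hx]
  · rfl

/-- Numbers the candidates in the first places of a voter. -/
def markRow : Prog :=
  .loop (.sub (.var limitReg) (.var placeReg)) markBody ;; nextVoter

theorem Marking.runs_markRow {v : Fin I.n} (h : Marking I v 0 s) :
    Runs markRow s (I.m * 23 + 14) (Marking I (v + 1) 0) := by
  have hloop := Runs.loop_sub I.limit 19 (Marking I v) (fun i s h => ⟨h.limit, h.place⟩)
    (fun i hi s h => h.runs_markBody (hi.trans_le (min_le_left _ _))) h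
  have hlim : I.limit ≤ I.m := min_le_left _ _
  refine (hloop.seq fun s₁ h₁ => h₁.runs_nextVoter.mono le_rfl ?_).mono (by lia) fun _ h => h
  rintro s₂ ⟨hscan, hvar, harr⟩
  refine ⟨hscan, ?_⟩
  rw [hvar _ (by simp), harr, seen_row]
  exact h₁.marks

/-- Numbers the candidates in the first places of all voters. -/
def markAll : Prog := .loop (.sub (.var votersReg) (.var voterReg)) markRow

theorem Marking.runs_markAll (h : Marking I 0 0 s) :
    Runs markAll s (I.n * (I.m * 23 + 18) + 4) (Marking I I.n 0) :=
  (Runs.loop_sub I.n (I.m * 23 + 14) (fun v => Marking I v 0) (fun v s h => ⟨h.voters, h.voter⟩)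
    (fun v hv s h => h.runs_markRow (v := ⟨v, hv⟩)) h).mono (by lia) fun _ h => h

/-- The candidates in one of the first `I.limit` places of some voter. -/
def Instance.kept (I : Instance) : Finset (Fin I.m) := seen I.P I.limit I.n 0

/-- The kept candidates carry the numbers `μ`, and the compressed table has been filled up to place
`i` of voter `v`. -/
structure Filling (I : Instance) (N : ℕ) (μ : Fin I.m → ℕ) (v i : ℕ) (s : Memory) : Prop
    extends Scanning I v i s where
  marks : Marks I.kept N μ
  count : s.var countReg = N
  numbers : ∀ c : Fin I.m, s.arr numberArr c = μ c
  row : s.var rowReg = v * (N + 1)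
  length : s.var lengthReg = (walk (I.n ^ 2) (numberAt I.P μ v) i).1
  gap : s.var gapReg = (walk (I.n ^ 2) (numberAt I.P μ v) i).2
  filled : Filled I.P I.kept N (I.n ^ 2) μ v i (s.arr tableArr)

/-- Enters the place of a kept candidate into the table. -/
def storePlace : Prog :=
  .put tableArr (.add (.var rowReg) (.get numberArr (.var candReg))) (.var lengthReg) ;;
  lengthReg ::= .add (.var lengthReg) (.num 1) ;;
  gapReg ::= .num 0

/-- Passes over the place of another candidate, without counting it if the gap is long. -/
def extendGap : Prog :=
  .ite (.sub (.add (.var squareReg) (.num 1)) (.var gapReg))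
    (lengthReg ::= .add (.var lengthReg) (.num 1) ;; gapReg ::= .add (.var gapReg) (.num 1))
    (candReg ::= .var candReg)

/-- Processes one place of a ranking. -/
def fillBody : Prog :=
  candReg ::= scanExpr ;;
  placeReg ::= .add (.var placeReg) (.num 1) ;;
  .ite (.get numberArr (.var candReg)) storePlace extendGap

theorem Filling.runs_storePlace {v : Fin I.n} (h : Filling I N μ v i s) (hi : i < I.m)
    (hc : I.P v ⟨i, hi⟩ ∈ I.kept) :
    Runs storePlace ((s.setVar candReg (I.P v ⟨i, hi⟩)).setVar placeReg (i + 1)) 12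
      (Filling I N μ v (i + 1)) := by
  have hwalk : walk (I.n ^ 2) (numberAt I.P μ v) (i + 1) =
      ((walk (I.n ^ 2) (numberAt I.P μ v) i).1 + 1, 0) := by
    rw [walk, if_pos (by rw [numberAt_of_lt _ _ _ hi]; exact h.marks.ne_zero_iff.2 hc)]
  refine (Runs.seq_put (Runs.seq_assign (.assign le_rfl
    ⟨⟨?_, ?_, ?_, ?_⟩, h.marks, ?_, ?_, ?_, ?_, ?_, ?_⟩))).mono (by simp) fun _ h => h
  · exact ((((h.setVar (by simp) _).setVar (by simp) _).setArr (by simp) _ _).setVar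
      (by simp) _).setVar (by simp) _
  · simp [h.voter]
  · simp [h.base]
  · simp
  · simp [h.count]
  · simp [h.numbers]
  · simp [h.row]
  · simp [hwalk, h.length]
  · simp [hwalk]
  · simpa [h.row, h.numbers, h.length] using h.filled.update_entry h.marks.toNumbering hi hc

theorem Filling.runs_extendGap {v : Fin I.n} (h : Filling I N μ v i s) (hi : i < I.m)
    (hc : I.P v ⟨i, hi⟩ ∉ I.kept) :
    Runs extendGap ((s.setVar candReg (I.P v ⟨i, hi⟩)).setVar placeReg (i + 1)) 14
      (Filling I N μ v (i + 1)) := by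
  have hwalk := (walk.eq_2 (I.n ^ 2) (numberAt I.P μ v) i).trans
    (if_neg (by simpa [numberAt_of_lt _ _ _ hi] using h.marks.eq_zero _ hc))
  have hfilled := h.filled.of_notMem hi hc
  refine (Runs.ite (T := 8) (fun he => ?_) fun he => ?_).mono (by simp) fun _ h => h
  · rw [if_pos (by simpa [h.square, h.gap, Nat.sub_eq_zero_iff_le, Nat.lt_succ_iff] using he)]
      at hwalk
    refine (Runs.seq_assign (.assign le_rfl
      ⟨⟨?_, ?_, ?_, ?_⟩, h.marks, ?_, ?_, ?_, ?_, ?_, hfilled⟩)).mono (by simp) fun _ h => h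
    · exact (((h.setVar (by simp) _).setVar (by simp) _).setVar (by simp) _).setVar (by simp) _
    all_goals simp [h.voter, h.base, h.count, h.numbers, h.row, h.length, h.gap, hwalk]
  · rw [if_neg (by simpa [h.square, h.gap, Nat.sub_eq_zero_iff_le] using he)] at hwalk
    refine .assign (by simp) ⟨⟨?_, ?_, ?_, ?_⟩, h.marks, ?_, ?_, ?_, ?_, ?_, hfilled⟩
    · exact ((h.setVar (by simp) _).setVar (by simp) _).setVar (by simp) _
    all_goals simp [h.voter, h.base, h.count, h.numbers, h.row, h.length, h.gap, hwalk]

theorem Filling.runs_fillBody {v : Fin I.n} (h : Filling I N μ v i s) (hi : i < I.m) :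
    Runs fillBody s 26 (Filling I N μ v (i + 1)) := by
  have hcand := h.eval_scanExpr hi
  refine (Runs.seq_assign (Runs.seq_assign (Runs.ite (T := 14) (fun he => ?_) fun he => ?_))).mono
    (by simp [scanExpr]) fun _ h => h <;> rw [hcand] at he ⊢
  · have hc : I.P v ⟨i, hi⟩ ∈ I.kept := h.marks.ne_zero_iff.1 (by simpa [h.numbers] using he)
    simpa [h.place] using (h.runs_storePlace hi hc).mono (by simp) fun _ h => h
  · have hc : I.P v ⟨i, hi⟩ ∉ I.kept := fun hc =>
      h.marks.ne_zero_iff.2 hc (by simpa [h.numbers] using he)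
    simpa [h.place] using h.runs_extendGap hi hc

/-- Enters the length of a complete row and prepares the next row. -/
def endRow : Prog :=
  .put tableArr (.var rowReg) (.var lengthReg) ;;
  rowReg ::= .add (.var rowReg) (.add (.var countReg) (.num 1)) ;;
  lengthReg ::= .num 0 ;;
  gapReg ::= .num 0 ;;
  nextVoter

theorem Filling.runs_endRow {v : Fin I.n} (h : Filling I N μ v I.m s) :
    Runs endRow s 23 (Filling I N μ (v + 1) 0) := by
  have hscan : Scanning I v I.m ((((s.setArr tableArr (s.var rowReg) (s.var lengthReg)).setVar
      rowReg (s.var rowReg + (s.var countReg + 1))).setVar lengthReg 0).setVar gapReg 0) :=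
    ⟨(((h.setArr (by simp) _ _).setVar (by simp) _).setVar (by simp) _).setVar (by simp) _,
      by simp [h.voter], by simp [h.base], by simp [h.place]⟩
  refine (Runs.seq_put (Runs.seq_assign (Runs.seq_assign (Runs.seq_assign (T := 10) ?_)))).mono
    (by simp) fun _ h => h
  simp only [Expr.eval, Memory.setArr_var]
  refine hscan.runs_nextVoter.mono le_rfl ?_
  rintro s' ⟨hscan, hvar, harr⟩
  refine ⟨hscan, h.marks, ?_, ?_, ?_, ?_, ?_, ?_⟩
  · simp [hvar, h.count]
  · simp [harr, h.numbers]
  · simp [hvar, h.row, h.count, add_one_mul]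
  · simp [hvar, walk]
  · simp [hvar, walk]
  · simpa [harr, h.row, h.length] using h.filled.update_end h.marks.toNumbering

/-- Fills a row of the table. -/
def fillRow : Prog := .loop (.sub (.var candsReg) (.var placeReg)) fillBody ;; endRow

theorem Filling.runs_fillRow {v : Fin I.n} (h : Filling I N μ v 0 s) :
    Runs fillRow s (I.m * 30 + 27) (Filling I N μ (v + 1) 0) :=
  ((Runs.loop_sub I.m 26 (Filling I N μ v) (fun i s h => ⟨h.cands, h.place⟩)
    (fun i hi s h => h.runs_fillBody hi) h).seq fun _ h => h.runs_endRow).mono (by lia) fun _ h => h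

/-- Fills the table. -/
def fillAll : Prog := .loop (.sub (.var votersReg) (.var voterReg)) fillRow

theorem Filling.runs_fillAll (h : Filling I N μ 0 0 s) :
    Runs fillAll s (I.n * (I.m * 30 + 31) + 4) (Filling I N μ I.n 0) :=
  (Runs.loop_sub I.n (I.m * 30 + 27) (fun v => Filling I N μ v 0) (fun v s h => ⟨h.voters, h.voter⟩)
    (fun v hv s h => h.runs_fillRow (v := ⟨v, hv⟩)) h).mono (by lia) fun _ h => h

/-- Prepares the second scan of the input. -/
def resetScan : Prog :=
  voterReg ::= .num 0 ;;
  baseReg ::= .num 4 ;;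
  rowReg ::= .num 0 ;;
  lengthReg ::= .num 0 ;;
  gapReg ::= .num 0

theorem Marking.runs_resetScan (h : Marking I I.n 0 s) :
    Runs resetScan s 10
      (Filling I (s.var countReg) (fun c => s.arr numberArr c) 0 0) := by
  refine (Runs.seq_assign (Runs.seq_assign (Runs.seq_assign (Runs.seq_assign (.assign le_rfl
    ⟨⟨?_, ?_, ?_, ?_⟩, h.marks, ?_, ?_, ?_, ?_, ?_, filled_zero _ _ _ _ _ _⟩))))).mono
    (by simp) fun _ h => h
  · exact ((((h.setVar (by simp) _).setVar (by simp) _).setVar (by simp) _).setVar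
      (by simp) _).setVar (by simp) _
  all_goals simp [h.place, walk]

/-- Numbers the relevant candidates and fills the table. -/
def compress : Prog := markAll ;; resetScan ;; fillAll

theorem Marking.runs_compress (h : Marking I 0 0 s) :
    Runs compress s (I.n * (I.m * 53 + 49) + 18) fun s' => ∃ N μ, Filling I N μ I.n 0 s' :=
  (h.runs_markAll.seq fun _ h => h.runs_resetScan.seq fun _ h =>
    h.runs_fillAll.mono le_rfl fun _ h => ⟨_, _, h⟩).mono (by lia) fun _ h => h

/-- The minimum of the values of `e` and `e'`, in terms of truncated subtraction. -/
def minExpr (e e' : Expr) : Expr := .sub e (.sub e e')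

@[simp]
theorem eval_minExpr (e e' : Expr) (s : Memory) :
    (minExpr e e').eval s = min (e.eval s) (e'.eval s) :=
  Nat.sub_sub_eq_min _ _

/-- Reads the four numbers in front of the rankings. -/
def readNumbers : Prog :=
  votersReg ::= .get inputArr (.num 0) ;;
  candsReg ::= .get inputArr (.num 1) ;;
  sizeReg ::= .get inputArr (.num 2) ;;
  budgetReg ::= .get inputArr (.num 3)

theorem runs_readNumbers (I : Instance) :
    Runs readNumbers (initMemory I.encode) 12 fun s =>
      s.var votersReg = I.n ∧ s.var candsReg = I.m ∧ s.var sizeReg = I.k ∧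
        s.var budgetReg = I.B ∧ (∀ x, budgetReg < x → s.var x = 0) ∧
        s.arr = (initMemory I.encode).arr := by
  refine (Runs.seq_assign (Runs.seq_assign (Runs.seq_assign (.assign le_rfl
    ⟨?_, ?_, ?_, ?_, fun x hx => ?_, rfl⟩)))).mono (by simp) fun _ h => h
  iterate 4 simp [initMemory, Instance.encode]
  simp [initMemory, show x ≠ 1 ∧ x ≠ 2 ∧ x ≠ 3 ∧ x ≠ 4 by lia]

/-- Computes the numbers that control the compression, given the square of the number of voters,
and starts the first scan of the input. -/
def startScan : Prog :=
  squareReg ::= .var scratchReg ;;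
  limitReg ::= minExpr (.var candsReg) (.add (.var squareReg) (.var votersReg)) ;;
  budgetReg ::= minExpr (.var budgetReg) (.var squareReg) ;;
  sizeReg ::= minExpr (.var sizeReg) (.add (.var votersReg) (.num 1)) ;;
  baseReg ::= .num 4

theorem runs_startScan (hn : s.var votersReg = I.n) (hm : s.var candsReg = I.m)
    (hk : s.var sizeReg = I.k) (hB : s.var budgetReg = I.B)
    (h0 : ∀ x, budgetReg < x → x < scratchReg → s.var x = 0)
    (hsq : s.var scratchReg = I.n ^ 2) (harr : s.arr = (initMemory I.encode).arr) :
    Runs startScan s 26 (Marking I 0 0) := by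
  refine (Runs.seq_assign (Runs.seq_assign (Runs.seq_assign (Runs.seq_assign (.assign le_rfl
    ⟨⟨⟨?_, ?_, ?_, ?_, ?_, ?_, fun j => ?_⟩, ?_, ?_, ?_⟩, ?_⟩))))).mono
    (by simp [minExpr]) fun _ h => h
  any_goals simp [hn, hm, hk, hB, h0, hsq, harr, Instance.limit, initMemory]
  simpa [seen_zero] using Marks.empty

theorem primrec_sq : Primrec fun n : ℕ => n ^ 2 :=
  (Primrec.nat_mul.comp .id .id).of_eq fun n => (sq n).symm

theorem exists_prog_marking : ∃ (p : Prog) (T : ℕ → ℕ), Primrec T ∧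
    ∀ I : Instance, Runs p (initMemory I.encode) (T I.n) (Marking I 0 0) := by
  obtain ⟨T, hT, h⟩ := exists_prog_of_primrec primrec_sq
  obtain ⟨p, hp⟩ := h scratchReg votersReg (by simp)
  refine ⟨readNumbers ;; p ;; startScan, fun n => 12 + (T n + 26),
    Primrec.nat_add.comp (.const 12) (Primrec.nat_add.comp hT (.const 26)), fun I => ?_⟩
  refine (runs_readNumbers I).seq fun s₁ ⟨hn, hm, hk, hB, h0, harr⟩ => ?_
  have hps := hp s₁
  rw [hn] at hps
  refine hps.seq fun s₂ ⟨hsq, hvar, harr₂⟩ => runs_startScan ?_ ?_ ?_ ?_ ?_ hsq (harr₂.trans harr)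
  · rw [hvar _ (by simp), hn]
  · rw [hvar _ (by simp), hm]
  · rw [hvar _ (by simp), hk]
  · rw [hvar _ (by simp), hB]
  · exact fun x hx hx' => (hvar x hx').trans (h0 x hx)

theorem exists_prog_push : ∃ T : ℕ → ℕ → ℕ, Primrec₂ T ∧ ∀ x < scratchReg, ∃ p,
    ∀ (s : Memory) (l : List ℕ) (E len : ℕ), s.var codeReg = Encodable.encode l →
      (∀ a ∈ s.var x :: l, a ≤ E) → l.length ≤ len → Runs p s (T E len) fun s' =>
        s'.var codeReg = Encodable.encode (s.var x :: l) ∧ KeepsBelow codeReg s s' := by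
  obtain ⟨T, hT, h⟩ :=
    exists_prog_of_primrec₂ (f := fun a b => (Nat.pair a b).succ) (Primrec.succ.comp₂ .natPair)
  obtain ⟨T', hT', hmono, hle⟩ := exists_monotone_primrec₂_bound hT
  refine ⟨fun E len => T' E (codeBound E len) + 2, Primrec.nat_add.comp
    (hT'.comp .fst primrec₂_codeBound) (.const 2), fun x hx => ?_⟩
  obtain ⟨p, hp⟩ := h scratchReg x codeReg hx (by simp)
  refine ⟨p ;; codeReg ::= .var scratchReg, fun s l E len hl ha hlen => ?_⟩
  rw [List.forall_mem_cons] at ha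
  have hcode : Encodable.encode l ≤ codeBound E len :=
    (encode_le_codeBound ha.2).trans (codeBound_monotone E hlen)
  refine ((hp s).mono ?_ fun _ h => h).seq fun s' ⟨hval, hs'⟩ =>
    .assign le_rfl ⟨?_, (hs'.mono (by simp)).setVar le_rfl _⟩
  · rw [hl]
    exact (hle _ _).trans (hmono _ _ _ _ ha.1 hcode)
  · simp [hval, hl, Encodable.encode_list_cons]

theorem exists_prog_pushAll (xs : List ℕ) (hxs : ∀ x ∈ xs, x < codeReg) :
    ∃ T : ℕ → ℕ → ℕ, Primrec₂ T ∧ ∃ p, ∀ (s : Memory) (l : List ℕ) (E : ℕ),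
      s.var codeReg = Encodable.encode l → (∀ a ∈ xs.map s.var ++ l, a ≤ E) →
      Runs p s (T E l.length) fun s' =>
        s'.var codeReg = Encodable.encode (xs.map s.var ++ l) ∧ KeepsBelow codeReg s s' := by
  induction xs with
  | nil =>
    refine ⟨fun _ _ => 2, .const 2, codeReg ::= .var codeReg, fun s l E hl _ => ?_⟩
    exact .assign le_rfl ⟨by simpa using hl, (KeepsBelow.refl _ s).setVar le_rfl _⟩
  | cons x xs ih =>
    rw [List.forall_mem_cons] at hxs
    obtain ⟨T, hT, p, hp⟩ := ih hxs.2
    obtain ⟨T', hT', h'⟩ := exists_prog_push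
    obtain ⟨p', hp'⟩ := h' x (hxs.1.trans (by simp))
    refine ⟨fun E len => T E len + T' E (xs.length + len), Primrec.nat_add.comp hT
      (hT'.comp .fst (Primrec.nat_add.comp (.const _) .snd)), p ;; p', fun s l E hl ha => ?_⟩
    rw [List.map_cons, List.cons_append] at ha ⊢
    refine (hp s l E hl fun a h => ha a (.tail _ h)).seq fun s₁ ⟨hval, hs₁⟩ => ?_
    rw [← hs₁.1 x hxs.1] at ha ⊢
    exact (hp' s₁ _ E _ hval ha (by simp)).mono le_rfl fun s₂ ⟨hval₂, hs₂⟩ =>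
      ⟨hval₂, hs₁.trans hs₂⟩

/-- Puts the entries of the table, from the last one down to the first one, in front of the coded
list, where the program `p` pushes one of them. -/
def encodeTable (p : Prog) : Prog :=
  codeReg ::= .num 0 ;;
  .loop (.var rowReg)
    (rowReg ::= .sub (.var rowReg) (.num 1) ;; itemReg ::= .get tableArr (.var rowReg) ;; p)

theorem exists_prog_encodeTable : ∃ T : ℕ → ℕ → ℕ, Primrec₂ T ∧ ∃ p, ∀ (s : Memory) (M E : ℕ),
    s.var rowReg = M → (∀ j < M, s.arr tableArr j ≤ E) → Runs p s (T E M) fun s' =>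
      s'.var codeReg = Encodable.encode ((List.range M).map (s.arr tableArr)) ∧
        KeepsBelow rowReg s s' := by
  obtain ⟨T, hT, h⟩ := exists_prog_push
  obtain ⟨p, hp⟩ := h itemReg (by simp)
  refine ⟨fun E M => 2 + (M * (2 + (4 + (3 + T E M))) + 2), Primrec.nat_add.comp (.const 2)
    (Primrec.nat_add.comp (Primrec.nat_mul.comp .snd (Primrec.nat_add.comp (.const 2)
      (Primrec.nat_add.comp (.const 4) (Primrec.nat_add.comp (.const 3) hT)))) (.const 2)),
    encodeTable p, fun s M E hM hE => ?_⟩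
  set l := (List.range M).map (s.arr tableArr) with hl
  have hlen : l.length = M := by simp [hl]
  have hlE : ∀ a ∈ l, a ≤ E := by simpa [hl] using hE
  refine (Runs.seq_assign (Runs.loop M _ (fun j s' => s'.var rowReg = M - j ∧
    s'.var codeReg = Encodable.encode (l.drop (M - j)) ∧ KeepsBelow rowReg s s')
    (fun j hj s₁ ⟨hrow, hcode, hs₁⟩ => ⟨?_, Runs.seq_assign (Runs.seq_assign (T := T E M) ?_)⟩)
    (fun s₁ h => ?_) ⟨?_, ?_, ?_⟩)).mono (by simp) fun s' h => ?_
  · simp only [Expr.eval, hrow]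
    lia
  · have hj' : M - (j + 1) < l.length := by lia
    have hdrop : l[M - (j + 1)] :: l.drop (M - j) = l.drop (M - (j + 1)) := by
      rw [List.drop_eq_getElem_cons hj', show M - (j + 1) + 1 = M - j by lia]
    have hitem : s.arr tableArr (M - j - 1) = l[M - (j + 1)] := by simp [hl, Nat.sub_sub]
    simp only [Expr.eval, hrow, Memory.setVar_var, Memory.setVar_arr, hs₁.2, hitem, if_true]
    refine (hp _ (l.drop (M - j)) E M (by simpa using hcode) ?_ (by simp; lia)).mono le_rfl ?_
    · simpa [hdrop] using fun a h => hlE a (List.mem_of_mem_drop h)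
    · rintro s₂ ⟨hcode₂, hs₂⟩
      refine ⟨?_, by simpa [hdrop] using hcode₂, ?_⟩
      · rw [hs₂.1 _ (by simp)]
        simp [Nat.sub_sub]
      · exact ((hs₁.setVar le_rfl _).setVar (by simp) _).trans (hs₂.mono (by simp))
  · simp [h.1]
  · simp [hM]
  · simp [List.drop_eq_nil_of_le hlen.le]
  · exact (KeepsBelow.refl _ s).setVar (by simp) _
  · simpa using h.2

theorem exists_prog_answerCode : ∃ T : ℕ → ℕ → ℕ, Primrec₂ T ∧ ∃ p, ∀ (s : Memory) (M E : ℕ),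
    s.var rowReg = M → (∀ j < M, s.arr tableArr j ≤ E) →
    (∀ x ∈ [votersReg, sizeReg, budgetReg, countReg], s.var x ≤ E) →
    Runs p s (T E M) fun s' => s'.var acceptReg = answerCode (Encodable.encode
      (s.var votersReg :: s.var sizeReg :: s.var budgetReg :: s.var countReg ::
        (List.range M).map (s.arr tableArr))) := by
  obtain ⟨T₁, hT₁, p₁, h₁⟩ := exists_prog_encodeTable
  obtain ⟨T₂, hT₂, p₂, h₂⟩ :=
    exists_prog_pushAll [votersReg, sizeReg, budgetReg, countReg] (by simp)
  obtain ⟨T₃, hT₃, h⟩ := exists_prog_of_primrec primrec_answerCode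
  obtain ⟨p₃, h₃⟩ := h scratchReg codeReg (by simp)
  obtain ⟨T₃', hT₃', hmono, hle⟩ := exists_monotone_primrec_bound hT₃
  refine ⟨fun E M => T₁ E M + (T₂ E M + (T₃' (codeBound E (4 + M)) + 2)),
    Primrec.nat_add.comp hT₁ (Primrec.nat_add.comp hT₂ (Primrec.nat_add.comp (hT₃'.comp
      (primrec₂_codeBound.comp .fst (Primrec.nat_add.comp (.const 4) .snd))) (.const 2))),
    p₁ ;; p₂ ;; p₃ ;; acceptReg ::= .var scratchReg, fun s M E hM hE hx => ?_⟩
  set l := (List.range M).map (s.arr tableArr) with hl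
  have hlen : l.length = M := by simp [hl]
  refine (h₁ s M E hM hE).seq fun s₁ ⟨hcode₁, hs₁⟩ => ?_
  have hxs : [votersReg, sizeReg, budgetReg, countReg].map s₁.var =
      [votersReg, sizeReg, budgetReg, countReg].map s.var := by
    simp [hs₁.1]
  have hall : ∀ a ∈ [votersReg, sizeReg, budgetReg, countReg].map s.var ++ l, a ≤ E :=
    List.forall_mem_append.2 ⟨List.forall_mem_map.2 hx, by simpa [hl] using hE⟩
  have hps := h₂ s₁ l E hcode₁ (hxs ▸ hall)
  rw [hxs, hlen] at hps
  refine hps.seq fun s₂ ⟨hcode₂, _⟩ => ((h₃ s₂).mono ?_ fun _ h => h).seq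
    fun s₃ ⟨hval, _⟩ => .assign le_rfl ?_
  · rw [hcode₂]
    refine (hle _).trans (hmono ((encode_le_codeBound hall).trans_eq ?_))
    rw [List.length_append, hlen]
    rfl
  · simp [hval, hcode₂]

/-- A bound on the number of candidates that are kept, in terms of the number of voters. -/
def countBound (n : ℕ) : ℕ := n * (n ^ 2 + n)

/-- A bound on the numbers in the compressed table, in terms of the number of voters. -/
def entryBound (n : ℕ) : ℕ := countBound n * (n ^ 2 + 2) + (n ^ 2 + 1) + n

theorem primrec_countBound : Primrec countBound :=
  Primrec.nat_mul.comp .id (Primrec.nat_add.comp primrec_sq .id)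

theorem primrec_entryBound : Primrec entryBound :=
  Primrec.nat_add.comp (Primrec.nat_add.comp (Primrec.nat_mul.comp primrec_countBound
    (Primrec.nat_add.comp primrec_sq (.const 2))) (Primrec.nat_add.comp primrec_sq (.const 1))) .id

theorem Filling.le_countBound (h : Filling I N μ I.n 0 s) : N ≤ countBound I.n :=
  h.marks.card.symm.trans_le ((card_seen_le I.P I.limit).trans
    (Nat.mul_le_mul_left _ (min_le_right _ _)))

theorem Filling.table_le_entryBound (h : Filling I N μ I.n 0 s) {j : ℕ}
    (hj : j < I.n * (N + 1)) : s.arr tableArr j ≤ entryBound I.n := by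
  have := h.filled.le h.marks hj
  have := Nat.mul_le_mul_right (I.n ^ 2 + 2) h.le_countBound
  rw [entryBound]
  lia

theorem Filling.var_le_entryBound (h : Filling I N μ I.n 0 s) :
    ∀ x ∈ [votersReg, sizeReg, budgetReg, countReg], s.var x ≤ entryBound I.n := by
  have hN : N ≤ countBound I.n * (I.n ^ 2 + 2) :=
    h.le_countBound.trans (Nat.le_mul_of_pos_right _ (by lia))
  simp only [List.forall_mem_cons, List.not_mem_nil, IsEmpty.forall_iff, implies_true, and_true,
    h.voters, h.size, h.budget, h.count, entryBound]
  lia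

theorem Filling.canChange_iff (h : Filling I N μ I.n 0 s) :
    CanChange I.P I.k I.B ↔ answerCode (Encodable.encode
      (s.var votersReg :: s.var sizeReg :: s.var budgetReg :: s.var countReg ::
        tableList (s.arr tableArr) I.n N)) ≠ 0 := by
  rw [answerCode_encode_ne_zero_iff, h.voters, h.size, h.budget, h.count]
  exact canChange_iff_tableAnswer h.marks.toNumbering (length_tableList _ _ _)
    (h.filled.similar h.marks.toNumbering)

theorem exists_prog_canChange : ∃ (p : Prog) (T : ℕ → ℕ), Primrec T ∧
    ∀ (I : Instance) (N : ℕ) (μ : Fin I.m → ℕ) (s : Memory), Filling I N μ I.n 0 s →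
      Runs p s (T I.n) fun s' => s'.var acceptReg ≠ 0 ↔ CanChange I.P I.k I.B := by
  obtain ⟨T, hT, p, hp⟩ := exists_prog_answerCode
  obtain ⟨T', hT', hmono, hle⟩ := exists_monotone_primrec₂_bound hT
  refine ⟨p, fun n => T' (entryBound n) (n * (countBound n + 1)), hT'.comp primrec_entryBound
    (Primrec.nat_mul.comp .id (Primrec.succ.comp primrec_countBound)), fun I N μ s h => ?_⟩
  refine (hp s (I.n * (N + 1)) (entryBound I.n) h.row (fun j => h.table_le_entryBound)
    h.var_le_entryBound).mono ((hle _ _).trans (hmono _ _ _ _ le_rfl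
      (Nat.mul_le_mul_left _ (Nat.succ_le_succ h.le_countBound)))) fun s' hs' => ?_
  rw [hs', h.canChange_iff, tableList]

theorem isFPT_canChange :
    IsFPT Instance.encode (fun I => I.n) fun I => CanChange I.P I.k I.B := by
  obtain ⟨p, T, hT, hp⟩ := exists_prog_marking
  obtain ⟨q, U, hU, hq⟩ := exists_prog_canChange
  refine ⟨p ;; compress ;; q, fun n => T n + U n + n * 49 + 53, 1,
    (Primrec.nat_add.comp (Primrec.nat_add.comp (Primrec.nat_add.comp hT hU)
      (Primrec.nat_mul.comp .id (.const 49))) (.const 53)).to_comp, fun I => ?_⟩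
  obtain ⟨t, s, hexec, ht, hs⟩ := (hp I).seq fun s₁ h₁ => h₁.runs_compress.seq
    fun s₂ ⟨N, μ, h₂⟩ => hq I N μ s₂ h₂
  refine ⟨t, s, hexec, ht.trans ?_, hs⟩
  calc T I.n + (I.n * (I.m * 53 + 49) + 18 + U I.n)
      ≤ (T I.n + U I.n + I.n * 49 + 53) * (4 + I.n * I.m) := by
        nlinarith [Nat.zero_le ((T I.n + U I.n + I.n * 49) * (3 + I.n * I.m))]
    _ ≤ (T I.n + U I.n + I.n * 49 + 53) * bitLength I.encode ^ 1 := by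
        rw [pow_one]
        exact Nat.mul_le_mul_left _ I.le_bitLength_encode

end Algorithm

end STVRobust

open STVRobust in
theorem mainTheorem12_general :
    IsFPT Instance.encode (fun I => I.n) (fun I => CanChange I.P I.k I.B) ∧
    (∀ (n m k : ℕ) (P : Profile n m) (c : Fin m), n < rank P c → ∀ W ∈ STV P k, c ∉ W) ∧
    (∀ (n m k : ℕ) (P : Profile n m), Normal n k → 1 ≤ k → k < m → CanChange P k (n * k)) ∧
    (∀ (n m k B : ℕ) (P : Profile n m), CanChange P k B →
      CanChangeWith {c | rank P c ≤ n * (k + 1)} P k (min B (n * k))) :=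
  ⟨isFPT_canChange, fun _ _ _ _ _ hc _ hW => notMem_of_mem_STV_of_lt_rank hc hW,
    fun _ _ _ P hN h1 hk => (canChangeWith_mul P hN h1 hk).mono (Set.subset_univ _) le_rfl,
    fun _ _ _ _ _ h => h.canChangeWith_min⟩

theorem mainTheorem12 :
    -- STV Robustness Radius, for normal committee sizes, is FPT in the number of voters
    STVRobust.IsFPT
      (fun I : {I : STVRobust.Instance // STVRobust.Normal I.n I.k} => I.1.encode)
      (fun I => I.1.n)
      (fun I => STVRobust.CanChange I.1.P I.1.k I.1.B) ∧
    -- candidates of rank above `n` belong to no winning committee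
    (∀ (n m k : ℕ) (P : STVRobust.Profile n m), STVRobust.Normal n k →
      ∀ c : Fin m, n < STVRobust.rank P c → ∀ W ∈ STVRobust.STV P k, c ∉ W) ∧
    -- the robustness radius is at most `n ^ 2`
    (∀ (n m k : ℕ) (P : STVRobust.Profile n m), STVRobust.Normal n k → 1 ≤ k → k < m →
      STVRobust.CanChange P k (n ^ 2)) ∧
    -- only swaps that move a candidate of rank at most `n ^ 2 + n + 1` matter
    (∀ (n m k B : ℕ) (P : STVRobust.Profile n m), STVRobust.Normal n k →
      STVRobust.CanChange P k B →
      STVRobust.CanChangeWith {c | STVRobust.rank P c ≤ n ^ 2 + n + 1} P k (min B (n ^ 2))) := by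
  obtain ⟨⟨p, f, c, hf, hfpt⟩, hrank, hradius, hswaps⟩ := mainTheorem12_general
  refine ⟨⟨p, f, c, hf, fun I => hfpt I.1⟩, fun n m k P _ => hrank n m k P,
    fun n m k P hN h1 hk => (hradius n m k P hN h1 hk).mono subset_rfl ?_,
    fun n m k B P hN h => (hswaps n m k B P h).mono
      (Set.ofPred_subset_ofPred.2 fun c hc => hc.trans ?_) (min_le_min_left B ?_)⟩
  all_goals nlinarith [hN.le]
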